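/- Let $\mu,R>0$. For $\delta>0$ let $D_1,D_2\subset\mathbb R^2$ be the disks of radius $R$ centred at $(-R-\delta/2,0)$ and $(R+\delta/2,0)$, let $D^e=\mathbb R^2\setminus\overline{D_1\cup D_2}$, and let $$\Pi_\delta=\big([-R-\delta/2,\,R+\delta/2]\times[-\sqrt\delta,\sqrt\delta]\big)\cap D^e .$$ For a velocity field $\mathbf u$ and a pressure $p$ put $\mathcal E[\mathbf u]=\frac12(\nabla\mathbf u+\nabla\mathbf u^T)$ and $\sigma[\mathbf u,p]=-pI+2\mu\,\mathcal E[\mathbf u]$. Let $\|\cdot\|_\infty$ be the supremum norm on $D^e$. The singular function $(\mathbf h_2,p_2)$ is the unique classical solution ($\mathbf h_2\in C^2(D^e)\cap C^1(\overline{D^e})$, $p_2\in C^1(D^e)\cap C(\overline{D^e})$) of $$\mu\Delta\mathbf h_2=\nabla p_2,\quad \nabla\cdot\mathbf h_2=0\ \text{ in } D^e,\qquad \mathbf h_2=-\tfrac12\mathbf e_y\ \text{ on }\partial D_1,\quad \mathbf h_2=\tfrac12\mathbf e_y\ \text{ on }\partial D_2,$$ such that, as $|\mathbf x|\to\infty$,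 $\mathbf h_2(\mathbf x)=\mathbf C+O(|\mathbf x|^{-1})$ for some constant $\mathbf C\in\mathbb R^2$, $\nabla\mathbf h_2(\mathbf x)=O(|\mathbf x|^{-2})$ and $p_2(\mathbf x)=O(|\mathbf x|^{-2})$. Proposition. There are constants $\delta_0,c,C>0$, depending only on $\mu$ and $R$, such that for every $0<\delta<\delta_0$ the singular function $(\mathbf h_2,p_2)$ exists, is unique, and satisfies $$c\,\delta^{-1}\le\|\mathcal E[\mathbf h_2]\|_\infty\le C\,\delta^{-1},\qquad c\,\delta^{-1/2}\le\|p_2\|_\infty\le C\,\delta^{-1/2},$$ and, for all $(x,y)\in\Pi_\delta$, $$\Big|\,\sigma[\mathbf h_2,p_2](x,y)-\mu\,\delta^{-1}\,\frac{R\delta}{y^2+R\delta}\begin{bmatrix}0&1\\1&0\end{bmatrix}\Big|\le C\,\delta^{-1/2}.$$ -/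

import Mathlib

open Filter Asymptotics
open scoped ENNReal Laplacian Gradient

-- Matrices carry the Frobenius norm.
attribute [local instance] Matrix.frobeniusNormedAddCommGroup

noncomputable section

namespace StokesCylinders

/-- The Euclidean plane, with coordinates `x = z 0` and `y = z 1`. -/
abbrev Plane : Type := EuclideanSpace ℝ (Fin 2)

/-- The standard unit vectors `e 0 = e_x` and `e 1 = e_y`. -/
def e (i : Fin 2) : Plane := EuclideanSpace.single i 1

/-- The centre `(-R - δ/2, 0)` of the left disk. -/
def leftCenter (R δ : ℝ) : Plane := !₂[-R - δ / 2, 0]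

/-- The centre `(R + δ/2, 0)` of the right disk. -/
def rightCenter (R δ : ℝ) : Plane := !₂[R + δ / 2, 0]

/-- The exterior domain: the complement of the two closed disks of radius `R`, which are at
distance `δ` from each other. -/
def exteriorDomain (R δ : ℝ) : Set Plane :=
  (Metric.closedBall (leftCenter R δ) R ∪ Metric.closedBall (rightCenter R δ) R)ᶜ

/-- The narrow region between the disks:
`([-R - δ/2, R + δ/2] × [-√δ, √δ]) ∩ exteriorDomain R δ`. -/
def narrowRegion (R δ : ℝ) : Set Plane :=
  {z | z 0 ∈ Set.Icc (-R - δ / 2) (R + δ / 2) ∧ z 1 ∈ Set.Icc (-√δ) √δ} ∩ exteriorDomain R δ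

/-- The entry `∂_j u_i` of the velocity gradient. -/
def velocityGradient (u : Plane → Plane) (z : Plane) : Matrix (Fin 2) (Fin 2) ℝ :=
  Matrix.of fun i j => (fderiv ℝ u z (e j)) i

/-- The divergence `∂_x u_x + ∂_y u_y`. -/
def divergence (u : Plane → Plane) (z : Plane) : ℝ := (velocityGradient u z).trace

/-- The strain tensor `(∇u + ∇uᵀ) / 2`. -/
def strain (u : Plane → Plane) (z : Plane) : Matrix (Fin 2) (Fin 2) ℝ :=
  (1 / 2 : ℝ) • (velocityGradient u z + (velocityGradient u z).transpose)

/-- The stress tensor `-p I + 2 μ ℰ[u]`. -/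
def stress (μ : ℝ) (u : Plane → Plane) (p : Plane → ℝ) (z : Plane) :
    Matrix (Fin 2) (Fin 2) ℝ :=
  -(p z) • (1 : Matrix (Fin 2) (Fin 2) ℝ) + (2 * μ) • strain u z

/-- The supremum norm of `f` on `Ω`, with value `∞` if `f` is unbounded on `Ω`. -/
def supNorm {F : Type*} [NormedAddCommGroup F] (Ω : Set Plane) (f : Plane → F) : ℝ≥0∞ :=
  ⨆ z ∈ Ω, ‖f z‖ₑ

/-- Classical solutions of the homogeneous Stokes system `μ Δu = ∇p`, `∇ ⬝ u = 0` in `Ω`, with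
`∇u` and `p` (hence the stress) continuous up to the boundary of `Ω`. -/
structure IsStokesSolution (μ : ℝ) (Ω : Set Plane) (u : Plane → Plane) (p : Plane → ℝ) :
    Prop where
  contDiffOn_velocity : ContDiffOn ℝ 2 u Ω
  contDiffOn_pressure : ContDiffOn ℝ 1 p Ω
  contDiffOn_velocity_closure : ContDiffOn ℝ 1 u (closure Ω)
  continuousOn_pressure_closure : ContinuousOn p (closure Ω)
  momentum : ∀ z ∈ Ω, μ • (Δ u) z = ∇ p z
  incompressible : ∀ z ∈ Ω, divergence u z = 0

/-- The decay class at infinity: `u = C + O(|z|⁻¹)` for some constant vector `C`,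
`∇u = O(|z|⁻²)` and `p = O(|z|⁻²)`. -/
structure HasDecay (u : Plane → Plane) (p : Plane → ℝ) : Prop where
  velocity : ∃ C : Plane, (fun z => u z - C) =O[Bornology.cobounded Plane] fun z => ‖z‖⁻¹
  gradient : fderiv ℝ u =O[Bornology.cobounded Plane] fun z => (‖z‖ ^ 2)⁻¹
  pressure : p =O[Bornology.cobounded Plane] fun z => (‖z‖ ^ 2)⁻¹

/-- `(u, p)` is a solution of the exterior Stokes problem that defines the singular function
`(h₂, p₂)`: the boundary value is `-e_y / 2` on the left circle and `e_y / 2` on the right one. -/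
structure IsSingularFunctionTwo (μ R δ : ℝ) (u : Plane → Plane) (p : Plane → ℝ) : Prop where
  stokes : IsStokesSolution μ (exteriorDomain R δ) u p
  boundary_left : ∀ z ∈ Metric.sphere (leftCenter R δ) R, u z = -(1 / 2 : ℝ) • e 1
  boundary_right : ∀ z ∈ Metric.sphere (rightCenter R δ) R, u z = (1 / 2 : ℝ) • e 1
  decay : HasDecay u p

end StokesCylinders

end

/-! Uniqueness is an energy argument. For the difference (u, p) of two solutions the field μ∇u·u −
pu has divergence μ|∇u|², and the decay makes its flux at infinity negligible. Instead of
integrating by parts up to the circles, the flux is multiplied by g(|u|²), where g vanishes near 0,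
so that its extension by zero is C¹ on the whole plane. A logarithmic g, for which r g'(r) is small,
keeps the additional term small. Hence ∇u = 0 wherever u ≠ 0 (`fderiv_eq_zero_of_energy`),
connectedness of the plane forces u = 0, and the pressure is constant along vertical rays, hence
zero (`IsSingularFunctionTwo.eqOn`).

Existence is by an explicit formula. The velocity is written −iV with V = 2 ∂Φ/∂z̄ = G + z Π̄ + L̄
(Goursat). The pressure is then −4μ Im Π, and the strain is read off from Q, the conjugate of
∂V/∂z̄. Put t = (z + a)/(z − a) with a = R sinh s and δ = 2R(cosh s − 1). The fluid fills e⁻ˢ < |t|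
< eˢ, infinity is t = 1, and z ↦ −z becomes t ↦ t⁻¹. The stream function c x log|t| + r|z|² can be
given the right boundary values, but r|z|² is a rigid rotation at infinity. It is removed by a
multiple K of a clamped flow, which vanishes on both circles and for which Π is real and positive at
t = 1. The clamped flow is a Laurent series whose coefficients solve a 2×2 system in each mode, and
the boundary condition then telescopes (`clampedSeries_boundary`). Once Π(1) = 0, the symmetry t ↦
t⁻¹ makes Π = O((t − 1)²), which is the required decay.

Estimates. Here s is comparable to √(δ/R). The explicit part carries all leading terms: its
coefficient is c ≈ −1/(4s), and in the gap Q ≈ 2ac/(a² − z²) ≈ −R/(2(y² + Rδ)), of size s⁻². Its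
pressure is smaller by a factor s, since Im(t + t⁻¹) = Im t · (1 − |t|⁻²). It remains to show that
the clamped part contributes only O(s^(−1/2)), and this has three ingredients. The value of the
clamped series at infinity is at least a multiple of s² (`le_clampedLimit`), so K is at most of
order a/s. The Laurent coefficients of its Π are finite differences, with step 2s, of profiles
controlled uniformly in s (`coeffH_eq`), so Π = O(s^(3/2)/a²). Finally, on the circles, where V
vanishes, |Q| ≤ 2|Π|; the maximum principle for a holomorphic function N close to Q carries this
bound inside (`norm_flowN_le_of_circles`). -/

noncomputable section

namespace StokesCylinders

section

open Complex ComplexConjugate Topology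

/-! ### Wirtinger calculus and the Goursat representation -/

/-- The real-linear map `h ↦ a h + b h̄`. -/
def wirtinger (a b : ℂ) : ℂ →L[ℝ] ℂ :=
  a • (1 : ℂ →L[ℝ] ℂ) + b • (conjCLE : ℂ ≃L[ℝ] ℂ).toContinuousLinearMap

@[simp] theorem wirtinger_apply (a b h : ℂ) : wirtinger a b h = a * h + b * conj h := by
  simp [wirtinger]

theorem _root_.HasDerivAt.hasFDerivAt_wirtinger {f : ℂ → ℂ} {f' z : ℂ} (h : HasDerivAt f f' z) :
    HasFDerivAt f (wirtinger f' 0) z := by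
  refine h.complexToReal_fderiv.congr_fderiv (ContinuousLinearMap.ext fun w => ?_)
  simp

theorem hasFDerivAt_wirtinger_add {f g : ℂ → ℂ} {a b c d z : ℂ}
    (hf : HasFDerivAt f (wirtinger a b) z) (hg : HasFDerivAt g (wirtinger c d) z) :
    HasFDerivAt (fun w => f w + g w) (wirtinger (a + c) (b + d)) z := by
  refine (hf.add hg).congr_fderiv (ContinuousLinearMap.ext fun w => ?_)
  simp
  ring

theorem hasFDerivAt_wirtinger_conj {f : ℂ → ℂ} {a b z : ℂ}
    (hf : HasFDerivAt f (wirtinger a b) z) :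
    HasFDerivAt (fun w => conj (f w)) (wirtinger (conj b) (conj a)) z := by
  refine (((conjCLE : ℂ ≃L[ℝ] ℂ).toContinuousLinearMap.hasFDerivAt (x := f z)).comp z
    hf).congr_fderiv (ContinuousLinearMap.ext fun w => ?_)
  simp
  ring

theorem hasFDerivAt_wirtinger_mul {f g : ℂ → ℂ} {a b c d z : ℂ}
    (hf : HasFDerivAt f (wirtinger a b) z) (hg : HasFDerivAt g (wirtinger c d) z) :
    HasFDerivAt (fun w => f w * g w)
      (wirtinger (a * g z + f z * c) (b * g z + f z * d)) z := by
  refine (hf.mul hg).congr_fderiv (ContinuousLinearMap.ext fun w => ?_)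
  simp
  ring

/-- The complex form `G + z Π̄ + L̄` of `2 ∂Φ/∂z̄` for a biharmonic stream function `Φ`. -/
def goursat (G P L : ℂ → ℂ) (z : ℂ) : ℂ := G z + z * conj (P z) + conj (L z)

/-- `G` is allowed a nonzero z̄-derivative: for a stream function x log|t| the classical Goursat
functions are multivalued, whereas log|t| is not. Only ∂G/∂z = Π matters for incompressibility,
because it makes the z-derivative of the sum equal to 2 Re Π, a real number. -/
theorem hasFDerivAt_goursat {G P L : ℂ → ℂ} {j P' L' z : ℂ}
    (hG : HasFDerivAt G (wirtinger (P z) (conj j)) z) (hP : HasDerivAt P P' z)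
    (hL : HasDerivAt L L' z) :
    HasFDerivAt (goursat G P L)
      (wirtinger (P z + conj (P z)) (conj (j + conj z * P' + L'))) z := by
  have h1 := hasFDerivAt_wirtinger_conj hP.hasFDerivAt_wirtinger
  have h2 := hasFDerivAt_wirtinger_conj hL.hasFDerivAt_wirtinger
  have h3 := hasFDerivAt_wirtinger_mul (hasDerivAt_id z).hasFDerivAt_wirtinger h1
  refine (hasFDerivAt_wirtinger_add (hasFDerivAt_wirtinger_add hG h3) h2).congr_fderiv ?_
  congr 1 <;> simp

/-! ### Transfer of the complex calculus to the Euclidean plane -/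

/-- The identification of `ℂ` with the plane. -/
def planeEquiv : ℂ ≃ₗᵢ[ℝ] Plane := Complex.orthonormalBasisOneI.repr

/-- The planar vector field with complex form `-i V`. -/
def planeVelocity (V : ℂ → ℂ) (x : Plane) : Plane := planeEquiv (-I * V (planeEquiv.symm x))

/-- The pressure `-4 μ Im Π`. -/
def planePressure (μ : ℝ) (P : ℂ → ℂ) (x : Plane) : ℝ := -(4 * μ) * (P (planeEquiv.symm x)).im

theorem planeEquiv_symm_e_zero : planeEquiv.symm (e 0) = 1 := by
  simp [planeEquiv, e]

theorem planeEquiv_symm_e_one : planeEquiv.symm (e 1) = I := by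
  simp [planeEquiv, e]

theorem planeEquiv_apply_zero (z : ℂ) : planeEquiv z 0 = z.re := by
  simp [planeEquiv]

theorem planeEquiv_apply_one (z : ℂ) : planeEquiv z 1 = z.im := by
  simp [planeEquiv]

theorem hasFDerivAt_planeVelocity {V : ℂ → ℂ} {a b : ℂ} {x : Plane}
    (h : HasFDerivAt V (wirtinger a b) (planeEquiv.symm x)) :
    HasFDerivAt (planeVelocity V)
      ((planeEquiv.toContinuousLinearEquiv : ℂ →L[ℝ] Plane).comp
        ((wirtinger (-I * a) (-I * b)).comp
          (planeEquiv.symm.toContinuousLinearEquiv : Plane →L[ℝ] ℂ))) x := by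
  have h0 := h.const_mul (-I)
  have h1 := (planeEquiv.toContinuousLinearEquiv : ℂ →L[ℝ] Plane).hasFDerivAt
    (x := -I * V (planeEquiv.symm x))
  have h2 := (planeEquiv.symm.toContinuousLinearEquiv : Plane →L[ℝ] ℂ).hasFDerivAt (x := x)
  have h3 := h1.comp x (HasFDerivAt.comp x (f := fun y => planeEquiv.symm y)
    (g := fun z => -I * V z) h0 h2)
  have h4 : wirtinger (-I * a) (-I * b) = -I • wirtinger a b := by
    refine ContinuousLinearMap.ext fun w => ?_
    simp
    ring
  rw [h4]
  exact h3

theorem velocityGradient_planeVelocity {V : ℂ → ℂ} {a b : ℂ} {x : Plane}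
    (h : HasFDerivAt V (wirtinger a b) (planeEquiv.symm x)) :
    velocityGradient (planeVelocity V) x =
      !![a.im + b.im, a.re - b.re; -a.re - b.re, a.im - b.im] := by
  ext i j
  simp only [velocityGradient, (hasFDerivAt_planeVelocity h).fderiv, Matrix.of_apply,
    ContinuousLinearMap.comp_apply, ContinuousLinearEquiv.coe_coe,
    LinearIsometryEquiv.coe_toContinuousLinearEquiv]
  fin_cases i <;> fin_cases j <;>
    simp [planeEquiv_symm_e_zero, planeEquiv_symm_e_one, planeEquiv_apply_zero,
      planeEquiv_apply_one] <;> ring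

/-- A real z-derivative `a` of V contributes to −iV only an infinitesimal rotation, which the
symmetrised gradient does not see. -/
theorem strain_planeVelocity {V : ℂ → ℂ} {a b : ℂ} {x : Plane} (ha : a.im = 0)
    (h : HasFDerivAt V (wirtinger a b) (planeEquiv.symm x)) :
    strain (planeVelocity V) x = !![b.im, -b.re; -b.re, -b.im] := by
  rw [strain, velocityGradient_planeVelocity h]
  ext i j
  fin_cases i <;> fin_cases j <;> simp [ha] <;> ring

theorem divergence_planeVelocity {V : ℂ → ℂ} {a b : ℂ} {x : Plane} (ha : a.im = 0)
    (h : HasFDerivAt V (wirtinger a b) (planeEquiv.symm x)) :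
    divergence (planeVelocity V) x = 0 := by
  rw [divergence, velocityGradient_planeVelocity h]
  simp [Matrix.trace_fin_two, ha]

theorem laplacian_apply_eq_fderiv_fderiv (f : Plane → Plane) (x : Plane) :
    (Δ f) x = ∑ i, fderiv ℝ (fderiv ℝ f) x (e i) (e i) := by
  rw [InnerProductSpace.laplacian_eq_iteratedFDeriv_orthonormalBasis f
    (EuclideanSpace.basisFun (Fin 2) ℝ)]
  simp [iteratedFDeriv_two_apply, e]

/-- The second derivatives of V along 1 and I are a₁ + a₂ + b₁ + b₂ and −a₁ + a₂ + b₁ − b₂, so only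
the mixed terms survive in the sum. The two mixed derivatives a₂ and b₁ are kept apart, which avoids
an appeal to symmetry. -/
theorem laplacian_planeVelocity {V A B : ℂ → ℂ} {x : Plane} {a₁ a₂ b₁ b₂ : ℂ}
    (h : ∀ᶠ z in 𝓝 (planeEquiv.symm x), HasFDerivAt V (wirtinger (A z) (B z)) z)
    (hA : HasFDerivAt A (wirtinger a₁ a₂) (planeEquiv.symm x))
    (hB : HasFDerivAt B (wirtinger b₁ b₂) (planeEquiv.symm x)) :
    (Δ (planeVelocity V)) x = planeEquiv (-I * (2 * (a₂ + b₁))) := by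
  have hc : Continuous (planeEquiv.symm : Plane → ℂ) := planeEquiv.symm.continuous
  have h1 : fderiv ℝ (planeVelocity V) =ᶠ[𝓝 x] fun y =>
      (planeEquiv.toContinuousLinearEquiv : ℂ →L[ℝ] Plane).comp
        ((wirtinger (-I * A (planeEquiv.symm y)) (-I * B (planeEquiv.symm y))).comp
          (planeEquiv.symm.toContinuousLinearEquiv : Plane →L[ℝ] ℂ)) := by
    filter_upwards [hc.continuousAt.eventually h] with y hy
    exact (hasFDerivAt_planeVelocity hy).fderiv
  have hd : DifferentiableAt ℝ (fun y : Plane =>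
      (planeEquiv.toContinuousLinearEquiv : ℂ →L[ℝ] Plane).comp
        ((wirtinger (-I * A (planeEquiv.symm y)) (-I * B (planeEquiv.symm y))).comp
          (planeEquiv.symm.toContinuousLinearEquiv : Plane →L[ℝ] ℂ))) x := by
    have hA' : DifferentiableAt ℝ (fun y : Plane => A (planeEquiv.symm y)) x :=
      hA.differentiableAt.comp x planeEquiv.symm.toContinuousLinearEquiv.differentiableAt
    have hB' : DifferentiableAt ℝ (fun y : Plane => B (planeEquiv.symm y)) x :=
      hB.differentiableAt.comp x planeEquiv.symm.toContinuousLinearEquiv.differentiableAt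
    refine (differentiableAt_const _).clm_comp (DifferentiableAt.clm_comp ?_
      (differentiableAt_const _))
    unfold wirtinger
    exact ((hA'.const_mul _).smul (differentiableAt_const _)).add
      ((hB'.const_mul _).smul (differentiableAt_const _))
  have key : ∀ i, fderiv ℝ (fderiv ℝ (planeVelocity V)) x (e i) (e i) =
      fderiv ℝ (planeVelocity (fun z => A z * planeEquiv.symm (e i) +
        B z * conj (planeEquiv.symm (e i)))) x (e i) := by
    intro i
    rw [h1.fderiv_eq]
    have := (hd.hasFDerivAt.clm_apply (hasFDerivAt_const (e i) x)).fderiv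
    have h2 := congrArg (fun T : Plane →L[ℝ] Plane => T (e i)) this
    simp only [add_apply, ContinuousLinearMap.comp_apply,
      ContinuousLinearMap.flip_apply, zero_apply, map_zero, zero_add] at h2
    rw [← h2]
    congr 2
    ext1 y
    simp only [planeVelocity, ContinuousLinearEquiv.coe_coe,
      LinearIsometryEquiv.coe_toContinuousLinearEquiv, wirtinger_apply]
    congr 1
    ring
  rw [laplacian_apply_eq_fderiv_fderiv, Fin.sum_univ_two, key, key, planeEquiv_symm_e_zero,
    planeEquiv_symm_e_one]
  have k0 : HasFDerivAt (fun z => A z * 1 + B z * conj 1)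
      (wirtinger (a₁ + b₁) (a₂ + b₂)) (planeEquiv.symm x) := by
    simpa using hasFDerivAt_wirtinger_add hA hB
  have k1 : HasFDerivAt (fun z => A z * I + B z * conj I)
      (wirtinger (a₁ * I + b₁ * (-I)) (a₂ * I + b₂ * (-I))) (planeEquiv.symm x) := by
    have c1 := hasFDerivAt_wirtinger_mul hA (hasDerivAt_const (planeEquiv.symm x) I).hasFDerivAt_wirtinger
    have c2 := hasFDerivAt_wirtinger_mul hB
      (hasDerivAt_const (planeEquiv.symm x) (-I)).hasFDerivAt_wirtinger
    simpa using hasFDerivAt_wirtinger_add c1 c2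
  rw [(hasFDerivAt_planeVelocity k0).fderiv, (hasFDerivAt_planeVelocity k1).fderiv]
  simp only [ContinuousLinearMap.comp_apply, ContinuousLinearEquiv.coe_coe,
    LinearIsometryEquiv.coe_toContinuousLinearEquiv, planeEquiv_symm_e_zero,
    planeEquiv_symm_e_one, wirtinger_apply, ← map_add]
  congr 1
  simp only [map_one, conj_I]
  linear_combination -(a₁ - b₁ - a₂ + b₂) * I * I_sq

theorem gradient_planePressure {P : ℂ → ℂ} {P' : ℂ} {x : Plane} (μ : ℝ)
    (hP : HasDerivAt P P' (planeEquiv.symm x)) :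
    ∇ (planePressure μ P) x = planeEquiv (-(4 * μ) * I * conj P') := by
  have h2 := (planeEquiv.symm.toContinuousLinearEquiv : Plane →L[ℝ] ℂ).hasFDerivAt (x := x)
  have h3 := HasFDerivAt.comp x (f := fun y => planeEquiv.symm y) (g := P)
    hP.hasFDerivAt_wirtinger h2
  have h4 := ((imCLM.hasFDerivAt (x := P (planeEquiv.symm x))).comp x h3).const_mul (-(4 * μ))
  refine HasGradientAt.gradient ?_
  rw [hasGradientAt_iff_hasFDerivAt]
  refine h4.congr_fderiv (ContinuousLinearMap.ext fun y => ?_)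
  simp only [InnerProductSpace.toDual_apply_apply, smul_apply,
    ContinuousLinearMap.comp_apply, ContinuousLinearEquiv.coe_coe,
    LinearIsometryEquiv.coe_toContinuousLinearEquiv, wirtinger_apply, imCLM_apply, smul_eq_mul,
    zero_mul, add_zero]
  obtain ⟨w, rfl⟩ := planeEquiv.surjective y
  rw [planeEquiv.inner_map_map, planeEquiv.symm_apply_apply, Complex.inner]
  simp
  ring

/-- Goursat's representation of Stokes flows. -/
theorem isStokesSolution_goursat {μ : ℝ} {Ω : Set Plane} {U : Set ℂ} {G P L J : ℂ → ℂ}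
    (hU : IsOpen U) (hΩU : closure Ω ⊆ planeEquiv.symm ⁻¹' U)
    (hGc : ContDiffOn ℝ 2 G U)
    (hG : ∀ z ∈ U, HasFDerivAt G (wirtinger (P z) (conj (J z))) z)
    (hP : DifferentiableOn ℂ P U) (hL : DifferentiableOn ℂ L U)
    (hJ : DifferentiableOn ℂ J U) :
    IsStokesSolution μ Ω (planeVelocity (goursat G P L)) (planePressure μ P) := by
  have cP : ContDiffOn ℝ 2 P U := (hP.contDiffOn hU).restrict_scalars ℝ
  have cL : ContDiffOn ℝ 2 L U := (hL.contDiffOn hU).restrict_scalars ℝ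
  have cc : ContDiff ℝ 2 (fun z : ℂ => conj z) := (conjCLE : ℂ ≃L[ℝ] ℂ).contDiff
  have cV : ContDiffOn ℝ 2 (goursat G P L) U :=
    (hGc.add (contDiffOn_id.mul (cc.comp_contDiffOn cP))).add (cc.comp_contDiffOn cL)
  have mt : Set.MapsTo planeEquiv.symm (closure Ω) U := hΩU
  have cu : ContDiffOn ℝ 2 (planeVelocity (goursat G P L)) (closure Ω) := by
    refine planeEquiv.contDiff.comp_contDiffOn (contDiffOn_const.mul ?_)
    exact cV.comp planeEquiv.symm.contDiff.contDiffOn mt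
  have cp : ContDiffOn ℝ 2 (planePressure μ P) (closure Ω) := by
    refine contDiffOn_const.mul ?_
    exact imCLM.contDiff.comp_contDiffOn (cP.comp planeEquiv.symm.contDiff.contDiffOn mt)
  have hd : ∀ {f : ℂ → ℂ}, DifferentiableOn ℂ f U → ∀ z ∈ U, HasDerivAt f (deriv f z) z :=
    fun hf z hz => (hf.differentiableAt (hU.mem_nhds hz)).hasDerivAt
  have hV : ∀ z ∈ U, HasFDerivAt (goursat G P L) (wirtinger (P z + conj (P z))
      (conj (J z + conj z * deriv P z + deriv L z))) z := fun z hz =>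
    hasFDerivAt_goursat (hG z hz) (hd hP z hz) (hd hL z hz)
  refine ⟨cu.mono subset_closure, (cp.mono subset_closure).of_le (by norm_num),
    cu.of_le (by norm_num), cp.continuousOn, fun x hx => ?_, fun x hx => ?_⟩
  · have hx' := mt (subset_closure hx)
    have e1 : HasFDerivAt (fun z => P z + conj (P z)) (wirtinger (deriv P (planeEquiv.symm x))
        (conj (deriv P (planeEquiv.symm x)))) (planeEquiv.symm x) := by
      have := (hd hP _ hx').hasFDerivAt_wirtinger
      simpa using hasFDerivAt_wirtinger_add this (hasFDerivAt_wirtinger_conj this)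
    have dP := hP.deriv hU
    have dL := hL.deriv hU
    have e2 := hasFDerivAt_wirtinger_conj (hasFDerivAt_wirtinger_add (hasFDerivAt_wirtinger_add
      (hd hJ _ hx').hasFDerivAt_wirtinger
      (hasFDerivAt_wirtinger_mul (hasFDerivAt_wirtinger_conj
        (hasDerivAt_id (planeEquiv.symm x)).hasFDerivAt_wirtinger)
        (hd dP _ hx').hasFDerivAt_wirtinger)) (hd dL _ hx').hasFDerivAt_wirtinger)
    -- Both mixed derivatives of V are the conjugate of Π', so the Laplacian of the velocity is −4i
    -- times that conjugate, which is also μ⁻¹∇(−4μ Im Π).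
    rw [gradient_planePressure μ (hd hP _ hx'), laplacian_planeVelocity
      (Filter.eventually_of_mem (hU.mem_nhds hx') hV) e1 e2, ← map_smul]
    congr 1
    simp
    ring
  · exact divergence_planeVelocity (by simp) (hV _ (mt (subset_closure hx)))

end

section

open Topology MeasureTheory

/-! ### Cutoff functions -/

theorem exists_deriv_smoothTransition_bound :
    ∃ C : ℝ, 0 < C ∧ ∀ x, 0 ≤ deriv Real.smoothTransition x ∧ deriv Real.smoothTransition x ≤ C ∧
      (x ∉ Set.Icc (0 : ℝ) 1 → deriv Real.smoothTransition x = 0) := by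
  have hc : Continuous (deriv Real.smoothTransition) :=
    (Real.smoothTransition.contDiff (n := 1)).continuous_deriv (by norm_num)
  obtain ⟨C, hC⟩ := isCompact_Icc.exists_bound_of_continuousOn (s := Set.Icc (0 : ℝ) 1)
    hc.continuousOn
  have h0 : ∀ x ∉ Set.Icc (0 : ℝ) 1, deriv Real.smoothTransition x = 0 := by
    intro x hx
    rw [Set.mem_Icc, not_and_or, not_le, not_le] at hx
    rcases hx with hx | hx
    · have : Real.smoothTransition =ᶠ[𝓝 x] fun _ => 0 := by
        filter_upwards [Iio_mem_nhds hx] with y hy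
        exact Real.smoothTransition.zero_of_nonpos (le_of_lt hy)
      rw [this.deriv_eq, deriv_const]
    · have : Real.smoothTransition =ᶠ[𝓝 x] fun _ => 1 := by
        filter_upwards [Ioi_mem_nhds hx] with y hy
        exact Real.smoothTransition.one_of_one_le (le_of_lt hy)
      rw [this.deriv_eq, deriv_const]
  refine ⟨|C| + 1, by positivity, fun x => ⟨Real.smoothTransition.monotone.deriv_nonneg, ?_, h0 x⟩⟩
  by_cases hx : x ∈ Set.Icc (0 : ℝ) 1
  · have := hC x hx
    rw [Real.norm_eq_abs] at this
    linarith [le_abs_self (deriv Real.smoothTransition x), le_abs_self C]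
  · rw [h0 x hx]; positivity

/-- A cutoff that vanishes near zero and equals one away from zero, whose derivative is
logarithmically small. -/
theorem exists_logarithmic_cutoff : ∃ C : ℝ, 0 < C ∧ ∀ N : ℝ, 1 ≤ N → ∃ g : ℝ → ℝ,
    ContDiff ℝ 1 g ∧ (∀ r, 0 ≤ g r ∧ g r ≤ 1) ∧ (∃ ε : ℝ, 0 < ε ∧ ∀ r, |r| < ε → g r = 0) ∧
    (∀ r, Real.exp (-N / 4) ≤ r → g r = 1) ∧
    ∀ r, 0 ≤ r → 0 ≤ deriv g r ∧ r * deriv g r ≤ C / N := by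
  obtain ⟨C, hC, h⟩ := exists_deriv_smoothTransition_bound
  refine ⟨4 * C, by positivity, fun N hN => ?_⟩
  have hN0 : 0 < N := by linarith
  -- The transition takes place while log(r² + ε²) runs from −N to −N/2, an interval of length
  -- comparable to N; this is what gives r g'(r) = O(1/N). Adding ε² keeps the logarithm smooth at r
  -- = 0.
  set ε := Real.exp (-N) with hε
  have hε0 : 0 < ε := Real.exp_pos _
  have hpos : ∀ r : ℝ, 0 < r ^ 2 + ε ^ 2 := fun r => by positivity
  have hlog : ∀ r, HasDerivAt (fun r : ℝ => 2 * (1 + Real.log (r ^ 2 + ε ^ 2) / N))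
      (2 * (2 * r / (r ^ 2 + ε ^ 2) / N)) r := by
    intro r
    have h1 : HasDerivAt (fun r : ℝ => r ^ 2 + ε ^ 2) (2 * r) r := by
      simpa using (hasDerivAt_pow 2 r).add_const (ε ^ 2)
    exact (((h1.log (hpos r).ne').div_const N).const_add 1).const_mul 2
  have hder : ∀ r, HasDerivAt (fun r => Real.smoothTransition
      (2 * (1 + Real.log (r ^ 2 + ε ^ 2) / N)))
      (deriv Real.smoothTransition (2 * (1 + Real.log (r ^ 2 + ε ^ 2) / N)) *
        (2 * (2 * r / (r ^ 2 + ε ^ 2) / N))) r := by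
    intro r
    have h2 : HasDerivAt Real.smoothTransition (deriv Real.smoothTransition
        (2 * (1 + Real.log (r ^ 2 + ε ^ 2) / N))) (2 * (1 + Real.log (r ^ 2 + ε ^ 2) / N)) :=
      ((Real.smoothTransition.contDiff (n := 1)).differentiable (by norm_num) _).hasDerivAt
    exact h2.comp r (hlog r)
  refine ⟨fun r => Real.smoothTransition (2 * (1 + Real.log (r ^ 2 + ε ^ 2) / N)), ?_,
    fun r => ⟨Real.smoothTransition.nonneg _, Real.smoothTransition.le_one _⟩,
    ⟨ε, hε0, fun r hr => ?_⟩, fun r hr => ?_, fun r hr => ?_⟩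
  · refine Real.smoothTransition.contDiff.comp (contDiff_const.mul (contDiff_const.add ?_))
    exact (((contDiff_id.pow 2).add contDiff_const).log (fun r => (hpos r).ne')).div_const N
  · apply Real.smoothTransition.zero_of_nonpos
    -- For |r| < ε the argument is at most 2ε² ≤ e · e^(−2N), and 1 − 2N ≤ −N since N ≥ 1.
    have h1 : r ^ 2 + ε ^ 2 ≤ Real.exp (1 - 2 * N) := by
      have : Real.exp (1 - 2 * N) = Real.exp 1 * ε ^ 2 := by
        rw [hε, ← Real.exp_nat_mul, ← Real.exp_add]; congr 1; push_cast; ring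
      rw [this]
      have h2 : (2 : ℝ) ≤ Real.exp 1 := by
        have := Real.add_one_le_exp (1 : ℝ); linarith
      have h3 : r ^ 2 ≤ ε ^ 2 := by
        rw [← sq_abs r]; exact pow_le_pow_left₀ (abs_nonneg _) hr.le 2
      nlinarith [sq_nonneg ε]
    have h2 := Real.log_le_log (hpos r) h1
    rw [Real.log_exp] at h2
    have h3 : Real.log (r ^ 2 + ε ^ 2) / N ≤ -1 := by
      rw [div_le_iff₀ hN0]; linarith
    linarith
  · apply Real.smoothTransition.one_of_one_le
    have h1 : Real.exp (-N / 2) ≤ r ^ 2 + ε ^ 2 := by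
      have : Real.exp (-N / 2) = Real.exp (-N / 4) ^ 2 := by
        rw [← Real.exp_nat_mul]; congr 1; push_cast; ring
      rw [this]
      have := pow_le_pow_left₀ (Real.exp_pos _).le hr 2
      nlinarith [sq_nonneg ε]
    have h2 := Real.log_le_log (Real.exp_pos _) h1
    rw [Real.log_exp] at h2
    have h3 : -(1 / 2) ≤ Real.log (r ^ 2 + ε ^ 2) / N := by
      rw [le_div_iff₀ hN0]; linarith
    linarith
  · rw [(hder r).deriv]
    obtain ⟨h1, h2, -⟩ := h (2 * (1 + Real.log (r ^ 2 + ε ^ 2) / N))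
    refine ⟨mul_nonneg h1 (by positivity), ?_⟩
    have h3 : r * (2 * (2 * r / (r ^ 2 + ε ^ 2) / N)) ≤ 4 / N := by
      rw [show r * (2 * (2 * r / (r ^ 2 + ε ^ 2) / N)) = 4 * (r ^ 2 / (r ^ 2 + ε ^ 2)) / N by ring]
      gcongr
      have : r ^ 2 / (r ^ 2 + ε ^ 2) ≤ 1 := (div_le_one (hpos r)).2 (by nlinarith [sq_nonneg ε])
      linarith
    calc r * (deriv Real.smoothTransition (2 * (1 + Real.log (r ^ 2 + ε ^ 2) / N)) *
          (2 * (2 * r / (r ^ 2 + ε ^ 2) / N)))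
        = deriv Real.smoothTransition (2 * (1 + Real.log (r ^ 2 + ε ^ 2) / N)) *
          (r * (2 * (2 * r / (r ^ 2 + ε ^ 2) / N))) := by ring
      _ ≤ C * (4 / N) := by
          refine mul_le_mul h2 h3 ?_ hC.le
          positivity
      _ = 4 * C / N := by ring

/-- A cutoff at scale `ρ` with derivative of order `ρ⁻¹`. -/
theorem exists_radial_cutoff : ∃ C : ℝ, 0 < C ∧ ∀ ρ : ℝ, 0 < ρ → ∃ χ : Plane → ℝ,
    ContDiff ℝ 1 χ ∧ (∀ z, 0 ≤ χ z ∧ χ z ≤ 1) ∧ (∀ z, ‖z‖ ≤ ρ → χ z = 1) ∧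
    (∀ z, 2 * ρ < ‖z‖ → χ z = 0) ∧ (∀ z i, |fderiv ℝ χ z (e i)| ≤ C * ‖z‖ / ρ ^ 2) ∧
    ∀ z, (‖z‖ < ρ ∨ 2 * ρ < ‖z‖) → fderiv ℝ χ z = 0 := by
  obtain ⟨C, hC, h⟩ := exists_deriv_smoothTransition_bound
  refine ⟨2 * C, by positivity, fun ρ hρ => ?_⟩
  have hder : ∀ z : Plane, HasFDerivAt (fun z : Plane =>
      Real.smoothTransition (2 - ‖z‖ ^ 2 / ρ ^ 2))
      (deriv Real.smoothTransition (2 - ‖z‖ ^ 2 / ρ ^ 2) •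
        (-((ρ ^ 2)⁻¹ • ((2 : ℕ) • (innerSL ℝ z : Plane →L[ℝ] ℝ))))) z := by
    intro z
    have h1 := (hasStrictFDerivAt_norm_sq z).hasFDerivAt
    have h2 : HasFDerivAt (fun z : Plane => 2 - ‖z‖ ^ 2 / ρ ^ 2)
        (-((ρ ^ 2)⁻¹ • ((2 : ℕ) • (innerSL ℝ z : Plane →L[ℝ] ℝ)))) z := by
      simpa only [div_eq_inv_mul] using (h1.const_mul ((ρ ^ 2)⁻¹)).const_sub 2
    have h3 : HasDerivAt Real.smoothTransition (deriv Real.smoothTransition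
        (2 - ‖z‖ ^ 2 / ρ ^ 2)) (2 - ‖z‖ ^ 2 / ρ ^ 2) :=
      ((Real.smoothTransition.contDiff (n := 1)).differentiable (by norm_num) _).hasDerivAt
    exact h3.comp_hasFDerivAt z h2
  have hρ2 : 0 < ρ ^ 2 := by positivity
  refine ⟨fun z => Real.smoothTransition (2 - ‖z‖ ^ 2 / ρ ^ 2), ?_,
    fun r => ⟨Real.smoothTransition.nonneg _, Real.smoothTransition.le_one _⟩,
    fun z hz => ?_, fun z hz => ?_, fun z i => ?_, fun z hz => ?_⟩
  · exact Real.smoothTransition.contDiff.comp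
      (contDiff_const.sub ((contDiff_norm_sq ℝ).div_const _))
  · apply Real.smoothTransition.one_of_one_le
    have : ‖z‖ ^ 2 / ρ ^ 2 ≤ 1 := (div_le_one hρ2).2 (by gcongr)
    linarith
  · apply Real.smoothTransition.zero_of_nonpos
    have : 2 ≤ ‖z‖ ^ 2 / ρ ^ 2 := by
      rw [le_div_iff₀ hρ2]; nlinarith
    linarith
  · rw [(hder z).fderiv]
    obtain ⟨h1, h2, -⟩ := h (2 - ‖z‖ ^ 2 / ρ ^ 2)
    simp only [smul_apply, neg_apply, innerSL_apply_apply, smul_eq_mul,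
      nsmul_eq_mul, abs_mul, abs_neg, abs_of_nonneg h1]
    have h3 : |inner ℝ z (e i)| ≤ ‖z‖ := by
      have := abs_real_inner_le_norm z (e i)
      simpa [e] using this
    rw [abs_of_pos (inv_pos.2 hρ2)]
    simp only [Nat.cast_ofNat, Nat.abs_ofNat]
    calc _ ≤ C * ((ρ ^ 2)⁻¹ * (2 * ‖z‖)) := by gcongr
      _ = 2 * C * ‖z‖ / ρ ^ 2 := by field_simp
  · rw [(hder z).fderiv, (h (2 - ‖z‖ ^ 2 / ρ ^ 2)).2.2, zero_smul]
    rw [Set.mem_Icc, not_and_or, not_le, not_le]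
    rcases hz with hz | hz
    · right
      have : ‖z‖ ^ 2 / ρ ^ 2 < 1 := by
        rw [div_lt_one hρ2]
        exact pow_lt_pow_left₀ hz (norm_nonneg _) (by norm_num)
      linarith
    · left
      have : 2 < ‖z‖ ^ 2 / ρ ^ 2 := by
        rw [lt_div_iff₀ hρ2]; nlinarith
      linarith

/-! ### The energy identity -/

theorem norm_e (i : Fin 2) : ‖e i‖ = 1 := by simp [e]

theorem apply_eq_inner_e (v : Plane) (i : Fin 2) : v i = inner ℝ v (e i) := by
  simp [e, EuclideanSpace.inner_single_right]

theorem abs_apply_le_norm (v : Plane) (i : Fin 2) : |v i| ≤ ‖v‖ := by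
  simpa [Real.norm_eq_abs] using PiLp.norm_apply_le v i

/-- The `k`-th component of the energy flux `μ ∇u ⬝ u - p u`. -/
def energyFlux (μ : ℝ) (u : Plane → Plane) (p : Plane → ℝ) (k : Fin 2) (z : Plane) : ℝ :=
  μ * inner ℝ (u z) (fderiv ℝ u z (e k)) - p z * u z k

/-- The dissipation density `|∇u|²`. -/
def dissipation (u : Plane → Plane) (z : Plane) : ℝ := ∑ k, ‖fderiv ℝ u z (e k)‖ ^ 2

theorem divergence_eq_sum (u : Plane → Plane) (z : Plane) :
    divergence u z = ∑ k, (fderiv ℝ u z (e k)) k := by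
  simp [divergence, velocityGradient, Matrix.trace]

theorem inner_eq_sum (v w : Plane) : inner ℝ v w = ∑ k, v k * w k := by
  simp [PiLp.inner_apply, mul_comm]

theorem contDiffAt_energyFlux {μ : ℝ} {u : Plane → Plane} {p : Plane → ℝ} {z : Plane}
    (hu : ContDiffAt ℝ 2 u z) (hp : ContDiffAt ℝ 1 p z) (k : Fin 2) :
    ContDiffAt ℝ 1 (energyFlux μ u p k) z := by
  have hu1 : ContDiffAt ℝ 1 u z := hu.of_le (by norm_num)
  have hd : ContDiffAt ℝ 1 (fun z => fderiv ℝ u z (e k)) z :=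
    (hu.fderiv_right (by norm_num)).clm_apply contDiffAt_const
  have hk : ContDiffAt ℝ 1 (fun z => u z k) z :=
    (contDiff_euclidean.1 contDiff_id k).contDiffAt.comp z hu1
  exact (contDiffAt_const.mul (hu1.inner ℝ hd)).sub (hp.mul hk)

/-- By the product rule the divergence of μ∇u·u − pu is μ|∇u|² + u·(μΔu − ∇p) − p div u, and the
last two terms vanish by the Stokes equations. -/
theorem sum_fderiv_energyFlux {μ : ℝ} {u : Plane → Plane} {p : Plane → ℝ} {z : Plane}
    (hu : ContDiffAt ℝ 2 u z) (hp : ContDiffAt ℝ 1 p z)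
    (hm : μ • (Δ u) z = ∇ p z) (hdiv : divergence u z = 0) :
    ∑ k, fderiv ℝ (energyFlux μ u p k) z (e k) = μ * dissipation u z := by
  have hu0 : HasFDerivAt u (fderiv ℝ u z) z := (hu.differentiableAt (by norm_num)).hasFDerivAt
  have hu1 : HasFDerivAt (fderiv ℝ u) (fderiv ℝ (fderiv ℝ u) z) z :=
    ((hu.fderiv_right (m := 1) (by norm_num)).differentiableAt (by norm_num)).hasFDerivAt
  have hp0 := (hp.differentiableAt (by norm_num)).hasFDerivAt
  have key : ∀ k, fderiv ℝ (energyFlux μ u p k) z (e k) =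
      μ * (‖fderiv ℝ u z (e k)‖ ^ 2 + inner ℝ (u z) (fderiv ℝ (fderiv ℝ u) z (e k) (e k))) -
      (fderiv ℝ p z (e k) * u z k + p z * (fderiv ℝ u z (e k)) k) := by
    intro k
    have h1 : HasFDerivAt (fun y => fderiv ℝ u y (e k)) ((fderiv ℝ (fderiv ℝ u) z).flip (e k)) z := by
      have := hu1.clm_apply (hasFDerivAt_const (e k) z)
      simpa using this
    have h2 := hu0.inner ℝ h1
    have h3 : HasFDerivAt (fun y => u y k) ((EuclideanSpace.proj k : Plane →L[ℝ] ℝ).comp (fderiv ℝ u z)) z :=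
      (EuclideanSpace.proj k : Plane →L[ℝ] ℝ).hasFDerivAt.comp z hu0
    have h4 : HasFDerivAt (energyFlux μ u p k) _ z := (h2.const_mul μ).sub (hp0.mul h3)
    rw [h4.fderiv]
    simp [fderivInnerCLM_apply]
    ring
  have h5 : ∑ k, fderiv ℝ p z (e k) * u z k = μ * inner ℝ (u z) ((Δ u) z) := by
    have : ∀ k, fderiv ℝ p z (e k) = (∇ p z) k := by
      intro k
      rw [apply_eq_inner_e, ← toDual_gradient, InnerProductSpace.toDual_apply_apply]
    simp_rw [this]
    rw [← hm, inner_eq_sum, Finset.mul_sum]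
    refine Finset.sum_congr rfl fun k _ => ?_
    simp
    ring
  rw [laplacian_apply_eq_fderiv_fderiv] at h5
  rw [divergence_eq_sum] at hdiv
  simp_rw [key, dissipation]
  simp only [Fin.sum_univ_two, inner_add_right] at h5 hdiv ⊢
  linear_combination -h5 - p z * hdiv

end

/-! ### Integration of the truncated energy flux -/

section

open Topology MeasureTheory

/-- The divergence theorem without a boundary, by integrating each component by parts against the
constant 1. -/
theorem integral_sum_fderiv_eq_zero {X : Fin 2 → Plane → ℝ} (hX : ∀ k, ContDiff ℝ 1 (X k))
    (hc : ∀ k, HasCompactSupport (X k)) :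
    Integrable (fun z => ∑ k, fderiv ℝ (X k) z (e k)) ∧
      ∫ z, ∑ k, fderiv ℝ (X k) z (e k) = 0 := by
  have hi : ∀ k, Integrable (fun z => fderiv ℝ (X k) z (e k)) := fun k =>
    (((hX k).continuous_fderiv (by norm_num)).clm_apply
      continuous_const).integrable_of_hasCompactSupport ((hc k).fderiv_apply (𝕜 := ℝ) (e k))
  refine ⟨integrable_finsetSum _ fun k _ => hi k, ?_⟩
  rw [integral_finsetSum _ fun k _ => hi k]
  refine Finset.sum_eq_zero fun k _ => ?_
  have := integral_mul_fderiv_eq_neg_fderiv_mul_of_integrable (μ := volume)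
    (f := fun _ : Plane => (1 : ℝ)) (g := X k) (v := e k) (by simp) (by simpa using hi k)
    (by simpa using (hX k).continuous.integrable_of_hasCompactSupport (hc k))
    (fun x _ => differentiableAt_const _)
    (fun x _ => (hX k).differentiable (by norm_num) x)
  simpa using this

/-- The pointwise lower bound for the divergence of the truncated energy flux. -/
theorem divergence_truncated_flux_lower_bound {μ M C N ρ : ℝ} (hμ : 0 ≤ μ)
    (hC : 0 ≤ C) (hρ : 0 < ρ) {u : Plane → Plane} {p : Plane → ℝ} {z : Plane}
    (hu : ContDiffAt ℝ 2 u z) (hp : ContDiffAt ℝ 1 p z)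
    (hm : μ • (Δ u) z = ∇ p z) (hdiv : divergence u z = 0)
    (hM : ‖u z‖ ≤ M) (hM1 : (1 + ‖z‖ ^ 2) * ‖fderiv ℝ u z‖ ≤ M) (hM2 : (1 + ‖z‖ ^ 2) * |p z| ≤ M)
    {g : ℝ → ℝ} {χ : Plane → ℝ} (hg : ContDiff ℝ 1 g) (hg01 : ∀ r, 0 ≤ g r ∧ g r ≤ 1)
    (hgd : ∀ r, 0 ≤ r → 0 ≤ deriv g r ∧ r * deriv g r ≤ C / N)
    (hχ : ContDiff ℝ 1 χ) (hχ01 : ∀ z, 0 ≤ χ z ∧ χ z ≤ 1)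
    (hχd : ∀ z i, |fderiv ℝ χ z (e i)| ≤ C * ‖z‖ / ρ ^ 2)
    (hχ0 : ∀ z, (‖z‖ < ρ ∨ 2 * ρ < ‖z‖) → fderiv ℝ χ z = 0) :
    g (‖u z‖ ^ 2) * χ z * (μ * dissipation u z) -
      (4 * C * M ^ 2 / N + 2 * C * (μ + 1) * M ^ 2 / ρ ^ 3) ≤
      ∑ k, fderiv ℝ (fun y => g (‖u y‖ ^ 2) * χ y * energyFlux μ u p k y) z (e k) := by
  have hM0 : 0 ≤ M := (norm_nonneg _).trans hM
  have hz1 : (1 : ℝ) ≤ 1 + ‖z‖ ^ 2 := by nlinarith [sq_nonneg ‖z‖]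
  have hA : ‖fderiv ℝ u z‖ ≤ M := by nlinarith [norm_nonneg (fderiv ℝ u z)]
  have hP : |p z| ≤ M := by nlinarith [abs_nonneg (p z)]
  have hAk : ∀ k, ‖fderiv ℝ u z (e k)‖ ≤ ‖fderiv ℝ u z‖ := fun k => by
    simpa [norm_e] using (fderiv ℝ u z).le_opNorm (e k)
  have hu0 : HasFDerivAt u (fderiv ℝ u z) z := (hu.differentiableAt (by norm_num)).hasFDerivAt
  have hg0 : HasDerivAt g (deriv g (‖u z‖ ^ 2)) (‖u z‖ ^ 2) :=
    (hg.differentiable (by norm_num) _).hasDerivAt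
  have hχ1 : HasFDerivAt χ (fderiv ℝ χ z) z := (hχ.differentiable (by norm_num) _).hasFDerivAt
  have hF : ∀ k, HasFDerivAt (energyFlux μ u p k) (fderiv ℝ (energyFlux μ u p k) z) z := fun k =>
    ((contDiffAt_energyFlux hu hp k).differentiableAt (by norm_num)).hasFDerivAt
  set d := deriv g (‖u z‖ ^ 2) with hd
  obtain ⟨hd0, hd1⟩ := hgd (‖u z‖ ^ 2) (by positivity)
  rw [← hd] at hd0 hd1
  have key : ∀ k, fderiv ℝ (fun y => g (‖u y‖ ^ 2) * χ y * energyFlux μ u p k y) z (e k) =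
      g (‖u z‖ ^ 2) * χ z * fderiv ℝ (energyFlux μ u p k) z (e k) +
      (2 * d * inner ℝ (u z) (fderiv ℝ u z (e k)) * χ z * energyFlux μ u p k z +
       g (‖u z‖ ^ 2) * fderiv ℝ χ z (e k) * energyFlux μ u p k z) := by
    intro k
    have h1 := hg0.comp_hasFDerivAt z hu0.norm_sq
    have h2 := (h1.mul hχ1).mul (hF k)
    have h3 : HasFDerivAt (fun y => g (‖u y‖ ^ 2) * χ y * energyFlux μ u p k y) _ z := h2
    rw [h3.fderiv]
    simp
    ring
  simp_rw [key]
  rw [Finset.sum_add_distrib, ← Finset.mul_sum, sum_fderiv_energyFlux hu hp hm hdiv]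
  have hFk : ∀ k, (1 + ‖z‖ ^ 2) * |energyFlux μ u p k z| ≤ (μ + 1) * M ^ 2 := by
    intro k
    have h1 : |energyFlux μ u p k z| ≤ μ * (‖u z‖ * ‖fderiv ℝ u z‖) + |p z| * ‖u z‖ := by
      refine (abs_sub _ _).trans ?_
      rw [abs_mul, abs_mul, abs_of_nonneg hμ]
      have := abs_real_inner_le_norm (u z) (fderiv ℝ u z (e k))
      have h2 := abs_apply_le_norm (u z) k
      have := hAk k
      gcongr
      exact ‹|inner ℝ _ _| ≤ _›.trans (by gcongr)
    calc (1 + ‖z‖ ^ 2) * |energyFlux μ u p k z|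
        ≤ (1 + ‖z‖ ^ 2) * (μ * (‖u z‖ * ‖fderiv ℝ u z‖) + |p z| * ‖u z‖) := by gcongr
      _ = μ * (‖u z‖ * ((1 + ‖z‖ ^ 2) * ‖fderiv ℝ u z‖)) + ((1 + ‖z‖ ^ 2) * |p z|) * ‖u z‖ := by
          ring
      _ ≤ μ * (M * M) + M * M := by gcongr
      _ = (μ + 1) * M ^ 2 := by ring
  -- The viscous part of the flux contributes 2χg'μ⟨u, ∂ₖu⟩², which is nonnegative and can be
  -- dropped; therefore only a lower bound is claimed. The pressure part carries the factor |u|²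
  -- g'(|u|²), which is at most C/N.
  have t1 : ∀ k, -(2 * C * M ^ 2 / N) ≤
      2 * d * inner ℝ (u z) (fderiv ℝ u z (e k)) * χ z * energyFlux μ u p k z := by
    intro k
    set a := inner ℝ (u z) (fderiv ℝ u z (e k)) with ha
    have ha1 : |a| ≤ ‖u z‖ * M := (abs_real_inner_le_norm _ _).trans
      (by have := (hAk k).trans hA; gcongr)
    have h2 := abs_apply_le_norm (u z) k
    have h3 : |a * (p z * u z k)| ≤ ‖u z‖ ^ 2 * M ^ 2 := by
      rw [abs_mul, abs_mul]
      calc |a| * (|p z| * |u z k|) ≤ (‖u z‖ * M) * (M * ‖u z‖) := by gcongr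
        _ = _ := by ring
    have h4 : 2 * d * a * χ z * energyFlux μ u p k z =
        χ z * (2 * d * (μ * a ^ 2)) - 2 * χ z * d * (a * (p z * u z k)) := by
      rw [energyFlux, ← ha]; ring
    rw [h4]
    have h5 : 0 ≤ χ z * (2 * d * (μ * a ^ 2)) := mul_nonneg (hχ01 z).1 (by positivity)
    have h6 : 2 * χ z * d * (a * (p z * u z k)) ≤ 2 * 1 * d * (‖u z‖ ^ 2 * M ^ 2) := by
      have h7 : 0 ≤ 2 * χ z * d := mul_nonneg (mul_nonneg zero_le_two (hχ01 z).1) hd0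
      calc _ ≤ 2 * χ z * d * (‖u z‖ ^ 2 * M ^ 2) :=
            mul_le_mul_of_nonneg_left ((le_abs_self _).trans h3) h7
        _ ≤ _ := by
            have := (hχ01 z).2
            gcongr
    have h8 : 2 * 1 * d * (‖u z‖ ^ 2 * M ^ 2) ≤ 2 * C * M ^ 2 / N := by
      calc _ = 2 * M ^ 2 * (‖u z‖ ^ 2 * d) := by ring
        _ ≤ 2 * M ^ 2 * (C / N) := by gcongr
        _ = _ := by ring
    linarith
  -- The derivative of χ is at most C‖z‖/ρ² and lives on ρ ≤ ‖z‖ ≤ 2ρ. There 1 + ‖z‖² ≥ ‖z‖ρ, so the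
  -- decay of the flux supplies the factor 1/(‖z‖ρ).
  have t2 : ∀ k, -(C * (μ + 1) * M ^ 2 / ρ ^ 3) ≤
      g (‖u z‖ ^ 2) * fderiv ℝ χ z (e k) * energyFlux μ u p k z := by
    intro k
    have hB : 0 ≤ C * (μ + 1) * M ^ 2 / ρ ^ 3 := by positivity
    by_cases hz : ‖z‖ < ρ ∨ 2 * ρ < ‖z‖
    · rw [hχ0 z hz]; simpa using hB
    · push Not at hz
      have h1 : |fderiv ℝ χ z (e k) * energyFlux μ u p k z| ≤ C * (μ + 1) * M ^ 2 / ρ ^ 3 := by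
        rw [abs_mul]
        have hzpos : 0 < ‖z‖ := hρ.trans_le hz.1
        have h2 : |energyFlux μ u p k z| ≤ (μ + 1) * M ^ 2 / (‖z‖ * ρ) := by
          rw [le_div_iff₀ (by positivity)]
          calc _ ≤ (1 + ‖z‖ ^ 2) * |energyFlux μ u p k z| := by
                rw [mul_comm]
                gcongr
                nlinarith [hz.1]
            _ ≤ _ := hFk k
        calc _ ≤ (C * ‖z‖ / ρ ^ 2) * ((μ + 1) * M ^ 2 / (‖z‖ * ρ)) :=
              mul_le_mul (hχd z k) h2 (abs_nonneg _) (by positivity)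
          _ = _ := by field_simp
      have h3 : |g (‖u z‖ ^ 2) * fderiv ℝ χ z (e k) * energyFlux μ u p k z| ≤
          C * (μ + 1) * M ^ 2 / ρ ^ 3 := by
        rw [mul_assoc, abs_mul, abs_of_nonneg (hg01 _).1]
        exact (mul_le_of_le_one_left (abs_nonneg _) (hg01 _).2).trans h1
      exact (abs_le.1 h3).1
  simp only [Fin.sum_univ_two]
  have a1 := t1 0
  have a2 := t1 1
  have a3 := t2 0
  have a4 := t2 1
  have e1 : 4 * C * M ^ 2 / N = 2 * C * M ^ 2 / N + 2 * C * M ^ 2 / N := by ring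
  have e2 : 2 * C * (μ + 1) * M ^ 2 / ρ ^ 3 =
    C * (μ + 1) * M ^ 2 / ρ ^ 3 + C * (μ + 1) * M ^ 2 / ρ ^ 3 := by ring
  rw [e1, e2]
  linarith

/-- A Stokes flow that vanishes on the boundary and decays has `∇u = 0` wherever `u ≠ 0`. -/
theorem fderiv_eq_zero_of_energy {μ M : ℝ} (hμ : 0 < μ) {Ω : Set Plane} (hΩ : IsOpen Ω)
    {u : Plane → Plane} {p : Plane → ℝ}
    (hu : ContDiffOn ℝ 2 u Ω) (hp : ContDiffOn ℝ 1 p Ω)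
    (hm : ∀ z ∈ Ω, μ • (Δ u) z = ∇ p z) (hdiv : ∀ z ∈ Ω, divergence u z = 0)
    (huc : ContinuousOn u (closure Ω)) (hu0 : ∀ z ∈ frontier Ω, u z = 0)
    (hM : ∀ z ∈ Ω, ‖u z‖ ≤ M ∧ (1 + ‖z‖ ^ 2) * ‖fderiv ℝ u z‖ ≤ M ∧ (1 + ‖z‖ ^ 2) * |p z| ≤ M)
    {z₀ : Plane} (hz₀ : z₀ ∈ Ω) (hne : u z₀ ≠ 0) : fderiv ℝ u z₀ = 0 := by
  by_contra hA
  have cu : ∀ z ∈ Ω, ContDiffAt ℝ 2 u z := fun z hz => hu.contDiffAt (hΩ.mem_nhds hz)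
  have cp : ∀ z ∈ Ω, ContDiffAt ℝ 1 p z := fun z hz => hp.contDiffAt (hΩ.mem_nhds hz)
  have hS : 0 < dissipation u z₀ := by
    rcases (Finset.sum_nonneg fun k _ => sq_nonneg ‖fderiv ℝ u z₀ (e k)‖ :
      0 ≤ dissipation u z₀).lt_or_eq with h | h
    · exact h
    · exfalso
      apply hA
      have h1 := (Finset.sum_eq_zero_iff_of_nonneg fun k _ =>
        sq_nonneg ‖fderiv ℝ u z₀ (e k)‖).1 h.symm
      refine ContinuousLinearMap.coe_injective
        ((EuclideanSpace.basisFun (Fin 2) ℝ).toBasis.ext fun i => ?_)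
      have := h1 i (Finset.mem_univ i)
      simpa [e] using this
  have cS : ContinuousAt (dissipation u) z₀ := by
    have : ContinuousAt (fderiv ℝ u) z₀ :=
      ((cu z₀ hz₀).fderiv_right (m := 1) (by norm_num)).continuousAt
    unfold dissipation
    simp only [Fin.sum_univ_two]
    exact ((this.clm_apply continuousAt_const).norm.pow 2).add
      ((this.clm_apply continuousAt_const).norm.pow 2)
  have cn : ContinuousAt (fun z => ‖u z‖ ^ 2) z₀ := ((cu z₀ hz₀).continuousAt.norm).pow 2
  obtain ⟨r, hr, hball⟩ : ∃ r > 0, ∀ z ∈ Metric.ball z₀ r, z ∈ Ω ∧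
      ‖u z₀‖ ^ 2 / 2 ≤ ‖u z‖ ^ 2 ∧ dissipation u z₀ / 2 ≤ dissipation u z := by
    have h1 : ∀ᶠ z in 𝓝 z₀, ‖u z₀‖ ^ 2 / 2 ≤ ‖u z‖ ^ 2 := by
      have : ‖u z₀‖ ^ 2 / 2 < ‖u z₀‖ ^ 2 := half_lt_self (by positivity)
      exact (cn.eventually (lt_mem_nhds this)).mono fun z hz => le_of_lt hz
    have h2 : ∀ᶠ z in 𝓝 z₀, dissipation u z₀ / 2 ≤ dissipation u z :=
      (cS.eventually (lt_mem_nhds (half_lt_self hS))).mono fun z hz => le_of_lt hz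
    obtain ⟨r, hr, h⟩ := Metric.eventually_nhds_iff_ball.1
      ((hΩ.eventually_mem hz₀).and (h1.and h2))
    exact ⟨r, hr, h⟩
  obtain ⟨C₁, hC₁, hg⟩ := exists_logarithmic_cutoff
  obtain ⟨C₂, hC₂, hχ⟩ := exists_radial_cutoff
  set C := max C₁ C₂ with hCdef
  have hC : 0 < C := lt_max_of_lt_left hC₁
  set B := volume.real (Metric.ball z₀ r) with hB
  have hBpos : 0 < B := ENNReal.toReal_pos (Metric.measure_ball_pos volume z₀ hr).ne'
    measure_ball_lt_top.ne
  set E₀ := 4 * C * M ^ 2 + 2 * C * (μ + 1) * M ^ 2 with hE₀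
  set V₁ := volume.real (Metric.ball (0 : Plane) 1) with hV₁
  -- The logarithmic parameter is N = ρ³, so that both error densities are O(ρ⁻³). On a disk of area
  -- O(ρ²) they integrate to O(1/ρ), while the dissipation near `z₀` stays fixed.
  have main : ∀ᶠ ρ : ℝ in atTop, μ * (dissipation u z₀ / 2) * B ≤ E₀ / ρ ^ 3 * ((2 * ρ) ^ 2 * V₁) := by
    have hexp : Tendsto (fun ρ : ℝ => Real.exp (-ρ ^ 3 / 4)) atTop (𝓝 0) := by
      refine Real.tendsto_exp_atBot.comp ?_
      have : Tendsto (fun ρ : ℝ => ρ ^ 3 / 4) atTop atTop :=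
        (tendsto_pow_atTop (by norm_num)).atTop_div_const (by norm_num)
      refine (tendsto_neg_atTop_atBot.comp this).congr fun ρ => ?_
      simp [neg_div]
    have hu0' : 0 < ‖u z₀‖ ^ 2 / 2 := by positivity
    filter_upwards [eventually_ge_atTop 1, eventually_ge_atTop (‖z₀‖ + r),
      hexp.eventually (gt_mem_nhds hu0')] with ρ hρ1 hρ2 hρ3
    have hρ0 : 0 < ρ := by linarith
    obtain ⟨g, gc, g01, ⟨ε, hε, gε⟩, g1, gd⟩ := hg (ρ ^ 3) (one_le_pow₀ hρ1)
    obtain ⟨χ, χc, χ01, χ1, χ2, χd, χ0⟩ := hχ ρ hρ0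
    -- Extension by zero is smooth enough: near the frontier |u|² < ε, where g vanishes identically.
    -- Neither the shape of the frontier nor boundary values of ∇u and p play a role here.
    let X : Fin 2 → Plane → ℝ := fun k =>
      Ω.indicator (fun y => g (‖u y‖ ^ 2) * χ y * energyFlux μ u p k y)
    have hXz : ∀ z ∉ Ω, ∀ k, X k =ᶠ[𝓝 z] fun _ => 0 := by
      intro z hz k
      by_cases hzc : z ∈ closure Ω
      · have hf : z ∈ frontier Ω := ⟨hzc, by rwa [hΩ.interior_eq]⟩
        have h1 : ContinuousWithinAt (fun y => |‖u y‖ ^ 2|) (closure Ω) z :=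
          ((huc z hzc).norm.pow 2).abs
        have h2 : |‖u z‖ ^ 2| < ε := by simpa [hu0 z hf] using hε
        have h3 := h1.eventually (gt_mem_nhds h2)
        filter_upwards [eventually_nhdsWithin_iff.1 h3] with y hy
        by_cases hyΩ : y ∈ Ω
        · simp [X, hyΩ, gε _ (hy (subset_closure hyΩ))]
        · simp [X, hyΩ]
      · filter_upwards [isClosed_closure.isOpen_compl.mem_nhds hzc] with y hy
        have : y ∉ Ω := fun h => hy (subset_closure h)
        simp [X, this]
    have hXin : ∀ z ∈ Ω, ∀ k, X k =ᶠ[𝓝 z]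
        fun y => g (‖u y‖ ^ 2) * χ y * energyFlux μ u p k y := by
      intro z hz k
      filter_upwards [hΩ.mem_nhds hz] with y hy
      simp [X, hy]
    have hXc : ∀ k, ContDiff ℝ 1 (X k) := by
      intro k
      rw [contDiff_iff_contDiffAt]
      intro z
      by_cases hz : z ∈ Ω
      · refine ContDiffAt.congr_of_eventuallyEq ?_ (hXin z hz k)
        refine ((gc.contDiffAt.comp z (((cu z hz).of_le (by norm_num)).norm_sq ℝ)).mul
          χc.contDiffAt).mul (contDiffAt_energyFlux (cu z hz) (cp z hz) k)
      · exact contDiffAt_const.congr_of_eventuallyEq (hXz z hz k)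
    have hXs : ∀ k, HasCompactSupport (X k) := by
      intro k
      refine HasCompactSupport.intro (isCompact_closedBall (0 : Plane) (2 * ρ)) fun z hz => ?_
      have : 2 * ρ < ‖z‖ := by simpa using hz
      by_cases hzΩ : z ∈ Ω <;> simp [X, hzΩ, χ2 z this]
    obtain ⟨hint, h0⟩ := integral_sum_fderiv_eq_zero hXc hXs
    have hCN : C₁ / ρ ^ 3 ≤ C / ρ ^ 3 := by gcongr; exact le_max_left _ _
    have lower : ∀ z, (Metric.ball z₀ r).indicator (fun _ => μ * (dissipation u z₀ / 2)) z -
        (Metric.closedBall (0 : Plane) (2 * ρ)).indicator (fun _ => E₀ / ρ ^ 3) z ≤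
        ∑ k, fderiv ℝ (X k) z (e k) := by
      intro z
      have hE : 0 ≤ (Metric.closedBall (0 : Plane) (2 * ρ)).indicator (fun _ => E₀ / ρ ^ 3) z := by
        refine Set.indicator_nonneg (fun _ _ => ?_) z
        positivity
      have hsub : z ∈ Metric.ball z₀ r → ‖z‖ ≤ ρ := fun h => by
        have h1 : ‖z - z₀‖ < r := by simpa [dist_eq_norm] using h
        have h2 := norm_add_le (z - z₀) z₀
        rw [sub_add_cancel] at h2
        linarith
      by_cases hz : z ∈ Ω
      · have hsum : ∑ k, fderiv ℝ (X k) z (e k) = ∑ k, fderiv ℝ (fun y =>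
            g (‖u y‖ ^ 2) * χ y * energyFlux μ u p k y) z (e k) :=
          Finset.sum_congr rfl fun k _ => by rw [(hXin z hz k).fderiv_eq]
        by_cases hzρ : z ∈ Metric.closedBall (0 : Plane) (2 * ρ)
        · rw [Set.indicator_of_mem hzρ, hsum]
          have hlow := divergence_truncated_flux_lower_bound hμ.le hC.le
            hρ0 (cu z hz) (cp z hz) (hm z hz) (hdiv z hz) (hM z hz).1 (hM z hz).2.1 (hM z hz).2.2 gc g01
            (fun r hr => ⟨(gd r hr).1, (gd r hr).2.trans hCN⟩) χc χ01
            (fun z i => (χd z i).trans (by gcongr; exact le_max_right _ _)) χ0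
          refine le_trans ?_ hlow
          have hE' : E₀ / ρ ^ 3 = 4 * C * M ^ 2 / ρ ^ 3 + 2 * C * (μ + 1) * M ^ 2 / ρ ^ 3 := by
            rw [hE₀]; ring
          rw [hE']
          gcongr
          have hD : 0 ≤ dissipation u z := Finset.sum_nonneg fun k _ => sq_nonneg _
          by_cases hzb : z ∈ Metric.ball z₀ r
          · rw [Set.indicator_of_mem hzb, χ1 z (hsub hzb),
              g1 _ (hρ3.le.trans (hball z hzb).2.1)]
            have := (hball z hzb).2.2
            rw [one_mul, one_mul]
            gcongr
          · rw [Set.indicator_of_notMem hzb]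
            exact mul_nonneg (mul_nonneg (g01 _).1 (χ01 _).1) (by positivity)
        · have hz2 : 2 * ρ < ‖z‖ := by simpa using hzρ
          have hzb : z ∉ Metric.ball z₀ r := fun h => by
            have := hsub h
            linarith
          rw [Set.indicator_of_notMem hzb, Set.indicator_of_notMem hzρ]
          have : ∀ k, X k =ᶠ[𝓝 z] fun _ => 0 := by
            intro k
            filter_upwards [(isOpen_lt continuous_const continuous_norm).mem_nhds hz2] with y hy
            by_cases hyΩ : y ∈ Ω <;> simp [X, hyΩ, χ2 y hy]
          simp [(this _).fderiv_eq]
      · have hzb : z ∉ Metric.ball z₀ r := fun h => hz (hball z h).1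
        rw [Set.indicator_of_notMem hzb]
        simp only [(hXz z hz _).fderiv_eq]
        simpa using hE
    have i1 : Integrable ((Metric.ball z₀ r).indicator
        (fun _ => μ * (dissipation u z₀ / 2)) : Plane → ℝ) volume :=
      (integrable_indicator_iff measurableSet_ball).2
        (integrableOn_const measure_ball_lt_top.ne)
    have i2 : Integrable ((Metric.closedBall (0 : Plane) (2 * ρ)).indicator
        (fun _ => E₀ / ρ ^ 3) : Plane → ℝ) volume :=
      (integrable_indicator_iff measurableSet_closedBall).2
        (integrableOn_const measure_closedBall_lt_top.ne)
    have h3 := integral_mono (i1.sub i2) hint lower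
    rw [h0, integral_sub' i1 i2, integral_indicator_const _ measurableSet_ball,
      integral_indicator_const _ measurableSet_closedBall] at h3
    have hv : volume.real (Metric.closedBall (0 : Plane) (2 * ρ)) = (2 * ρ) ^ 2 * V₁ := by
      rw [Measure.addHaar_real_closedBall _ _ (by positivity)]
      simp [hV₁]
    rw [hv, ← hB] at h3
    simp only [smul_eq_mul] at h3
    linarith
  have lim : Tendsto (fun ρ : ℝ => E₀ / ρ ^ 3 * ((2 * ρ) ^ 2 * V₁)) atTop (𝓝 0) := by
    have h1 : Tendsto (fun ρ : ℝ => (4 * E₀ * V₁) / ρ) atTop (𝓝 0) :=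
      tendsto_const_nhds.div_atTop tendsto_id
    refine h1.congr' ?_
    filter_upwards [eventually_gt_atTop 0] with ρ hρ
    field_simp
    ring
  have := ge_of_tendsto lim main
  have : 0 < μ * (dissipation u z₀ / 2) * B := by positivity
  linarith

end

section

open Topology

/-! ### Uniqueness -/

theorem isOpen_exteriorDomain (R δ : ℝ) : IsOpen (exteriorDomain R δ) :=
  (Metric.isClosed_closedBall.union Metric.isClosed_closedBall).isOpen_compl

theorem frontier_exteriorDomain_subset {R : ℝ} (hR : 0 < R) (δ : ℝ) :
    frontier (exteriorDomain R δ) ⊆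
      Metric.sphere (leftCenter R δ) R ∪ Metric.sphere (rightCenter R δ) R := by
  rw [exteriorDomain, frontier_compl]
  refine (frontier_union_subset _ _).trans ?_
  rw [frontier_closedBall _ hR.ne', frontier_closedBall _ hR.ne']
  exact Set.union_subset_union Set.inter_subset_left Set.inter_subset_right

/-- Being C¹ on the closure provides, near each point of the closure, some family of derivatives
continuous at that point. Inside the open set it agrees with the true derivative, so the latter is
locally bounded up to the frontier, and compactness glues the local bounds. -/
theorem exists_fderiv_bound_on_closedBall {Ω : Set Plane} (hΩ : IsOpen Ω) {u : Plane → Plane}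
    (hu : ContDiffOn ℝ 1 u (closure Ω)) (r : ℝ) :
    ∃ M : ℝ, ∀ z ∈ Ω, ‖z‖ ≤ r → ‖fderiv ℝ u z‖ ≤ M := by
  have hK : IsCompact (closure Ω ∩ Metric.closedBall (0 : Plane) r) :=
    (isCompact_closedBall _ _).inter_left isClosed_closure
  have key : ∃ M : ℝ, ∀ z ∈ (closure Ω ∩ Metric.closedBall (0 : Plane) r) ∩ Ω,
      ‖fderiv ℝ u z‖ ≤ M := by
    refine hK.induction_on (p := fun s => ∃ M : ℝ, ∀ z ∈ s ∩ Ω, ‖fderiv ℝ u z‖ ≤ M)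
      ⟨0, by simp⟩ ?_ ?_ ?_
    · rintro s t hst ⟨M, hM⟩
      exact ⟨M, fun z hz => hM z ⟨hst hz.1, hz.2⟩⟩
    · rintro s t ⟨M, hM⟩ ⟨M', hM'⟩
      refine ⟨max M M', ?_⟩
      rintro z ⟨hz | hz, hzΩ⟩
      · exact (hM z ⟨hz, hzΩ⟩).trans (le_max_left _ _)
      · exact (hM' z ⟨hz, hzΩ⟩).trans (le_max_right _ _)
    · rintro x ⟨hx, -⟩
      have h1 : ContDiffWithinAt ℝ ((0 : ℕ) + 1) u (closure Ω) x := by simpa using hu x hx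
      obtain ⟨v, hv, -, f', hf', hc⟩ := (contDiffWithinAt_succ_iff_hasFDerivWithinAt
        (n := ((0 : ℕ) : WithTop ℕ∞)) (by simp)).1 h1
      rw [Set.insert_eq_of_mem hx] at hv
      have hc' : ContinuousWithinAt (fun y => ‖f' y‖) (closure Ω) x := by
        have := hc.continuousWithinAt.norm
        refine this.mono_of_mem_nhdsWithin ?_
        exact hv
      have h2 := hc'.eventually (gt_mem_nhds (lt_add_one ‖f' x‖))
      obtain ⟨o, ho, hxo, hov⟩ := mem_nhdsWithin.1 (inter_mem hv h2)
      refine ⟨o, mem_nhdsWithin_of_mem_nhds (ho.mem_nhds hxo), ‖f' x‖ + 1, ?_⟩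
      rintro z ⟨hzo, hzΩ⟩
      have hz := hov ⟨hzo, subset_closure hzΩ⟩
      have hd : HasFDerivAt u (f' z) z := by
        refine (hf' z hz.1).hasFDerivAt ?_
        refine mem_of_superset ((ho.inter hΩ).mem_nhds ⟨hzo, hzΩ⟩) ?_
        exact fun y hy => (hov ⟨hy.1, subset_closure hy.2⟩).1
      rw [hd.fderiv]
      exact le_of_lt hz.2
  obtain ⟨M, hM⟩ := key
  exact ⟨M, fun z hz hzr => hM z ⟨⟨subset_closure hz, by simpa using hzr⟩, hz⟩⟩

theorem IsBigO.exists_bound_cobounded {F : Type*} [NormedAddCommGroup F] {f : Plane → F}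
    {g : Plane → ℝ} (h : f =O[Bornology.cobounded Plane] g) :
    ∃ c r : ℝ, 0 < c ∧ 1 ≤ r ∧ ∀ z, r ≤ ‖z‖ → ‖f z‖ ≤ c * |g z| := by
  obtain ⟨c, hc, hcf⟩ := h.exists_pos
  rw [IsBigOWith] at hcf
  obtain ⟨r, -, hr⟩ := hasBasis_cobounded_norm.eventually_iff.1 hcf
  exact ⟨c, max r 1, hc, le_max_right _ _, fun z hz => hr ((le_max_left _ _).trans hz)⟩

theorem IsSingularFunctionTwo.exists_bound {μ R δ : ℝ} {u : Plane → Plane} {p : Plane → ℝ}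
    (h : IsSingularFunctionTwo μ R δ u p) : ∃ M : ℝ, ∀ z ∈ exteriorDomain R δ,
      ‖u z‖ ≤ M ∧ (1 + ‖z‖ ^ 2) * ‖fderiv ℝ u z‖ ≤ M ∧ (1 + ‖z‖ ^ 2) * |p z| ≤ M := by
  obtain ⟨C, hC⟩ := h.decay.velocity
  obtain ⟨c₁, r₁, hc₁, hr₁, h₁⟩ := IsBigO.exists_bound_cobounded hC
  obtain ⟨c₂, r₂, hc₂, hr₂, h₂⟩ := IsBigO.exists_bound_cobounded h.decay.gradient
  obtain ⟨c₃, r₃, hc₃, hr₃, h₃⟩ := IsBigO.exists_bound_cobounded h.decay.pressure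
  set r := max r₁ (max r₂ r₃) with hr
  have hK : IsCompact (closure (exteriorDomain R δ) ∩ Metric.closedBall (0 : Plane) r) :=
    (isCompact_closedBall _ _).inter_left isClosed_closure
  obtain ⟨M₁, hM₁⟩ := hK.exists_bound_of_continuousOn
    (h.stokes.contDiffOn_velocity_closure.continuousOn.mono Set.inter_subset_left)
  obtain ⟨M₂, hM₂⟩ := exists_fderiv_bound_on_closedBall (isOpen_exteriorDomain R δ)
    h.stokes.contDiffOn_velocity_closure r
  obtain ⟨M₃, hM₃⟩ := hK.exists_bound_of_continuousOn
    (h.stokes.continuousOn_pressure_closure.mono Set.inter_subset_left)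
  refine ⟨|M₁| + (1 + r ^ 2) * |M₂| + (1 + r ^ 2) * |M₃| + ‖C‖ + c₁ + 2 * c₂ + 2 * c₃,
    fun z hz => ?_⟩
  by_cases hzr : ‖z‖ ≤ r
  · have hzK : z ∈ closure (exteriorDomain R δ) ∩ Metric.closedBall (0 : Plane) r :=
      ⟨subset_closure hz, by simpa using hzr⟩
    have b1 := (hM₁ z hzK).trans (le_abs_self _)
    have b2 := (hM₂ z hz hzr).trans (le_abs_self _)
    have b3 := (hM₃ z hzK).trans (le_abs_self _)
    rw [Real.norm_eq_abs] at b3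
    have hz2 : ‖z‖ ^ 2 ≤ r ^ 2 := by gcongr
    have b2' : (1 + ‖z‖ ^ 2) * ‖fderiv ℝ u z‖ ≤ (1 + r ^ 2) * |M₂| := by gcongr
    have b3' : (1 + ‖z‖ ^ 2) * |p z| ≤ (1 + r ^ 2) * |M₃| := by gcongr
    have : 0 ≤ (1 + r ^ 2) * |M₂| := by positivity
    have : 0 ≤ (1 + r ^ 2) * |M₃| := by positivity
    have := abs_nonneg M₁
    have := norm_nonneg C
    exact ⟨by linarith, by linarith, by linarith⟩
  · push Not at hzr
    have e1 : r₁ ≤ ‖z‖ := (le_max_left _ _).trans hzr.le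
    have e2 : r₂ ≤ ‖z‖ := ((le_max_left _ _).trans (le_max_right _ _)).trans hzr.le
    have e3 : r₃ ≤ ‖z‖ := ((le_max_right _ _).trans (le_max_right _ _)).trans hzr.le
    have hz1 : 1 ≤ ‖z‖ := hr₁.trans e1
    have hz0 : 0 < ‖z‖ := by linarith
    have hz2 : 1 ≤ ‖z‖ ^ 2 := one_le_pow₀ hz1
    have b1 : ‖u z‖ ≤ c₁ + ‖C‖ := by
      have := h₁ z e1
      rw [abs_of_pos (by positivity)] at this
      have h4 : c₁ * ‖z‖⁻¹ ≤ c₁ := mul_le_of_le_one_right hc₁.le (inv_le_one_of_one_le₀ hz1)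
      have := norm_sub_norm_le (u z) C
      linarith
    have hsq : ∀ c a : ℝ, 0 < c → a ≤ c * |(‖z‖ ^ 2)⁻¹| → (1 + ‖z‖ ^ 2) * a ≤ 2 * c := by
      intro c a hc ha
      rw [abs_of_pos (by positivity), ← div_eq_mul_inv, le_div_iff₀ (by positivity)] at ha
      rcases le_total 0 a with h0 | h0
      · nlinarith
      · nlinarith
    have b2 := hsq _ _ hc₂ (h₂ z e2)
    have b3 := hsq _ _ hc₃ (h₃ z e3)
    rw [Real.norm_eq_abs] at b3
    have : 0 ≤ (1 + r ^ 2) * |M₂| := by positivity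
    have : 0 ≤ (1 + r ^ 2) * |M₃| := by positivity
    have := abs_nonneg M₁
    have := norm_nonneg C
    exact ⟨by linarith, by linarith, by linarith⟩

/-- The extension of u by zero is continuous on the plane, and a level set of a nonzero value is
both closed and open, because near such a point the derivative vanishes. Connectedness of the plane
suffices; Ω itself need not be connected. -/
theorem eqOn_zero_of_fderiv_eq_zero {Ω : Set Plane} (hΩ : IsOpen Ω) (hne : Ωᶜ.Nonempty)
    {u : Plane → Plane} (hu : DifferentiableOn ℝ u Ω) (huc : ContinuousOn u (closure Ω))
    (hu0 : ∀ z ∈ frontier Ω, u z = 0) (hd : ∀ z ∈ Ω, u z ≠ 0 → fderiv ℝ u z = 0) :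
    ∀ z ∈ Ω, u z = 0 := by
  intro z₀ hz₀
  by_contra hn
  set v := Ω.indicator u with hv
  have hvc : Continuous v := by
    rw [continuous_iff_continuousAt]
    intro z
    by_cases hz : z ∈ Ω
    · refine ((hu.differentiableAt (hΩ.mem_nhds hz)).continuousAt).congr ?_
      filter_upwards [hΩ.mem_nhds hz] with y hy
      simp [hv, hy]
    · have hvz : v z = 0 := by simp [hv, hz]
      rw [ContinuousAt, hvz]
      by_cases hzc : z ∈ closure Ω
      · have hf : z ∈ frontier Ω := ⟨hzc, by rwa [hΩ.interior_eq]⟩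
        rw [Metric.tendsto_nhds]
        intro ε hε
        have h1 := huc z hzc
        rw [ContinuousWithinAt, hu0 z hf] at h1
        filter_upwards [eventually_nhdsWithin_iff.1 (Metric.tendsto_nhds.1 h1 ε hε)] with y hy
        by_cases hyΩ : y ∈ Ω
        · simpa [hv, hyΩ] using hy (subset_closure hyΩ)
        · simpa [hv, hyΩ] using hε
      · refine tendsto_const_nhds.congr' ?_
        filter_upwards [isClosed_closure.isOpen_compl.mem_nhds hzc] with y hy
        have : y ∉ Ω := fun h => hy (subset_closure h)
        simp [hv, this]
  have hv0 : v z₀ = u z₀ := by simp [hv, hz₀]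
  have hclopen : IsClopen {z | v z = v z₀} := by
    refine ⟨isClosed_eq hvc continuous_const, isOpen_iff_mem_nhds.2 fun z hz => ?_⟩
    have hz' : v z = v z₀ := hz
    have hvz : v z ≠ 0 := by rw [hz', hv0]; exact hn
    obtain ⟨r, hr, hb⟩ := Metric.eventually_nhds_iff_ball.1
      (hvc.continuousAt.eventually_ne hvz)
    have hbΩ : ∀ y ∈ Metric.ball z r, y ∈ Ω := fun y hy => by
      by_contra hyΩ
      exact hb y hy (by simp [hv, hyΩ])
    have huv : ∀ y ∈ Metric.ball z r, v y = u y := fun y hy => by simp [hv, hbΩ y hy]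
    refine mem_of_superset (Metric.ball_mem_nhds z hr) fun y hy => ?_
    have := (convex_ball z r).norm_image_sub_le_of_norm_fderiv_le (𝕜 := ℝ) (f := u) (C := 0)
      (fun x hx => hu.differentiableAt (hΩ.mem_nhds (hbΩ x hx)))
      (fun x hx => by
        rw [hd x (hbΩ x hx) (by rw [← huv x hx]; exact hb x hx)]; simp)
      (Metric.mem_ball_self hr) hy
    have h2 : u y = u z := by
      rw [zero_mul] at this
      exact sub_eq_zero.1 (norm_le_zero_iff.1 this)
    change v y = v z₀
    rw [huv y hy, h2, ← huv z (Metric.mem_ball_self hr), hz']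
  have huniv := hclopen.eq_univ ⟨z₀, rfl⟩
  obtain ⟨y, hy⟩ := hne
  have h1 : v y = v z₀ := by
    have : y ∈ {z | v z = v z₀} := huniv ▸ Set.mem_univ y
    exact this
  rw [hv0] at h1
  have h2 : v y = 0 := by simp [hv, show y ∉ Ω from hy]
  exact hn (h1 ▸ h2)

theorem mem_exteriorDomain_iff {R δ : ℝ} (hR : 0 < R) (z : Plane) : z ∈ exteriorDomain R δ ↔
    R ^ 2 < (z 0 + R + δ / 2) ^ 2 + z 1 ^ 2 ∧ R ^ 2 < (z 0 - R - δ / 2) ^ 2 + z 1 ^ 2 := by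
  have key : ∀ c : Plane, z ∈ Metric.closedBall c R ↔
      (z 0 - c 0) ^ 2 + (z 1 - c 1) ^ 2 ≤ R ^ 2 := by
    intro c
    rw [Metric.mem_closedBall, EuclideanSpace.dist_eq, Real.sqrt_le_left hR.le, Fin.sum_univ_two,
      Real.dist_eq, Real.dist_eq, sq_abs, sq_abs]
  rw [exteriorDomain, Set.mem_compl_iff, Set.mem_union, not_or, key, key, not_le, not_le]
  simp only [leftCenter, rightCenter, Matrix.cons_val_zero, Matrix.cons_val_one]
  ring_nf

/-- Both centres lie on the horizontal axis, so moving vertically away from that axis increases the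
distance to each of them. -/
theorem add_vertical_mem_exteriorDomain {R δ : ℝ} (hR : 0 < R) {z : Plane}
    (hz : z ∈ exteriorDomain R δ) {t : ℝ} (ht : 0 ≤ t * z 1) : z + t • e 1 ∈ exteriorDomain R δ := by
  rw [mem_exteriorDomain_iff hR] at hz ⊢
  have e0 : (z + t • e 1) 0 = z 0 := by simp [e]
  have e1 : (z + t • e 1) 1 = z 1 + t := by simp [e]
  rw [e0, e1]
  constructor <;> nlinarith [hz.1, hz.2, sq_nonneg t]

/-- From every point a vertical ray escapes to infinity inside the domain. Along it p is constant
and tends to 0. -/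
theorem pressure_eq_zero_of_gradient_eq_zero {R δ : ℝ} (hR : 0 < R) {p : Plane → ℝ}
    (hp : DifferentiableOn ℝ p (exteriorDomain R δ))
    (hg : ∀ z ∈ exteriorDomain R δ, ∇ p z = 0)
    (hdec : Tendsto p (Bornology.cobounded Plane) (𝓝 0)) :
    ∀ z ∈ exteriorDomain R δ, p z = 0 := by
  intro z hz
  obtain ⟨σ, hσ, hσz⟩ : ∃ σ : ℝ, |σ| = 1 ∧ 0 ≤ σ * z 1 := by
    rcases le_total 0 (z 1) with h | h
    · exact ⟨1, by simp, by simpa using h⟩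
    · exact ⟨-1, by simp, by simpa using h⟩
  have hin : ∀ t : ℝ, 0 ≤ t → z + (t * σ) • e 1 ∈ exteriorDomain R δ := fun t ht =>
    add_vertical_mem_exteriorDomain hR hz (by rw [mul_assoc]; exact mul_nonneg ht hσz)
  have hder : ∀ t : ℝ, 0 ≤ t → HasDerivAt (fun t : ℝ => p (z + (t * σ) • e 1)) 0 t := by
    intro t ht
    have h1 : HasFDerivAt p (0 : Plane →L[ℝ] ℝ) (z + (t * σ) • e 1) := by
      have h2 := (hp.differentiableAt ((isOpen_exteriorDomain R δ).mem_nhds (hin t ht))).hasFDerivAt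
      rwa [← toDual_gradient, hg _ (hin t ht), map_zero] at h2
    have h3 : HasDerivAt (fun t : ℝ => z + (t * σ) • e 1) (σ • e 1) t := by
      have := (((hasDerivAt_id t).mul_const σ).smul_const (e 1)).const_add z
      simpa using this
    exact h1.comp_hasDerivAt t h3
  have hconst : ∀ t : ℝ, 0 ≤ t → p (z + (t * σ) • e 1) = p z := by
    intro t ht
    have := (convex_Ici (0 : ℝ)).norm_image_sub_le_of_norm_hasDerivWithin_le (C := 0)
      (f := fun t : ℝ => p (z + (t * σ) • e 1)) (f' := fun _ => 0)
      (fun x hx => (hder x hx).hasDerivWithinAt) (fun _ _ => by simp)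
      (Set.mem_Ici.2 le_rfl) (Set.mem_Ici.2 ht)
    simp only [zero_mul, zero_smul, add_zero] at this
    exact sub_eq_zero.1 (norm_le_zero_iff.1 this)
  have hlim : Tendsto (fun t : ℝ => z + (t * σ) • e 1) atTop (Bornology.cobounded Plane) := by
    rw [← tendsto_norm_atTop_iff_cobounded]
    refine tendsto_atTop_mono' atTop ?_ (tendsto_atTop_add_const_right atTop (-‖z‖) tendsto_id)
    filter_upwards [eventually_ge_atTop 0] with t ht
    have h1 : ‖(t * σ) • e 1‖ = t := by
      rw [norm_smul, norm_e, mul_one, norm_mul, Real.norm_eq_abs, Real.norm_eq_abs, hσ, mul_one,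
        abs_of_nonneg ht]
    have h2 := norm_sub_le (z + (t * σ) • e 1) z
    rw [add_sub_cancel_left, h1] at h2
    simp only [id]
    linarith
  have h4 : Tendsto (fun t : ℝ => p (z + (t * σ) • e 1)) atTop (𝓝 (p z)) :=
    tendsto_const_nhds.congr' ((eventually_ge_atTop 0).mono fun t ht => (hconst t ht).symm)
  exact tendsto_nhds_unique h4 (hdec.comp hlim)

/-- Uniqueness of the singular function. -/
theorem IsSingularFunctionTwo.eqOn {μ R δ : ℝ} (hμ : 0 < μ) (hR : 0 < R)
    {u v : Plane → Plane} {p q : Plane → ℝ}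
    (hu : IsSingularFunctionTwo μ R δ u p) (hv : IsSingularFunctionTwo μ R δ v q) :
    Set.EqOn u v (closure (exteriorDomain R δ)) ∧
      Set.EqOn p q (closure (exteriorDomain R δ)) := by
  have hΩ := isOpen_exteriorDomain R δ
  set Ω := exteriorDomain R δ with hΩdef
  obtain ⟨M, hM⟩ := hu.exists_bound
  obtain ⟨M', hM'⟩ := hv.exists_bound
  have cu : ∀ z ∈ Ω, ContDiffAt ℝ 2 u z := fun z hz =>
    hu.stokes.contDiffOn_velocity.contDiffAt (hΩ.mem_nhds hz)
  have cv : ∀ z ∈ Ω, ContDiffAt ℝ 2 v z := fun z hz =>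
    hv.stokes.contDiffOn_velocity.contDiffAt (hΩ.mem_nhds hz)
  have cp : ∀ z ∈ Ω, DifferentiableAt ℝ p z := fun z hz =>
    (hu.stokes.contDiffOn_pressure.contDiffAt (hΩ.mem_nhds hz)).differentiableAt (by norm_num)
  have cq : ∀ z ∈ Ω, DifferentiableAt ℝ q z := fun z hz =>
    (hv.stokes.contDiffOn_pressure.contDiffAt (hΩ.mem_nhds hz)).differentiableAt (by norm_num)
  have hgrad : ∀ z ∈ Ω, ∇ (p - q) z = ∇ p z - ∇ q z := fun z hz => by
    rw [gradient, fderiv_sub (cp z hz) (cq z hz), map_sub]; rfl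
  have hfd : ∀ z ∈ Ω, fderiv ℝ (u - v) z = fderiv ℝ u z - fderiv ℝ v z := fun z hz =>
    fderiv_sub ((cu z hz).differentiableAt (by norm_num)) ((cv z hz).differentiableAt (by norm_num))
  have hmom : ∀ z ∈ Ω, μ • (Δ (u - v)) z = ∇ (p - q) z := fun z hz => by
    rw [(cu z hz).laplacian_sub (cv z hz), smul_sub, hu.stokes.momentum z hz,
      hv.stokes.momentum z hz, hgrad z hz]
  have hdiv : ∀ z ∈ Ω, divergence (u - v) z = 0 := fun z hz => by
    have h1 := hu.stokes.incompressible z hz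
    have h2 := hv.stokes.incompressible z hz
    rw [divergence_eq_sum] at h1 h2 ⊢
    rw [hfd z hz]
    simp only [sub_apply, PiLp.sub_apply, Finset.sum_sub_distrib, h1, h2, sub_zero]
  have hcont : ContinuousOn (u - v) (closure Ω) :=
    hu.stokes.contDiffOn_velocity_closure.continuousOn.sub
      hv.stokes.contDiffOn_velocity_closure.continuousOn
  have hbd : ∀ z ∈ frontier Ω, (u - v) z = 0 := fun z hz => by
    rw [Pi.sub_apply]
    rcases frontier_exteriorDomain_subset hR δ hz with h | h
    · rw [hu.boundary_left z h, hv.boundary_left z h, sub_self]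
    · rw [hu.boundary_right z h, hv.boundary_right z h, sub_self]
  have hbound : ∀ z ∈ Ω, ‖(u - v) z‖ ≤ M + M' ∧ (1 + ‖z‖ ^ 2) * ‖fderiv ℝ (u - v) z‖ ≤ M + M' ∧
      (1 + ‖z‖ ^ 2) * |(p - q) z| ≤ M + M' := fun z hz => by
    obtain ⟨a1, a2, a3⟩ := hM z hz
    obtain ⟨b1, b2, b3⟩ := hM' z hz
    have hz0 : 0 ≤ 1 + ‖z‖ ^ 2 := by positivity
    refine ⟨(norm_sub_le _ _).trans (by linarith), ?_, ?_⟩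
    · rw [hfd z hz]
      have := mul_le_mul_of_nonneg_left (norm_sub_le (fderiv ℝ u z) (fderiv ℝ v z)) hz0
      linarith
    · have := mul_le_mul_of_nonneg_left (abs_sub (p z) (q z)) hz0
      rw [Pi.sub_apply]
      linarith
  have hzero : ∀ z ∈ Ω, (u - v) z = 0 := by
    refine eqOn_zero_of_fderiv_eq_zero hΩ ?_ ?_ hcont hbd fun z hz hne => ?_
    · exact ⟨leftCenter R δ, fun h => h (Or.inl (Metric.mem_closedBall_self hR.le))⟩
    · exact fun z hz => (((cu z hz).sub (cv z hz)).differentiableAt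
        (by norm_num)).differentiableWithinAt
    · exact fderiv_eq_zero_of_energy hμ hΩ
        (hu.stokes.contDiffOn_velocity.sub hv.stokes.contDiffOn_velocity)
        (hu.stokes.contDiffOn_pressure.sub hv.stokes.contDiffOn_pressure)
        hmom hdiv hcont hbd hbound hz hne
  have hpz : ∀ z ∈ Ω, (p - q) z = 0 := by
    refine pressure_eq_zero_of_gradient_eq_zero hR
      (fun z hz => ((cp z hz).sub (cq z hz)).differentiableWithinAt) (fun z hz => ?_) ?_
    · rw [← hmom z hz]
      have : (u - v) =ᶠ[𝓝 z] fun _ => 0 := by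
        filter_upwards [hΩ.mem_nhds hz] with y hy
        exact hzero y hy
      rw [(InnerProductSpace.laplacian_congr_nhds this).eq_of_nhds]
      simp
    · have h1 := hu.decay.pressure.sub hv.decay.pressure
      refine h1.trans_tendsto ?_
      have : Tendsto (fun z : Plane => ‖z‖ ^ 2) (Bornology.cobounded Plane) atTop :=
        (tendsto_pow_atTop two_ne_zero).comp tendsto_norm_cobounded_atTop
      exact this.inv_tendsto_atTop
  constructor
  · refine Set.EqOn.of_subset_closure (s := Ω) (fun z hz => sub_eq_zero.1 (hzero z hz))
      hu.stokes.contDiffOn_velocity_closure.continuousOn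
      hv.stokes.contDiffOn_velocity_closure.continuousOn subset_closure subset_rfl
  · exact Set.EqOn.of_subset_closure (s := Ω) (fun z hz => sub_eq_zero.1 (hpz z hz))
      hu.stokes.continuousOn_pressure_closure
      hv.stokes.continuousOn_pressure_closure subset_closure subset_rfl

end

section

open Complex ComplexConjugate Topology

/-! ### Stokes flows in bipolar coordinates -/

/-- The bipolar coordinate `(z + a) / (z - a)`. -/
def bipolar (a : ℝ) (z : ℂ) : ℂ := (z + a) / (z - a)

/-- The annulus `q⁻¹ < |t| < q`. -/
def annulus (q : ℝ) : Set ℂ := {t | q⁻¹ < ‖t‖ ∧ ‖t‖ < q}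

theorem isOpen_annulus (q : ℝ) : IsOpen (annulus q) :=
  (isOpen_lt continuous_const continuous_norm).inter (isOpen_lt continuous_norm continuous_const)

theorem ne_zero_of_mem_annulus {q : ℝ} (hq : 0 < q) {t : ℂ} (ht : t ∈ annulus q) : t ≠ 0 := by
  rintro rfl
  have := ht.1
  rw [norm_zero] at this
  exact absurd this (not_lt.2 (inv_pos.2 hq).le)

theorem inv_mem_annulus {q : ℝ} (hq : 0 < q) {t : ℂ} (ht : t ∈ annulus q) : t⁻¹ ∈ annulus q := by
  have h0 : 0 < ‖t‖ := norm_pos_iff.2 (ne_zero_of_mem_annulus hq ht)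
  refine ⟨?_, ?_⟩
  · rw [norm_inv]; exact inv_strictAnti₀ h0 ht.2
  · rw [norm_inv]; exact inv_lt_of_inv_lt₀ hq ht.1

theorem one_mem_annulus {q : ℝ} (hq : 1 < q) : (1 : ℂ) ∈ annulus q := by
  simp [annulus, inv_lt_one_of_one_lt₀ hq, hq]

/-- The points of the plane whose bipolar coordinate lies in the annulus. -/
def bipolarDomain (a q : ℝ) : Set ℂ := bipolar a ⁻¹' annulus q

section

variable {a q : ℝ} {z : ℂ}

theorem sub_ne_zero_of_mem_bipolarDomain (hq : 0 < q) (hz : z ∈ bipolarDomain a q) :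
    z - a ≠ 0 := fun h => ne_zero_of_mem_annulus hq hz (by simp [bipolar, h])

theorem add_ne_zero_of_mem_bipolarDomain (hq : 0 < q) (hz : z ∈ bipolarDomain a q) :
    z + a ≠ 0 := fun h => ne_zero_of_mem_annulus hq hz (by simp [bipolar, h])

theorem bipolar_sub_one (hz : z - a ≠ 0) : bipolar a z - 1 = 2 * a / (z - a) := by
  rw [bipolar]; field_simp; ring

theorem bipolar_ne_one (ha : a ≠ 0) (hz : z - a ≠ 0) : bipolar a z - 1 ≠ 0 := by
  rw [bipolar_sub_one hz]
  exact div_ne_zero (mul_ne_zero two_ne_zero (ofReal_ne_zero.2 ha)) hz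

theorem eq_of_bipolar (ha : a ≠ 0) (hz : z - a ≠ 0) :
    z = a * (bipolar a z + 1) / (bipolar a z - 1) := by
  have : (a : ℂ) ≠ 0 := ofReal_ne_zero.2 ha
  rw [bipolar_sub_one hz, bipolar]
  field_simp
  ring

theorem hasDerivAt_bipolar (hz : z - a ≠ 0) :
    HasDerivAt (bipolar a) (-(2 * a) / (z - a) ^ 2) z := by
  have h1 : HasDerivAt (fun z : ℂ => z + a) 1 z := (hasDerivAt_id z).add_const _
  have h2 : HasDerivAt (fun z : ℂ => z - a) 1 z := (hasDerivAt_id z).sub_const _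
  refine (h1.div h2 hz).congr_deriv ?_
  ring

theorem isOpen_bipolarDomain (hq : 0 < q) : IsOpen (bipolarDomain a q) := by
  have h1 : ContinuousOn (bipolar a) {z | z - a ≠ 0} := fun z hz =>
    (hasDerivAt_bipolar hz).continuousAt.continuousWithinAt
  have h2 : IsOpen {z : ℂ | z - a ≠ 0} := isOpen_ne_fun (by fun_prop) continuous_const
  have h3 := h1.isOpen_inter_preimage h2 (isOpen_annulus q)
  convert h3 using 1
  ext z
  exact ⟨fun hz => ⟨sub_ne_zero_of_mem_bipolarDomain hq hz, hz⟩, fun hz => hz.2⟩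

theorem bipolar_neg (z : ℂ) : bipolar a (-z) = (bipolar a z)⁻¹ := by
  rw [bipolar, bipolar, inv_div, ← neg_div_neg_eq]
  congr 1 <;> ring

theorem neg_mem_bipolarDomain (hq : 0 < q) (hz : z ∈ bipolarDomain a q) :
    -z ∈ bipolarDomain a q := by
  rw [bipolarDomain, Set.mem_preimage, bipolar_neg]
  exact inv_mem_annulus hq hz

end

/-! ### The family of flows and its Goursat functions -/

/-- The analytic function `Π` of the flow, in the bipolar coordinate. -/
def flowPi (a c r k : ℝ) (A : ℂ → ℂ) (t : ℂ) : ℂ :=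
  -c * (t - 1) ^ 2 / (4 * a * t) + r +
    k * (A t + A t⁻¹ - (t - 1) * (t * deriv A t - deriv A t⁻¹ / t ^ 2))

/-- The analytic function `L` of the flow, in the bipolar coordinate. -/
def flowL (a c k l : ℝ) (A : ℂ → ℂ) (t : ℂ) : ℂ :=
  -c * (t ^ 2 - 1) / (4 * t) +
    k * a * (A t - A t⁻¹ - (t - 1) * (t * deriv A t + deriv A t⁻¹ / t ^ 2)) -
    l * (t - t⁻¹) / (2 * a)

/-- The analytic function `J` of the flow, in the bipolar coordinate. -/
def flowJ (a c : ℝ) (t : ℂ) : ℂ := -c * (t - 1) ^ 2 / (4 * a * t)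

/-- The function `G` of the flow. -/
def flowG (a c r k : ℝ) (A : ℂ → ℂ) (z : ℂ) : ℂ :=
  (c * (Real.log ‖bipolar a z‖ : ℝ) + r * z) +
    k * ((z + a) * A (bipolar a z) + (z - a) * A (bipolar a z)⁻¹)

/-- The flow `2 ∂Φ/∂z̄` of the stream function
`Φ = c x log|t| + r|z|² + k Re(|z+a|² A(t) + |z-a|² A(t⁻¹)) - l log(|z+a||z-a|)`. -/
def flowV (a c r k l : ℝ) (A : ℂ → ℂ) : ℂ → ℂ :=
  goursat (flowG a c r k A) (fun z => flowPi a c r k A (bipolar a z))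
    (fun z => flowL a c k l A (bipolar a z))

/-- Up to a constant, log|f| is the real part of log(f(w)/f(z)). Normalising by f(z) puts the
argument at 1, inside the slit plane, so the principal branch is available at every point. -/
theorem hasFDerivAt_log_norm {f : ℂ → ℂ} {f' z : ℂ} (hf : HasDerivAt f f' z) (h0 : f z ≠ 0) :
    HasFDerivAt (fun w => ((Real.log ‖f w‖ : ℝ) : ℂ))
      (wirtinger (f' / (2 * f z)) (conj (f' / (2 * f z)))) z := by
  have h1 : HasDerivAt (fun w => Complex.log (f w / f z)) (f' / f z) z := by
    have := (hf.div_const (f z)).clog (by rw [div_self h0]; exact one_mem_slitPlane)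
    rwa [div_self h0, div_one] at this
  have h2 : HasFDerivAt (fun w => (1 / 2 : ℂ) * (Complex.log (f w / f z) +
      conj (Complex.log (f w / f z))) + (Real.log ‖f z‖ : ℝ))
      (wirtinger (f' / (2 * f z)) (conj (f' / (2 * f z)))) z := by
    have h3 := hasFDerivAt_wirtinger_mul (hasDerivAt_const z (1 / 2 : ℂ)).hasFDerivAt_wirtinger
      (hasFDerivAt_wirtinger_add h1.hasFDerivAt_wirtinger
        (hasFDerivAt_wirtinger_conj h1.hasFDerivAt_wirtinger))
    refine (h3.add_const _).congr_fderiv ?_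
    congr 1
    · simp; field_simp
    · simp only [map_div₀, map_mul, map_ofNat, zero_mul, zero_add]
      field_simp
  refine h2.congr_of_eventuallyEq ?_
  filter_upwards [hf.continuousAt.eventually_ne h0] with w hw
  have h4 : Real.log ‖f w‖ = (Complex.log (f w / f z)).re + Real.log ‖f z‖ := by
    rw [Complex.log_re, norm_div, Real.log_div (norm_ne_zero_iff.2 hw) (norm_ne_zero_iff.2 h0)]
    ring
  rw [h4, Complex.add_conj]
  push_cast
  ring

section

variable {a c r k l q : ℝ} {A : ℂ → ℂ}

theorem hasDerivAt_comp_inv (hq : 0 < q) (hA : DifferentiableOn ℂ A (annulus q)) {t : ℂ}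
    (ht : t ∈ annulus q) : HasDerivAt (fun t => A t⁻¹) (-(deriv A t⁻¹ / t ^ 2)) t := by
  have h1 := (hA.differentiableAt ((isOpen_annulus q).mem_nhds (inv_mem_annulus hq ht))).hasDerivAt
  have h2 := h1.comp t (hasDerivAt_inv (ne_zero_of_mem_annulus hq ht))
  refine h2.congr_deriv ?_
  ring

theorem differentiableOn_comp_inv (hq : 0 < q) (hA : DifferentiableOn ℂ A (annulus q)) :
    DifferentiableOn ℂ (fun t => A t⁻¹) (annulus q) := fun _ ht =>
  (hasDerivAt_comp_inv hq hA ht).differentiableAt.differentiableWithinAt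

theorem differentiableOn_flowPi (ha : a ≠ 0) (hq : 0 < q)
    (hA : DifferentiableOn ℂ A (annulus q)) :
    DifferentiableOn ℂ (flowPi a c r k A) (annulus q) := by
  have h1 := differentiableOn_comp_inv hq hA
  have h2 := hA.deriv (isOpen_annulus q)
  have h3 := differentiableOn_comp_inv hq h2
  have h0 : ∀ t ∈ annulus q, t ≠ 0 := fun t => ne_zero_of_mem_annulus hq
  unfold flowPi
  refine DifferentiableOn.add (DifferentiableOn.add (DifferentiableOn.div (by fun_prop)
    (by fun_prop) fun t ht => ?_) (by fun_prop)) (DifferentiableOn.mul (by fun_prop)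
    (DifferentiableOn.sub (hA.add h1) (DifferentiableOn.mul (by fun_prop)
    (DifferentiableOn.sub (differentiableOn_id.mul h2) (h3.div (by fun_prop) fun t ht => ?_)))))
  · exact mul_ne_zero (mul_ne_zero (by norm_num) (ofReal_ne_zero.2 ha)) (h0 t ht)
  · exact pow_ne_zero 2 (h0 t ht)

theorem differentiableOn_flowL (hq : 0 < q) (hA : DifferentiableOn ℂ A (annulus q)) :
    DifferentiableOn ℂ (flowL a c k l A) (annulus q) := by
  have h1 := differentiableOn_comp_inv hq hA
  have h2 := hA.deriv (isOpen_annulus q)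
  have h3 := differentiableOn_comp_inv hq h2
  have h0 : ∀ t ∈ annulus q, t ≠ 0 := fun t => ne_zero_of_mem_annulus hq
  unfold flowL
  refine DifferentiableOn.sub (DifferentiableOn.add (DifferentiableOn.div (by fun_prop)
    (by fun_prop) fun t ht => ?_) (DifferentiableOn.mul (by fun_prop)
    (DifferentiableOn.sub (hA.sub h1) (DifferentiableOn.mul (by fun_prop)
    (DifferentiableOn.add (differentiableOn_id.mul h2) (h3.div (by fun_prop) fun t ht => ?_))))))
    (DifferentiableOn.div_const (DifferentiableOn.mul (by fun_prop)
      (differentiableOn_id.sub (differentiableOn_id.inv h0))) _)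
  · exact mul_ne_zero (by norm_num) (h0 t ht)
  · exact pow_ne_zero 2 (h0 t ht)

theorem differentiableOn_flowJ (ha : a ≠ 0) (hq : 0 < q) :
    DifferentiableOn ℂ (flowJ a c) (annulus q) := by
  unfold flowJ
  refine DifferentiableOn.div (by fun_prop) (by fun_prop) fun t ht => ?_
  exact mul_ne_zero (mul_ne_zero (by norm_num) (ofReal_ne_zero.2 ha))
    (ne_zero_of_mem_annulus hq ht)

theorem differentiableOn_comp_bipolar (hq : 0 < q) {f : ℂ → ℂ}
    (hf : DifferentiableOn ℂ f (annulus q)) :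
    DifferentiableOn ℂ (fun z => f (bipolar a z)) (bipolarDomain a q) := fun z hz =>
  ((hf.differentiableAt ((isOpen_annulus q).mem_nhds hz)).comp z
    (hasDerivAt_bipolar (sub_ne_zero_of_mem_bipolarDomain hq hz)).differentiableAt
    ).differentiableWithinAt

theorem hasFDerivAt_flowG (ha : a ≠ 0) (hq : 0 < q) (hA : DifferentiableOn ℂ A (annulus q))
    {z : ℂ} (hz : z ∈ bipolarDomain a q) :
    HasFDerivAt (flowG a c r k A) (wirtinger (flowPi a c r k A (bipolar a z))
      (conj (flowJ a c (bipolar a z)))) z := by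
  have hs := sub_ne_zero_of_mem_bipolarDomain hq hz
  have hp := add_ne_zero_of_mem_bipolarDomain hq hz
  have ht0 := ne_zero_of_mem_annulus hq hz
  have hac : (a : ℂ) ≠ 0 := ofReal_ne_zero.2 ha
  have hb := hasDerivAt_bipolar hs
  have d1 := (hA.differentiableAt ((isOpen_annulus q).mem_nhds hz)).hasDerivAt.comp z hb
  have d2 := HasDerivAt.comp z (h₂ := fun t => A t⁻¹) (hasDerivAt_comp_inv hq hA hz) hb
  have d3 := ((((hasDerivAt_id z).add_const (a : ℂ)).mul d1).add
    (((hasDerivAt_id z).sub_const (a : ℂ)).mul d2)).const_mul (k : ℂ)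
  have d4 := hasFDerivAt_wirtinger_mul (hasDerivAt_const z (c : ℂ)).hasFDerivAt_wirtinger
    (hasFDerivAt_log_norm hb ht0)
  have d5 := (hasDerivAt_id z).const_mul (r : ℂ)
  have d6 := hasFDerivAt_wirtinger_add (hasFDerivAt_wirtinger_add d4 d5.hasFDerivAt_wirtinger)
    d3.hasFDerivAt_wirtinger
  refine HasFDerivAt.congr_fderiv (f := flowG a c r k A) d6 ?_
  congr 1
  · simp only [flowPi, bipolar, id, Function.comp]
    field_simp
    ring
  · simp only [flowJ, bipolar] at *
    simp only [map_div₀, map_mul, map_neg, map_pow, map_sub, map_add, map_one, conj_ofReal]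
    have hs' : conj z - a ≠ 0 := by simpa using (map_ne_zero (starRingEnd ℂ)).2 hs
    have hp' : conj z + a ≠ 0 := by simpa using (map_ne_zero (starRingEnd ℂ)).2 hp
    simp only [map_ofNat]
    field_simp
    ring

theorem contDiffOn_flowG (hq : 0 < q) (hA : DifferentiableOn ℂ A (annulus q)) :
    ContDiffOn ℝ 2 (flowG a c r k A) (bipolarDomain a q) := by
  have hU := isOpen_bipolarDomain (a := a) hq
  have hb : DifferentiableOn ℂ (bipolar a) (bipolarDomain a q) := fun z hz =>
    (hasDerivAt_bipolar (sub_ne_zero_of_mem_bipolarDomain hq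
      hz)).differentiableAt.differentiableWithinAt
  have cb : ContDiffOn ℝ 2 (bipolar a) (bipolarDomain a q) :=
    (hb.contDiffOn hU).restrict_scalars ℝ
  have c1 : ContDiffOn ℝ 2 (fun z => A (bipolar a z)) (bipolarDomain a q) :=
    ((differentiableOn_comp_bipolar hq hA).contDiffOn hU).restrict_scalars ℝ
  have c2 : ContDiffOn ℝ 2 (fun z => A (bipolar a z)⁻¹) (bipolarDomain a q) :=
    ((differentiableOn_comp_bipolar hq (differentiableOn_comp_inv hq hA)).contDiffOn
      hU).restrict_scalars ℝ
  have c3 : ContDiffOn ℝ 2 (fun z => ((Real.log ‖bipolar a z‖ : ℝ) : ℂ)) (bipolarDomain a q) := by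
    refine ofRealCLM.contDiff.comp_contDiffOn (ContDiffOn.log (cb.norm ℝ fun z hz => ?_)
      fun z hz => ?_)
    · exact ne_zero_of_mem_annulus hq hz
    · exact norm_ne_zero_iff.2 (ne_zero_of_mem_annulus hq hz)
  unfold flowG
  exact ((contDiffOn_const.mul c3).add (contDiffOn_const.mul contDiffOn_id)).add
    (contDiffOn_const.mul (((contDiffOn_id.add contDiffOn_const).mul c1).add
      ((contDiffOn_id.sub contDiffOn_const).mul c2)))

theorem isStokesSolution_flowV {μ : ℝ} {Ω : Set Plane} (ha : a ≠ 0) (hq : 0 < q)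
    (hA : DifferentiableOn ℂ A (annulus q))
    (hΩ : closure Ω ⊆ planeEquiv.symm ⁻¹' bipolarDomain a q) :
    IsStokesSolution μ Ω (planeVelocity (flowV a c r k l A))
      (planePressure μ fun z => flowPi a c r k A (bipolar a z)) :=
  isStokesSolution_goursat (isOpen_bipolarDomain hq) hΩ (contDiffOn_flowG hq hA)
    (fun _ hz => hasFDerivAt_flowG ha hq hA hz)
    (differentiableOn_comp_bipolar hq (differentiableOn_flowPi ha hq hA))
    (differentiableOn_comp_bipolar hq (differentiableOn_flowL hq hA))
    (differentiableOn_comp_bipolar hq (differentiableOn_flowJ ha hq))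

theorem flowPi_inv {t : ℂ} (ht : t ≠ 0) : flowPi a c r k A t⁻¹ = flowPi a c r k A t := by
  simp only [flowPi, inv_inv]
  by_cases ha : (a : ℂ) = 0
  · simp only [ha]
    field_simp
    ring
  · field_simp
    ring

theorem flowL_inv {t : ℂ} (ht : t ≠ 0) : flowL a c k l A t⁻¹ = -flowL a c k l A t := by
  simp only [flowL, inv_inv]
  by_cases ha : (a : ℂ) = 0
  · simp only [ha]
    field_simp
    ring
  · field_simp
    ring

/-- The reflection z ↦ −z acts as t ↦ t⁻¹, under which Π is even and L is odd. Thanks to this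
symmetry boundary values need checking on one circle only, and oddness later forces the velocity to
tend to 0 at infinity. -/
theorem flowV_neg (hq : 0 < q) {z : ℂ} (hz : z ∈ bipolarDomain a q) :
    flowV a c r k l A (-z) = -flowV a c r k l A z := by
  have ht0 := ne_zero_of_mem_annulus hq hz
  simp only [flowV, goursat, bipolar_neg, flowPi_inv ht0, flowL_inv ht0, flowG, inv_inv, norm_inv,
    Real.log_inv, map_neg]
  push_cast
  ring

/-- The conjugate of the flow in bipolar coordinates. -/
theorem conj_flowV (ha : a ≠ 0) (hq : 0 < q) {z t : ℂ} (hz : z ∈ bipolarDomain a q)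
    (htz : bipolar a z = t) :
    conj (flowV a c r k l A z) * (conj t - 1) =
      c * (Real.log ‖t‖ * (conj t - 1) - (t - 1) * (t * conj t - 1) / (2 * t)) +
      2 * r * a * (conj t + 1) +
      2 * a * k * (conj t * (A t + conj (A t) - (t - 1) * (t * deriv A t)) +
        (A t⁻¹ + conj (A t⁻¹) + (1 - t⁻¹) * (deriv A t⁻¹ / t))) -
      l * ((t - t⁻¹) * (conj t - 1) / (2 * a)) := by
  have hs := sub_ne_zero_of_mem_bipolarDomain hq hz
  have ht0 : t ≠ 0 := htz ▸ ne_zero_of_mem_annulus hq hz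
  have hac : (a : ℂ) ≠ 0 := ofReal_ne_zero.2 ha
  have ht1 : t - 1 ≠ 0 := htz ▸ bipolar_ne_one ha hs
  have ht1' : conj t - 1 ≠ 0 := by simpa using (map_ne_zero (starRingEnd ℂ)).2 ht1
  -- The factor t̄ − 1 in the statement clears the denominator of z̄ = a(t̄ + 1)/(t̄ − 1).
  have hz' : z = a * (t + 1) / (t - 1) := htz ▸ eq_of_bipolar ha hs
  have hzc : conj z = a * (conj t + 1) / (conj t - 1) := by
    rw [hz']; simp
  simp only [flowV, goursat, flowG, htz, map_add, map_mul, conj_conj, conj_ofReal, map_sub, hzc]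
  simp only [flowPi, flowL]
  field_simp
  ring

end

/-! ### The exterior domain in bipolar coordinates -/

/-- Apollonius: the circle of radius R about R cosh s is the locus where the distances to the foci
∓R sinh s have ratio eˢ. The identity needs only cosh² − sinh² = 1. -/
theorem exp_mul_normSq_sub (R s x y : ℝ) :
    Real.exp (2 * s) * ((x - R * Real.sinh s) ^ 2 + y ^ 2) -
      ((x + R * Real.sinh s) ^ 2 + y ^ 2) =
    (Real.exp (2 * s) - 1) * ((x - R * Real.cosh s) ^ 2 + y ^ 2 - R ^ 2) := by
  have h1 : Real.exp (2 * s) = (Real.cosh s + Real.sinh s) ^ 2 := by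
    rw [Real.cosh_add_sinh, ← Real.exp_nat_mul]; norm_num
  rw [h1]
  have h2 := Real.cosh_sq s
  set C := Real.cosh s
  set S := Real.sinh s
  linear_combination (2 * R * x * (C + S) - R ^ 2 * ((C + S) ^ 2 - 1)) * h2

theorem norm_sq_planeEquiv_sub (x : Plane) (b : ℝ) :
    ‖planeEquiv.symm x - b‖ ^ 2 = (x 0 - b) ^ 2 + x 1 ^ 2 := by
  obtain ⟨z, rfl⟩ := planeEquiv.surjective x
  rw [planeEquiv.symm_apply_apply, planeEquiv_apply_zero, planeEquiv_apply_one, ← normSq_eq_norm_sq,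
    normSq_apply]
  simp
  ring

theorem norm_bipolar_sq (a : ℝ) (z : ℂ) : ‖bipolar a z‖ ^ 2 = ‖z + a‖ ^ 2 / ‖z - a‖ ^ 2 := by
  rw [bipolar, norm_div, div_pow]

/-- Clearing denominators gives conditions that are continuous in z and also settle z = a, where the
quotient is 0 by convention: there the first inequality would bound a square strictly by 0. -/
theorem mem_bipolarDomain_iff {a ρ : ℝ} (hρ : 0 < ρ) (z : ℂ) :
    z ∈ bipolarDomain a ρ ↔
      ‖z + a‖ ^ 2 < ρ ^ 2 * ‖z - a‖ ^ 2 ∧ ‖z - a‖ ^ 2 < ρ ^ 2 * ‖z + a‖ ^ 2 := by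
  have key : ∀ h : z - a ≠ 0, (z ∈ bipolarDomain a ρ ↔
      ‖z + a‖ ^ 2 < ρ ^ 2 * ‖z - a‖ ^ 2 ∧ ‖z - a‖ ^ 2 < ρ ^ 2 * ‖z + a‖ ^ 2) := by
    intro h
    have hp : 0 < ‖z - a‖ ^ 2 := by positivity
    have e1 : ‖bipolar a z‖ < ρ ↔ ‖z + a‖ ^ 2 < ρ ^ 2 * ‖z - a‖ ^ 2 := by
      rw [← pow_lt_pow_iff_left₀ (norm_nonneg _) hρ.le two_ne_zero, norm_bipolar_sq,
        div_lt_iff₀ hp]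
    have e2 : ρ⁻¹ < ‖bipolar a z‖ ↔ ‖z - a‖ ^ 2 < ρ ^ 2 * ‖z + a‖ ^ 2 := by
      rw [← pow_lt_pow_iff_left₀ (inv_pos.2 hρ).le (norm_nonneg _) two_ne_zero, norm_bipolar_sq,
        lt_div_iff₀ hp, inv_pow, inv_mul_lt_iff₀ (by positivity)]
    rw [← e1, ← e2]
    exact and_comm
  constructor
  · intro hz
    exact (key (sub_ne_zero_of_mem_bipolarDomain hρ hz)).1 hz
  · intro hz
    refine (key fun h => ?_).2 hz
    rw [h] at hz
    have := hz.1
    rw [norm_zero] at this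
    nlinarith [sq_nonneg ‖z + a‖]

theorem norm_bipolar_of_mem_closure {a ρ : ℝ} (ha : a ≠ 0) (hρ : 1 < ρ) {z : ℂ}
    (hz : z ∈ closure (bipolarDomain a ρ)) :
    z - a ≠ 0 ∧ ρ⁻¹ ≤ ‖bipolar a z‖ ∧ ‖bipolar a z‖ ≤ ρ := by
  have hρ0 : 0 < ρ := by linarith
  have h1 : ‖z + a‖ ^ 2 ≤ ρ ^ 2 * ‖z - a‖ ^ 2 ∧ ‖z - a‖ ^ 2 ≤ ρ ^ 2 * ‖z + a‖ ^ 2 := by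
    have hcl : IsClosed {z : ℂ | ‖z + a‖ ^ 2 ≤ ρ ^ 2 * ‖z - a‖ ^ 2 ∧
        ‖z - a‖ ^ 2 ≤ ρ ^ 2 * ‖z + a‖ ^ 2} :=
      IsClosed.and (isClosed_le (by fun_prop) (by fun_prop))
        (isClosed_le (by fun_prop) (by fun_prop))
    refine closure_minimal (fun w hw => ?_) hcl hz
    have := (mem_bipolarDomain_iff hρ0 w).1 hw
    exact ⟨this.1.le, this.2.le⟩
  have h0 : z - a ≠ 0 := by
    intro h
    rw [h, norm_zero] at h1
    have h2 : z + a = 0 := by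
      have : ‖z + a‖ ^ 2 ≤ 0 := by simpa using h1.1
      simpa using this
    have h3 : (2 : ℂ) * a = 0 := by linear_combination h2 - h
    exact (mul_ne_zero two_ne_zero (ofReal_ne_zero.2 ha)) h3
  have hp : 0 < ‖z - a‖ ^ 2 := by positivity
  refine ⟨h0, ?_, ?_⟩
  · rw [← pow_le_pow_iff_left₀ (inv_pos.2 hρ0).le (norm_nonneg _) two_ne_zero, norm_bipolar_sq,
      le_div_iff₀ hp, inv_pow, inv_mul_le_iff₀ (by positivity)]
    exact h1.2
  · rw [← pow_le_pow_iff_left₀ (norm_nonneg _) hρ0.le two_ne_zero, norm_bipolar_sq,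
      div_le_iff₀ hp]
    exact h1.1

section

variable {R s a δ : ℝ}

theorem exp_mul_norm_sub_sq (ha : a = R * Real.sinh s) (hδ : δ = 2 * R * (Real.cosh s - 1))
    (x : Plane) :
    Real.exp s ^ 2 * ‖planeEquiv.symm x - a‖ ^ 2 - ‖planeEquiv.symm x + a‖ ^ 2 =
      (Real.exp s ^ 2 - 1) * ((x 0 - R - δ / 2) ^ 2 + x 1 ^ 2 - R ^ 2) := by
  have h := exp_mul_normSq_sub R s (x 0) (x 1)
  have h1 := norm_sq_planeEquiv_sub x a
  have h2 := norm_sq_planeEquiv_sub x (-a)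
  rw [ofReal_neg, sub_neg_eq_add, sub_neg_eq_add] at h2
  have h3 : Real.exp s ^ 2 = Real.exp (2 * s) := by rw [← Real.exp_nat_mul]; norm_num
  rw [h1, h2, ha, h3, h, hδ]
  ring

theorem exp_mul_norm_add_sq (ha : a = R * Real.sinh s) (hδ : δ = 2 * R * (Real.cosh s - 1))
    (x : Plane) :
    Real.exp s ^ 2 * ‖planeEquiv.symm x + a‖ ^ 2 - ‖planeEquiv.symm x - a‖ ^ 2 =
      (Real.exp s ^ 2 - 1) * ((x 0 + R + δ / 2) ^ 2 + x 1 ^ 2 - R ^ 2) := by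
  have h := exp_mul_normSq_sub R s (-x 0) (x 1)
  have h1 := norm_sq_planeEquiv_sub x a
  have h2 := norm_sq_planeEquiv_sub x (-a)
  rw [ofReal_neg, sub_neg_eq_add, sub_neg_eq_add] at h2
  have h3 : Real.exp s ^ 2 = Real.exp (2 * s) := by rw [← Real.exp_nat_mul]; norm_num
  rw [h1, h2, ha, h3, hδ]
  linear_combination h

theorem one_lt_exp_sq (hs : 0 < s) : 0 < Real.exp s ^ 2 - 1 := by
  have := Real.one_lt_exp_iff.2 hs
  nlinarith

theorem mem_exteriorDomain_iff_bipolar (hR : 0 < R) (hs : 0 < s) (ha : a = R * Real.sinh s)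
    (hδ : δ = 2 * R * (Real.cosh s - 1)) (x : Plane) :
    x ∈ exteriorDomain R δ ↔ planeEquiv.symm x ∈ bipolarDomain a (Real.exp s) := by
  rw [mem_exteriorDomain_iff hR, mem_bipolarDomain_iff (Real.exp_pos s)]
  have h1 := exp_mul_norm_sub_sq ha hδ x
  have h2 := exp_mul_norm_add_sq ha hδ x
  have hp := one_lt_exp_sq hs
  constructor
  · rintro ⟨h3, h4⟩
    exact ⟨by nlinarith [mul_pos hp (sub_pos.2 h4)], by nlinarith [mul_pos hp (sub_pos.2 h3)]⟩
  · rintro ⟨h3, h4⟩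
    constructor
    · have h5 : 0 < (Real.exp s ^ 2 - 1) * ((x 0 + R + δ / 2) ^ 2 + x 1 ^ 2 - R ^ 2) := by linarith
      linarith [(pos_iff_pos_of_mul_pos h5).1 hp]
    · have h5 : 0 < (Real.exp s ^ 2 - 1) * ((x 0 - R - δ / 2) ^ 2 + x 1 ^ 2 - R ^ 2) := by linarith
      linarith [(pos_iff_pos_of_mul_pos h5).1 hp]

theorem closure_exteriorDomain_subset (hR : 0 < R) (hs : 0 < s) (ha : a = R * Real.sinh s)
    (hδ : δ = 2 * R * (Real.cosh s - 1)) :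
    closure (exteriorDomain R δ) ⊆ planeEquiv.symm ⁻¹' closure (bipolarDomain a (Real.exp s)) := by
  have : exteriorDomain R δ = planeEquiv.symm ⁻¹' bipolarDomain a (Real.exp s) :=
    Set.ext fun x => mem_exteriorDomain_iff_bipolar hR hs ha hδ x
  rw [this]
  exact planeEquiv.symm.continuous.closure_preimage_subset _

theorem closure_bipolarDomain_subset {ρ q : ℝ} (ha : a ≠ 0) (hρ : 1 < ρ) (hq : ρ < q) :
    closure (bipolarDomain a ρ) ⊆ bipolarDomain a q := fun z hz => by
  obtain ⟨-, h1, h2⟩ := norm_bipolar_of_mem_closure ha hρ hz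
  exact ⟨(inv_strictAnti₀ (by linarith) hq).trans_le h1, h2.trans_lt hq⟩

theorem sphere_subset_planeEquiv {c : Plane} {x : Plane} (hx : x ∈ Metric.sphere c R) :
    (x 0 - c 0) ^ 2 + (x 1 - c 1) ^ 2 = R ^ 2 := by
  rw [mem_sphere_iff_norm, EuclideanSpace.norm_eq, Fin.sum_univ_two] at hx
  rw [← hx, Real.sq_sqrt (by positivity)]
  simp

theorem norm_bipolar_right (hR : 0 < R) (hs : 0 < s) (ha : a = R * Real.sinh s)
    (hδ : δ = 2 * R * (Real.cosh s - 1)) {x : Plane}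
    (hx : x ∈ Metric.sphere (rightCenter R δ) R) :
    ‖bipolar a (planeEquiv.symm x)‖ = Real.exp s := by
  have ha0 : 0 < a := by rw [ha]; exact mul_pos hR (Real.sinh_pos_iff.2 hs)
  have h0 := sphere_subset_planeEquiv hx
  simp only [rightCenter, Matrix.cons_val_zero, Matrix.cons_val_one] at h0
  have h1 := exp_mul_norm_sub_sq ha hδ x
  have h2 : (x 0 - R - δ / 2) ^ 2 + x 1 ^ 2 - R ^ 2 = 0 := by linear_combination h0
  rw [h2, mul_zero, sub_eq_zero] at h1
  have hne : planeEquiv.symm x - a ≠ 0 := by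
    intro h
    rw [h, norm_zero] at h1
    have h3 : planeEquiv.symm x + a = 0 := by
      rw [← norm_eq_zero, ← sq_eq_zero_iff, ← h1]; ring
    have h4 : (2 : ℂ) * a = 0 := by linear_combination h3 - h
    exact (mul_ne_zero two_ne_zero (ofReal_ne_zero.2 ha0.ne')) h4
  rw [← sq_eq_sq₀ (norm_nonneg _) (Real.exp_pos s).le, norm_bipolar_sq, ← h1]
  field_simp

theorem neg_mem_sphere_right {x : Plane} (hx : x ∈ Metric.sphere (leftCenter R δ) R) :
    -x ∈ Metric.sphere (rightCenter R δ) R := by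
  have : rightCenter R δ = -leftCenter R δ := by
    ext i
    fin_cases i <;> simp [rightCenter, leftCenter]
    ring
  rw [mem_sphere_iff_norm, this, sub_neg_eq_add, neg_add_eq_sub, norm_sub_rev]
  exact mem_sphere_iff_norm.1 hx

end

end

section

open Complex ComplexConjugate Topology

/-! ### Power series with geometrically decaying real coefficients -/

/-- The power series with real coefficients `c`. -/
def powerSeries (c : ℕ → ℝ) (t : ℂ) : ℂ := ∑' n, (c n : ℂ) * t ^ n

section

variable {c : ℕ → ℝ} {M q : ℝ} {t : ℂ}

theorem norm_coeff_mul_pow_le (hq : 0 < q) (hc : ∀ n, |c n| * q ^ n ≤ M) (n : ℕ) (r : ℝ)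
    (hr : 0 ≤ r) : |c n| * r ^ n ≤ M * (r / q) ^ n := by
  rw [div_pow, mul_div_assoc', le_div_iff₀ (by positivity)]
  calc |c n| * r ^ n * q ^ n = |c n| * q ^ n * r ^ n := by ring
    _ ≤ M * r ^ n := by gcongr; exact hc n

theorem summable_mul_coeff (hq : 0 < q) (hc : ∀ n, |c n| * q ^ n ≤ M) {r : ℝ} (hr : 0 ≤ r)
    (hrq : r < q) : Summable fun n : ℕ => (n : ℝ) * (|c n| * r ^ n) := by
  have h1 : ‖r / q‖ < 1 := by
    rw [Real.norm_eq_abs, abs_of_nonneg (by positivity)]; exact (div_lt_one hq).2 hrq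
  have h2 := (summable_pow_mul_geometric_of_norm_lt_one 1 h1).mul_left M
  refine Summable.of_nonneg_of_le (fun n => by positivity) (fun n => ?_) h2
  calc (n : ℝ) * (|c n| * r ^ n) ≤ n * (M * (r / q) ^ n) :=
        mul_le_mul_of_nonneg_left (norm_coeff_mul_pow_le hq hc n r hr) (Nat.cast_nonneg n)
    _ = M * ((n : ℝ) ^ 1 * (r / q) ^ n) := by ring

theorem hasSum_powerSeries (hq : 0 < q) (hc : ∀ n, |c n| * q ^ n ≤ M) (ht : ‖t‖ < q) :
    HasSum (fun n => (c n : ℂ) * t ^ n) (powerSeries c t) := by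
  refine Summable.hasSum (Summable.of_norm ?_)
  have h1 : ‖t‖ / q < 1 := (div_lt_one hq).2 ht
  refine Summable.of_nonneg_of_le (fun n => norm_nonneg _) (fun n => ?_)
    ((summable_geometric_of_lt_one (by positivity) h1).mul_left M)
  rw [norm_mul, norm_pow, norm_real, Real.norm_eq_abs]
  exact norm_coeff_mul_pow_le hq hc n _ (norm_nonneg _)

theorem hasDerivAt_powerSeries (hq : 0 < q) (hc : ∀ n, |c n| * q ^ n ≤ M) (ht : ‖t‖ < q) :
    HasDerivAt (powerSeries c) (∑' n : ℕ, (c n : ℂ) * (n * t ^ (n - 1))) t := by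
  obtain ⟨r, hr1, hr2⟩ := exists_between ht
  have hr0 : 0 < r := (norm_nonneg t).trans_lt hr1
  have hu : Summable fun n : ℕ => (n : ℝ) * (|c n| * r ^ n) / r :=
    (summable_mul_coeff hq hc hr0.le hr2).div_const r
  have ht' : t ∈ Metric.ball (0 : ℂ) r := by simpa using hr1
  refine hasDerivAt_tsum_of_isPreconnected hu Metric.isOpen_ball
    (convex_ball (0 : ℂ) r).isPreconnected (g := fun n t => (c n : ℂ) * t ^ n)
    (fun n y _ => (hasDerivAt_pow n y).const_mul (c n : ℂ)) (fun n y hy => ?_)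
    (Metric.mem_ball_self hr0) ?_ ht'
  · have hy' : ‖y‖ < r := by simpa using hy
    rw [norm_mul, norm_mul, norm_pow, norm_real, Real.norm_eq_abs, norm_natCast]
    rcases n with _ | n
    · simp
    · rw [pow_succ, Nat.add_sub_cancel]
      have : ‖y‖ ^ n ≤ r ^ n := by gcongr
      calc |c (n + 1)| * (((n + 1 : ℕ) : ℝ) * ‖y‖ ^ n)
          ≤ |c (n + 1)| * (((n + 1 : ℕ) : ℝ) * r ^ n) := by gcongr
        _ = _ := by field_simp
  · exact (hasSum_powerSeries hq hc (by simpa using hq)).summable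

theorem hasSum_mul_deriv_powerSeries (hq : 0 < q) (hc : ∀ n, |c n| * q ^ n ≤ M) (ht : ‖t‖ < q) :
    HasSum (fun n : ℕ => (n : ℂ) * ((c n : ℂ) * t ^ n)) (t * deriv (powerSeries c) t) := by
  have hs : Summable fun n : ℕ => (n : ℂ) * ((c n : ℂ) * t ^ n) := by
    refine Summable.of_norm ((summable_mul_coeff hq hc (norm_nonneg t) ht).congr fun n => ?_)
    simp
  rw [(hasDerivAt_powerSeries hq hc ht).deriv, ← tsum_mul_left]
  have h : ∀ n : ℕ, t * ((c n : ℂ) * (n * t ^ (n - 1))) = (n : ℂ) * ((c n : ℂ) * t ^ n) := by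
    intro n
    rcases n with _ | n
    · simp
    · rw [Nat.add_sub_cancel, pow_succ]; ring
  rw [tsum_congr h]
  exact hs.hasSum

theorem conj_powerSeries (c : ℕ → ℝ) (t : ℂ) : conj (powerSeries c t) = powerSeries c (conj t) := by
  rw [powerSeries, powerSeries, conj_tsum]
  simp

end

/-- The Laurent series `Σ aₙ tⁿ + Σ bₙ t⁻ⁿ`. -/
def laurent (α β : ℕ → ℝ) (t : ℂ) : ℂ := powerSeries α t + powerSeries β t⁻¹

section

variable {α β : ℕ → ℝ} {M N q : ℝ} {t : ℂ}

theorem norm_inv_lt_of_mem_annulus (hq : 0 < q) (ht : t ∈ annulus q) : ‖t⁻¹‖ < q :=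
  (inv_mem_annulus hq ht).2

theorem hasDerivAt_laurent (hq : 0 < q) (hα : ∀ n, |α n| * q ^ n ≤ M)
    (hβ : ∀ n, |β n| * q ^ n ≤ N) (ht : t ∈ annulus q) :
    HasDerivAt (laurent α β) (deriv (powerSeries α) t - deriv (powerSeries β) t⁻¹ / t ^ 2) t := by
  have h1 := hasDerivAt_powerSeries hq hα ht.2
  have h2 := hasDerivAt_powerSeries hq hβ (norm_inv_lt_of_mem_annulus hq ht)
  have h3 := h1.add (h2.comp t (hasDerivAt_inv (ne_zero_of_mem_annulus hq ht)))
  rw [h1.deriv, h2.deriv]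
  refine h3.congr_deriv ?_
  ring

theorem differentiableOn_laurent (hq : 0 < q) (hα : ∀ n, |α n| * q ^ n ≤ M)
    (hβ : ∀ n, |β n| * q ^ n ≤ N) : DifferentiableOn ℂ (laurent α β) (annulus q) := fun _ ht =>
  (hasDerivAt_laurent hq hα hβ ht).differentiableAt.differentiableWithinAt

/-- Telescoping starts at index 2 because the modes 0 and 1 are exceptional: the general coefficient
formulas have denominators n(n + 1) and n(n − 1). -/
theorem eq_of_telescoping {f c : ℕ → ℂ} {L : ℂ} (hf : HasSum f L)
    (h : ∀ n, f (n + 2) = c (n + 2) - c (n + 1)) (hc : Tendsto c atTop (𝓝 0)) :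
    L = f 0 + f 1 - c 1 := by
  have h1 : ∀ n, ∑ i ∈ Finset.range (n + 2), f i = f 0 + f 1 - c 1 + c (n + 1) := by
    intro n
    induction n with
    | zero => simp [Finset.sum_range_succ]
    | succ n ih => rw [Finset.sum_range_succ, ih, h n]; ring
  have h2 := (tendsto_add_atTop_iff_nat 2).2 hf.tendsto_sum_nat
  have h3 : Tendsto (fun n => f 0 + f 1 - c 1 + c (n + 1)) atTop (𝓝 (f 0 + f 1 - c 1 + 0)) :=
    tendsto_const_nhds.add ((tendsto_add_atTop_iff_nat 1).2 hc)
  rw [add_zero] at h3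
  exact tendsto_nhds_unique h2 (h3.congr fun n => (h1 n).symm)

end

/-! ### The coefficients of the clamped flow -/

/-- The denominator `sinh 2ns + n sinh 2s`, with `q = exp 2s`. -/
def den (q : ℝ) (n : ℕ) : ℝ := (q ^ n - (q ^ n)⁻¹ + n * (q - q⁻¹)) / 2

/-- The numerator of `coeffA`. -/
def numA (q : ℝ) (n : ℕ) : ℝ := n * (1 - q⁻¹) + 1 - (q ^ n)⁻¹

/-- The numerator of `coeffB`. -/
def numB (q : ℝ) (n : ℕ) : ℝ := n * (q - 1) + 1 - (q ^ n)⁻¹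

/-- The coefficients of the positive powers. -/
def coeffA (s q : ℝ) (n : ℕ) : ℝ :=
  if n = 0 then -1 + ((q - 1) ^ 2 - 4 * q * s ^ 2) / (q ^ 2 - 1 + 4 * q * s)
  else numA q n / (n * (n + 1) * den q n)

/-- The coefficients of the negative powers. -/
def coeffB (s q : ℝ) (n : ℕ) : ℝ :=
  if n = 0 then 0 else if n = 1 then 1 + s - (q - 1) / (2 * (q + 1))
  else -(numB q n / (n * (n - 1) * den q n))

/-- The coefficient of the term `x log|t|`. -/
def coeffX (s q : ℝ) : ℝ := -((q - 1) ^ 2 / (q ^ 2 - 1 + 4 * q * s))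

section

variable {s q : ℝ}

theorem inv_pow_le_one_of_one_lt (hq : 1 < q) (n : ℕ) : (q ^ n)⁻¹ ≤ 1 :=
  inv_le_one_of_one_le₀ (one_le_pow₀ hq.le)

theorem sub_inv_pos (hq : 1 < q) : 0 < q - q⁻¹ := by
  have := inv_lt_one_of_one_lt₀ hq
  linarith

theorem sub_inv_pow_le (hq : 1 < q) {n : ℕ} (hn : n ≠ 0) :
    q ^ n * (1 - q⁻¹) ≤ q ^ n - (q ^ n)⁻¹ := by
  obtain ⟨m, rfl⟩ := Nat.exists_eq_succ_of_ne_zero hn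
  have h1 : q ^ (m + 1) * (1 - q⁻¹) = q ^ (m + 1) - q ^ m := by
    have : q ≠ 0 := by positivity
    field_simp
    ring
  rw [Nat.succ_eq_add_one, h1]
  have := inv_pow_le_one_of_one_lt hq (m + 1)
  have := one_le_pow₀ (n := m) hq.le
  linarith

theorem den_pos (hq : 1 < q) {n : ℕ} (hn : n ≠ 0) : 0 < den q n := by
  have h1 := sub_inv_pow_le hq hn
  have h2 : 0 < q ^ n * (1 - q⁻¹) := mul_pos (by positivity) (by
    have := inv_lt_one_of_one_lt₀ hq; linarith)
  have h3 : 0 ≤ (n : ℝ) * (q - q⁻¹) := mul_nonneg (Nat.cast_nonneg n) (sub_inv_pos hq).le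
  unfold den
  linarith

theorem pow_mul_le_den (hq : 1 < q) {n : ℕ} (hn : n ≠ 0) :
    q ^ n * ((1 - q⁻¹) / 2) ≤ den q n := by
  have h1 := sub_inv_pow_le hq hn
  have h3 : 0 ≤ (n : ℝ) * (q - q⁻¹) := mul_nonneg (Nat.cast_nonneg n) (sub_inv_pos hq).le
  unfold den
  linarith

theorem numA_bounds (hq : 1 < q) (n : ℕ) : 0 ≤ numA q n ∧ numA q n ≤ n + 1 := by
  have h1 := inv_pow_le_one_of_one_lt hq n
  have h2 : 0 < q⁻¹ := by positivity
  have h3 : 0 < (q ^ n)⁻¹ := by positivity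
  have h4 := inv_lt_one_of_one_lt₀ hq
  have h5 : (0 : ℝ) ≤ n := Nat.cast_nonneg n
  unfold numA
  constructor <;> nlinarith

theorem numB_bounds (hq : 1 < q) (n : ℕ) : 0 ≤ numB q n ∧ numB q n ≤ (n + 1) * q := by
  have h1 := inv_pow_le_one_of_one_lt hq n
  have h3 : 0 < (q ^ n)⁻¹ := by positivity
  have h5 : (0 : ℝ) ≤ n := Nat.cast_nonneg n
  unfold numB
  constructor <;> nlinarith

theorem exists_coeffA_bound (s : ℝ) (hq : 1 < q) : ∃ M, ∀ n, |coeffA s q n| * q ^ n ≤ M := by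
  have hq' : 0 < (1 - q⁻¹) / 2 := by
    have := inv_lt_one_of_one_lt₀ hq; linarith
  refine ⟨|coeffA s q 0| + ((1 - q⁻¹) / 2)⁻¹, fun n => ?_⟩
  have hp : 0 < ((1 - q⁻¹) / 2)⁻¹ := by positivity
  rcases Nat.eq_zero_or_pos n with rfl | hn
  · rw [pow_zero, mul_one]; linarith
  · have hn0 : n ≠ 0 := hn.ne'
    have h1 := den_pos hq hn0
    have h2 := pow_mul_le_den hq hn0
    obtain ⟨h3, h4⟩ := numA_bounds hq n
    have h5 : (1 : ℝ) ≤ n := by exact_mod_cast hn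
    have h6 : |coeffA s q n| * q ^ n ≤ ((1 - q⁻¹) / 2)⁻¹ := by
      rw [coeffA, if_neg hn0, abs_of_nonneg (by positivity), div_mul_eq_mul_div,
        div_le_iff₀ (by positivity), inv_mul_eq_div, le_div_iff₀ hq']
      calc numA q n * q ^ n * ((1 - q⁻¹) / 2) = numA q n * (q ^ n * ((1 - q⁻¹) / 2)) := by ring
        _ ≤ (n + 1) * den q n := by gcongr
        _ ≤ n * (n + 1) * den q n := by
          have : 0 ≤ ((n : ℝ) + 1) * den q n := by positivity
          nlinarith
    have := abs_nonneg (coeffA s q 0)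
    linarith

theorem exists_coeffB_bound (s : ℝ) (hq : 1 < q) : ∃ M, ∀ n, |coeffB s q n| * q ^ n ≤ M := by
  have hq' : 0 < (1 - q⁻¹) / 2 := by
    have := inv_lt_one_of_one_lt₀ hq; linarith
  refine ⟨|coeffB s q 1| * q + 2 * q * ((1 - q⁻¹) / 2)⁻¹, fun n => ?_⟩
  have hp : 0 < 2 * q * ((1 - q⁻¹) / 2)⁻¹ := by positivity
  have hp' : 0 ≤ |coeffB s q 1| * q := by positivity
  rcases lt_trichotomy n 1 with hn | rfl | hn
  · have : n = 0 := by omega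
    subst this
    have : coeffB s q 0 = 0 := by simp [coeffB]
    rw [this, abs_zero, zero_mul]; linarith
  · rw [pow_one]; linarith
  · have hn0 : n ≠ 0 := by omega
    have hn1 : n ≠ 1 := by omega
    have h1 := den_pos hq hn0
    have h2 := pow_mul_le_den hq hn0
    obtain ⟨h3, h4⟩ := numB_bounds hq n
    have h5 : (2 : ℝ) ≤ n := by exact_mod_cast hn
    have h7 : (0 : ℝ) < n - 1 := by linarith
    have h6 : |coeffB s q n| * q ^ n ≤ 2 * q * ((1 - q⁻¹) / 2)⁻¹ := by
      rw [coeffB, if_neg hn0, if_neg hn1, abs_neg, abs_of_nonneg (by positivity),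
        div_mul_eq_mul_div, div_le_iff₀ (by positivity), ← div_eq_mul_inv, div_mul_eq_mul_div,
        le_div_iff₀ hq']
      calc numB q n * q ^ n * ((1 - q⁻¹) / 2) = numB q n * (q ^ n * ((1 - q⁻¹) / 2)) := by ring
        _ ≤ (n + 1) * q * den q n := by gcongr
        _ ≤ 2 * q * (n * (n - 1) * den q n) := by
          have h8 : 0 ≤ q * den q n := by positivity
          nlinarith [mul_nonneg h8 (by nlinarith : (0 : ℝ) ≤ 2 * (n * (n - 1)) - (n + 1))]
    linarith

/-! The recurrences behind the boundary condition. -/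

/-- The boundary condition couples neighbouring modes. Prescribing the right-hand sides as cₙ and
−cₙ₋₁ with cₙ = 2q⁻ⁿ/(n(n + 1)) decouples it: these terms cancel between consecutive modes. What is
left for each n is a 2×2 system for the two coefficients, with determinant −2q · q⁻ⁿ · `den q n`. -/
theorem coeff_recurrence_pos (hq : 1 < q) (n : ℕ) (hn : 2 ≤ n) :
    coeffA s q n * ((q ^ n)⁻¹ - n * q) + (1 - n) * coeffB s q n =
      2 * (q ^ n)⁻¹ / (n * (n + 1)) ∧
    q * (n + 1) * coeffA s q n + (q * (q ^ n)⁻¹ + n) * coeffB s q n =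
      -(2 * q * (q ^ n)⁻¹ / (n * (n - 1))) := by
  have hn0 : n ≠ 0 := by omega
  have hn1 : n ≠ 1 := by omega
  have h1 := (den_pos hq hn0).ne'
  have h5 : (2 : ℝ) ≤ n := by exact_mod_cast hn
  have h7 : (n : ℝ) - 1 ≠ 0 := by linarith
  have h8 : (n : ℝ) ≠ 0 := by linarith
  have h9 : (n : ℝ) + 1 ≠ 0 := by linarith
  have hq0 : q ≠ 0 := by linarith
  simp only [coeffA, coeffB, if_neg hn0, if_neg hn1, numA, numB]
  unfold den at h1 ⊢
  have hQ : q ^ n ≠ 0 := pow_ne_zero n hq0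
  set Q := q ^ n
  set ν := (n : ℝ)
  have h2 : q * (Q ^ 2 - 1) + ν * Q * (q ^ 2 - 1) ≠ 0 := by
    intro h
    apply h1
    field_simp
    linear_combination h
  have h3 : (Q - Q⁻¹ + ν * (q - q⁻¹)) / 2 = (q * (Q ^ 2 - 1) + ν * Q * (q ^ 2 - 1)) / (2 * q * Q) := by
    field_simp
  rw [h3]
  constructor
  · field_simp
    ring
  · field_simp
    ring

/-- The same coefficients also solve the system coming from the negative powers, now with right-hand
sides −cₙ₋₁ and cₙ for cₙ = 2((n + 1)q − n)/(n(n + 1)). This compatibility of four equations for two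
unknowns is what makes the construction work. -/
theorem coeff_recurrence_neg (hq : 1 < q) (n : ℕ) (hn : 2 ≤ n) :
    coeffB s q n * (q * n + q ^ n) + (1 + n) * coeffA s q n =
      -(2 * (n * q - (n - 1)) / (n * (n - 1))) ∧
    (q * q ^ n - n) * coeffA s q n + q * (1 - n) * coeffB s q n =
      2 * ((n + 1) * q - n) / (n * (n + 1)) := by
  have hn0 : n ≠ 0 := by omega
  have hn1 : n ≠ 1 := by omega
  have h1 := (den_pos hq hn0).ne'
  have h5 : (2 : ℝ) ≤ n := by exact_mod_cast hn
  have h7 : (n : ℝ) - 1 ≠ 0 := by linarith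
  have h8 : (n : ℝ) ≠ 0 := by linarith
  have h9 : (n : ℝ) + 1 ≠ 0 := by linarith
  have hq0 : q ≠ 0 := by linarith
  simp only [coeffA, coeffB, if_neg hn0, if_neg hn1, numA, numB]
  unfold den at h1 ⊢
  have hQ : q ^ n ≠ 0 := pow_ne_zero n hq0
  set Q := q ^ n
  set ν := (n : ℝ)
  have h2 : q * (Q ^ 2 - 1) + ν * Q * (q ^ 2 - 1) ≠ 0 := by
    intro h
    apply h1
    field_simp
    linear_combination h
  have h3 : (Q - Q⁻¹ + ν * (q - q⁻¹)) / 2 = (q * (Q ^ 2 - 1) + ν * Q * (q ^ 2 - 1)) / (2 * q * Q) := by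
    field_simp
  rw [h3]
  obtain ⟨E, hE⟩ : ∃ E, E = q * (Q ^ 2 - 1) + ν * Q * (q ^ 2 - 1) := ⟨_, rfl⟩
  rw [← hE] at h2 ⊢
  constructor
  · field_simp
    rw [hE]
    ring
  · field_simp
    rw [hE]
    ring

end

end

section

open Complex ComplexConjugate Topology

/-! ### The boundary values -/

section

variable {a c c' r r' k l s q K : ℝ} {t z : ℂ} {A : ℂ → ℂ}

theorem flowPi_add_smul (t : ℂ) :
    flowPi a (c + K * c') (r + K * r') (K * k) A t =
      flowPi a c r 0 A t + K * flowPi a c' r' k A t := by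
  simp only [flowPi]
  push_cast
  ring

theorem flowV_add_smul (z : ℂ) :
    flowV a (c + K * c') (r + K * r') (K * k) (K * l) A z =
      flowV a c r 0 0 A z + K * flowV a c' r' k l A z := by
  simp only [flowV, goursat, flowPi_add_smul, flowG, flowL]
  push_cast
  simp only [map_add, map_sub, map_mul, conj_ofReal, map_div₀, map_neg, map_zero]
  ring

/-- The Laurent series of the clamped flow. -/
def clampedSeries (s q : ℝ) : ℂ → ℂ := laurent (coeffA s q) (coeffB s q)

theorem differentiableOn_clampedSeries (s : ℝ) (hq : 1 < q) :
    DifferentiableOn ℂ (clampedSeries s q) (annulus q) := by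
  obtain ⟨M, hM⟩ := exists_coeffA_bound s hq
  obtain ⟨N, hN⟩ := exists_coeffB_bound s hq
  exact differentiableOn_laurent (by linarith) hM hN

theorem tendsto_telescope_pos (hq : 1 < q) {x : ℂ} (hx : ‖x‖ < q) :
    Tendsto (fun n : ℕ => 2 * ((q : ℂ) ^ n)⁻¹ / (n * (n + 1)) * x ^ n) atTop (𝓝 0) := by
  have h1 : ‖x‖ / q < 1 := (div_lt_one (by linarith)).2 hx
  have h2 := (tendsto_pow_atTop_nhds_zero_of_lt_one (by positivity) h1).const_mul 2
  rw [mul_zero] at h2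
  refine squeeze_zero_norm (fun n => ?_) h2
  have h3 : ‖2 * ((q : ℂ) ^ n)⁻¹ / (n * (n + 1)) * x ^ n‖ =
      2 * (‖x‖ / q) ^ n / (n * (n + 1)) := by
    have h4 : ‖(n : ℂ) + 1‖ = n + 1 := by
      rw [← Nat.cast_succ, norm_natCast]; push_cast; rfl
    simp only [norm_mul, norm_div, norm_inv, norm_pow, norm_real, norm_natCast, h4,
      Real.norm_eq_abs, abs_of_pos (by linarith : 0 < q), norm_ofNat, div_pow]
    field_simp
  rw [h3]
  rcases Nat.eq_zero_or_pos n with rfl | hn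
  · simp
  · have : (1 : ℝ) ≤ n := by exact_mod_cast hn
    exact div_le_self (by positivity) (by nlinarith)

theorem tendsto_telescope_neg (hq : 1 < q) {x : ℂ} (hx : ‖x‖ < 1) :
    Tendsto (fun n : ℕ => 2 * (((n : ℂ) + 1) * q - n) / (n * (n + 1)) * x ^ (n + 1))
      atTop (𝓝 0) := by
  have h2 := (tendsto_add_atTop_iff_nat 1).2
    ((tendsto_pow_atTop_nhds_zero_of_lt_one (norm_nonneg x) hx).const_mul (2 * q))
  rw [mul_zero] at h2
  refine squeeze_zero_norm (fun n => ?_) h2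
  rw [norm_mul, norm_pow]
  refine mul_le_mul_of_nonneg_right ?_ (by positivity)
  have h3 : 2 * (((n : ℂ) + 1) * q - n) / (n * (n + 1)) =
      ((2 * ((n + 1) * q - n) / (n * (n + 1)) : ℝ) : ℂ) := by
    push_cast; rfl
  rw [h3, norm_real, Real.norm_eq_abs]
  rcases Nat.eq_zero_or_pos n with rfl | hn
  · simp; linarith
  · have h4 : (1 : ℝ) ≤ n := by exact_mod_cast hn
    have h5 : 0 ≤ (n + 1) * q - n := by nlinarith
    rw [abs_of_nonneg (by positivity), div_le_iff₀ (by positivity)]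
    nlinarith [mul_nonneg (by linarith : (0 : ℝ) ≤ n - 1) (by positivity : 0 ≤ (n + 1) * q)]

/-- On this circle t̄ = q/t, so the conjugated series are again power series in t or t⁻¹ and the
whole expression becomes a Laurent series in t. Its nonnegative and negative halves telescope
separately by the recurrences, and only finitely many terms survive. Among the free coefficients
only the sum of the zeroth `coeffA` and the first `coeffB` enters; splitting it differently changes
the stream function by a constant. -/
theorem clampedSeries_boundary (hq : 1 < q) (ht : ‖t‖ ^ 2 = q) :
    conj t * (clampedSeries s q t + conj (clampedSeries s q t) -
        (t - 1) * (t * deriv (clampedSeries s q) t)) +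
      (clampedSeries s q t⁻¹ + conj (clampedSeries s q t⁻¹) +
        (1 - t⁻¹) * (deriv (clampedSeries s q) t⁻¹ / t)) =
    2 * coeffA s q 0 * (1 + q * t⁻¹) - t + 2 * q / (q + 1) + 2 * coeffB s q 1 +
      t⁻¹ * (2 * q * coeffB s q 1 + 2 / (q + 1)) - q * t⁻¹ ^ 2 := by
  obtain ⟨M, hM⟩ := exists_coeffA_bound s hq
  obtain ⟨N, hN⟩ := exists_coeffB_bound s hq
  have hq0 : 0 < q := by linarith
  have hqc : (q : ℂ) ≠ 0 := ofReal_ne_zero.2 hq0.ne'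
  have hpos : 0 < ‖t‖ := by
    rcases (norm_nonneg t).eq_or_lt with h | h
    · rw [← h] at ht; norm_num at ht; linarith
    · exact h
  have ht0 : t ≠ 0 := norm_pos_iff.1 hpos
  have ht1 : 1 < ‖t‖ := by nlinarith
  have htq : ‖t‖ < q := by nlinarith
  have hyt : ‖t⁻¹‖ < 1 := by rw [norm_inv]; exact inv_lt_one_of_one_lt₀ ht1
  have hyq : ‖t⁻¹‖ < q := by linarith
  have htc : conj t = q * t⁻¹ := by
    have h1 : t * conj t = q := by rw [mul_conj, normSq_eq_norm_sq, ht]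
    field_simp
    linear_combination h1
  have hyc : conj t⁻¹ = t / q := by
    rw [map_inv₀, htc]; field_simp
  have hqy : ‖q * t⁻¹‖ < q := by rw [← htc, RCLike.norm_conj]; exact htq
  have htdq : ‖t / q‖ < q := by rw [← hyc, RCLike.norm_conj]; exact hyq
  have hta : t ∈ annulus q := by
    refine ⟨?_, htq⟩
    exact (inv_lt_one_of_one_lt₀ hq).trans ht1
  have hya := inv_mem_annulus hq0 hta
  set y := t⁻¹ with hy
  have hyi : y⁻¹ = t := inv_inv t
  have e1 : clampedSeries s q t = powerSeries (coeffA s q) t + powerSeries (coeffB s q) y := rfl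
  have e2 : clampedSeries s q y = powerSeries (coeffA s q) y + powerSeries (coeffB s q) t := by
    rw [clampedSeries, laurent, hyi]
  have e3 : conj (clampedSeries s q t) =
      powerSeries (coeffA s q) (q * y) + powerSeries (coeffB s q) (t / q) := by
    rw [e1, map_add, conj_powerSeries, conj_powerSeries, htc, hyc]
  have e4 : conj (clampedSeries s q y) =
      powerSeries (coeffA s q) (t / q) + powerSeries (coeffB s q) (q * y) := by
    rw [e2, map_add, conj_powerSeries, conj_powerSeries, htc, hyc]
  have e5 : t * deriv (clampedSeries s q) t =
      t * deriv (powerSeries (coeffA s q)) t - y * deriv (powerSeries (coeffB s q)) y := by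
    rw [clampedSeries, (hasDerivAt_laurent hq0 hM hN hta).deriv, hy]
    field_simp
  have e6 : deriv (clampedSeries s q) y / t =
      y * deriv (powerSeries (coeffA s q)) y - t * deriv (powerSeries (coeffB s q)) t := by
    rw [clampedSeries, (hasDerivAt_laurent hq0 hM hN hya).deriv, hyi, hy]
    field_simp
  have at1 := hasSum_powerSeries hq0 hM htq
  have ay := hasSum_powerSeries hq0 hM hyq
  have aqy := hasSum_powerSeries hq0 hM hqy
  have atq := hasSum_powerSeries hq0 hM htdq
  have bt1 := hasSum_powerSeries hq0 hN htq
  have bby := hasSum_powerSeries hq0 hN hyq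
  have bqy := hasSum_powerSeries hq0 hN hqy
  have btq := hasSum_powerSeries hq0 hN htdq
  have dat := hasSum_mul_deriv_powerSeries hq0 hM htq
  have day := hasSum_mul_deriv_powerSeries hq0 hM hyq
  have dbt := hasSum_mul_deriv_powerSeries hq0 hN htq
  have dby := hasSum_mul_deriv_powerSeries hq0 hN hyq
  -- `hI` gathers the series in powers of t and `hII` those in powers of y = t⁻¹. The factors y, and
  -- q y = t̄, shift a mode by one, which is the source of the two-term coupling.
  have hI := (((((at1.mul_left (q * y)).add (btq.mul_left (q * y))).add
    (dat.mul_left (q * y - q))).add bt1).add atq).add (dbt.mul_left (y - 1))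
  have hII := (((((bby.mul_left (q * y)).add (aqy.mul_left (q * y))).add
    (dby.mul_left (q - q * y))).add ay).add bqy).add (day.mul_left (1 - y))
  have hty : y * t = 1 := inv_mul_cancel₀ ht0
  have hI' := eq_of_telescoping hI (c := fun n : ℕ => 2 * ((q : ℂ) ^ n)⁻¹ / (n * (n + 1)) * t ^ n) (h := ?tel1)
    (hc := tendsto_telescope_pos hq htq)
  case tel1 =>
    intro n
    obtain ⟨r1, r2⟩ := coeff_recurrence_pos (s := s) hq (n + 2) (by omega)
    have r1' := congrArg (fun x : ℝ => (x : ℂ)) r1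
    have r2' := congrArg (fun x : ℝ => (x : ℂ)) r2
    push_cast at r1' r2' ⊢
    have h3 : 2 * ((q : ℂ) ^ (n + 1))⁻¹ / ((n + 1) * (n + 1 + 1)) * t ^ (n + 1) =
        y * t ^ (n + 2) *
          (2 * (q * ((q : ℂ) ^ (n + 2))⁻¹) / ((n + 2) * (n + 2 - 1))) := by
      have h5 : (n : ℂ) + 1 ≠ 0 := by exact_mod_cast Nat.succ_ne_zero n
      have h6 : (n : ℂ) + 2 ≠ 0 := by exact_mod_cast Nat.succ_ne_zero (n + 1)
      have h7 : ((n : ℂ) + 2 - 1) = n + 1 := by ring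
      have h8 : ((n : ℂ) + 1 + 1) = n + 2 := by ring
      have h9 : y * t ^ (n + 2) = t ^ (n + 1) := by
        rw [pow_succ t (n + 1)]; linear_combination t ^ (n + 1) * hty
      rw [h9, h7, h8]
      field_simp
      ring
    rw [h3, div_pow, div_eq_mul_inv (t ^ (n + 2))]
    linear_combination t ^ (n + 2) * r1' + y * t ^ (n + 2) * r2'
  have hII' := eq_of_telescoping hII (c := fun n : ℕ => 2 * (((n : ℂ) + 1) * q - n) / (n * (n + 1)) * y ^ (n + 1)) (h := ?tel2)
    (hc := tendsto_telescope_neg hq hyt)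
  case tel2 =>
    intro n
    obtain ⟨r1, r2⟩ := coeff_recurrence_neg (s := s) hq (n + 2) (by omega)
    have r1' := congrArg (fun x : ℝ => (x : ℂ)) r1
    have r2' := congrArg (fun x : ℝ => (x : ℂ)) r2
    push_cast at r1' r2' ⊢
    rw [mul_pow]
    have h8 : ((n : ℂ) + 1 + 1) = n + 2 := by ring
    have h7 : ((n : ℂ) + 2 - 1) = n + 1 := by ring
    rw [h7] at r1'
    rw [h8]
    linear_combination y ^ (n + 2) * r1' + y ^ (n + 3) * r2'
  have b0 : coeffB s q 0 = 0 := by simp [coeffB]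
  have a1 : coeffA s q 1 = 1 / (q + 1) := by
    have h1 : q - 1 ≠ 0 := by linarith
    have h2 : q + 1 ≠ 0 := by linarith
    have h3 : q ^ 2 - 1 ≠ 0 := by nlinarith
    have h4 : den q 1 = (q ^ 2 - 1) / q := by simp only [den]; field_simp; push_cast; ring
    rw [coeffA, if_neg one_ne_zero, h4, numA]
    field_simp
    push_cast
    ring
  have a1' := congrArg (fun x : ℝ => (x : ℂ)) a1
  push_cast at a1'
  simp only [b0, a1', pow_zero, pow_one, Nat.cast_zero, Nat.cast_one, ofReal_zero] at hI' hII'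
  rw [htc, e3, e4, e5, e6, e1, e2]
  have hq1 : (q : ℂ) + 1 ≠ 0 := by exact_mod_cast (by linarith : q + 1 ≠ 0)
  have key : (q * y * powerSeries (coeffA s q) t + q * y * powerSeries (coeffB s q) (t / q) +
      (q * y - q) * (t * deriv (powerSeries (coeffA s q)) t) + powerSeries (coeffB s q) t +
      powerSeries (coeffA s q) (t / q) + (y - 1) * (t * deriv (powerSeries (coeffB s q)) t)) +
      (q * y * powerSeries (coeffB s q) y + q * y * powerSeries (coeffA s q) (q * y) +
      (q - q * y) * (y * deriv (powerSeries (coeffB s q)) y) + powerSeries (coeffA s q) y +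
      powerSeries (coeffB s q) (q * y) + (1 - y) * (y * deriv (powerSeries (coeffA s q)) y)) =
      2 * coeffA s q 0 * (1 + q * y) - t + 2 * q / (q + 1) + 2 * coeffB s q 1 +
      y * (2 * q * coeffB s q 1 + 2 / (q + 1)) - q * y ^ 2 := by
    rw [hI', hII', hy]
    push_cast
    field_simp
    ring
  linear_combination key - q * (t * deriv (powerSeries (coeffA s q)) t -
    y * deriv (powerSeries (coeffB s q)) y) * hty
theorem conj_sub_one_ne_zero (ha : a ≠ 0) (hq : 0 < q) (hz : z ∈ bipolarDomain a q) :
    conj (bipolar a z) - 1 ≠ 0 := by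
  have := sub_ne_zero.2 (bipolar_ne_one ha (sub_ne_zero_of_mem_bipolarDomain hq hz))
  simpa using (map_ne_zero (starRingEnd ℂ)).2 this

/-- The clamped flow vanishes on the circle `|t|² = q`. -/
theorem flowV_clamped_eq_zero (ha : a ≠ 0) (hs : 0 < s) (hqs : q = Real.exp (2 * s))
    (hz : z ∈ bipolarDomain a q) (htz : ‖bipolar a z‖ = Real.exp s) :
    flowV a (coeffX s q / a) 0 (1 / (4 * a ^ 2)) 1 (clampedSeries s q) z = 0 := by
  have hq : 1 < q := by rw [hqs]; exact Real.one_lt_exp_iff.2 (by linarith)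
  have hq0 : 0 < q := by linarith
  have h1 : ‖bipolar a z‖ ^ 2 = q := by
    rw [htz, hqs, ← Real.exp_nat_mul]; norm_num
  have h2 := conj_flowV (c := coeffX s q / a) (r := 0) (k := 1 / (4 * a ^ 2)) (l := 1)
    (A := clampedSeries s q) ha hq0 hz rfl
  have h3 := clampedSeries_boundary (s := s) hq h1
  rw [htz, Real.log_exp] at h2
  set t := bipolar a z
  have ht0 : t ≠ 0 := ne_zero_of_mem_annulus hq0 hz
  have hE : q ^ 2 - 1 + 4 * q * s ≠ 0 := by
    have : 0 < q * s := by positivity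
    nlinarith
  have hEc : (q : ℂ) ^ 2 - 1 + 4 * q * s ≠ 0 := by exact_mod_cast hE
  have hq1 : (q : ℂ) + 1 ≠ 0 := by exact_mod_cast (by linarith : q + 1 ≠ 0)
  have hac : (a : ℂ) ≠ 0 := ofReal_ne_zero.2 ha
  have htc : conj t = q / t := by
    rw [eq_div_iff ht0, mul_comm, mul_conj, normSq_eq_norm_sq, h1]
  have h4 : conj (flowV a (coeffX s q / a) 0 (1 / (4 * a ^ 2)) 1 (clampedSeries s q) z) *
      (conj t - 1) = 0 := by
    rw [h2, h3, htc]
    -- The terms −t and −q t⁻² left by telescoping cancel against the logarithmic sources at the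
    -- foci (the coefficient l = 1). Two equations remain, for the powers t⁰ and t⁻¹. They fix
    -- `coeffX` and the sum of the zeroth `coeffA` and the first `coeffB`.
    simp only [coeffX, coeffA, coeffB, if_true, one_ne_zero, if_false]
    push_cast
    obtain ⟨E, hEd⟩ : ∃ E, E = (q : ℂ) ^ 2 - 1 + 4 * q * s := ⟨_, rfl⟩
    rw [← hEd] at hEc ⊢
    field_simp
    rw [hEd]
    ring
  have h5 := (mul_eq_zero.1 h4).resolve_right (conj_sub_one_ne_zero ha hq0 hz)
  simpa using h5

/-- The boundary value of the explicit part of the flow on the circle `|t|² = q`. -/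
theorem flowV_explicit_eq (ha : a ≠ 0) (hs : 0 < s) (hqs : q = Real.exp (2 * s))
    (hz : z ∈ bipolarDomain a q) (htz : ‖bipolar a z‖ = Real.exp s) :
    flowV a (-(2 * q) / (q ^ 2 - 1 + 4 * q * s))
      (-((q - 1) ^ 2 / (4 * a * (q ^ 2 - 1 + 4 * q * s)))) 0 0 A z = -1 / 2 := by
  have hq : 1 < q := by rw [hqs]; exact Real.one_lt_exp_iff.2 (by linarith)
  have hq0 : 0 < q := by linarith
  have h1 : ‖bipolar a z‖ ^ 2 = q := by
    rw [htz, hqs, ← Real.exp_nat_mul]; norm_num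
  have h2 := conj_flowV (c := -(2 * q) / (q ^ 2 - 1 + 4 * q * s))
    (r := -((q - 1) ^ 2 / (4 * a * (q ^ 2 - 1 + 4 * q * s)))) (k := 0) (l := 0) (A := A)
    ha hq0 hz rfl
  rw [htz, Real.log_exp] at h2
  set t := bipolar a z
  have ht0 : t ≠ 0 := ne_zero_of_mem_annulus hq0 hz
  have hE : q ^ 2 - 1 + 4 * q * s ≠ 0 := by
    have : 0 < q * s := by positivity
    nlinarith
  have hEc : (q : ℂ) ^ 2 - 1 + 4 * q * s ≠ 0 := by exact_mod_cast hE
  have hac : (a : ℂ) ≠ 0 := ofReal_ne_zero.2 ha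
  have htc : conj t = q / t := by
    rw [eq_div_iff ht0, mul_comm, mul_conj, normSq_eq_norm_sq, h1]
  have h5 := conj_sub_one_ne_zero ha hq0 hz
  have h4 : conj (flowV a (-(2 * q) / (q ^ 2 - 1 + 4 * q * s))
      (-((q - 1) ^ 2 / (4 * a * (q ^ 2 - 1 + 4 * q * s)))) 0 0 A z) * (conj t - 1) =
      (-1 / 2) * (conj t - 1) := by
    rw [h2, htc]
    push_cast
    obtain ⟨E, hEd⟩ : ∃ E, E = (q : ℂ) ^ 2 - 1 + 4 * q * s := ⟨_, rfl⟩
    rw [← hEd] at hEc ⊢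
    field_simp
    rw [hEd]
    ring
  have h6 := congrArg conj (mul_right_cancel₀ h5 h4)
  have h7 : conj (-1 / 2 : ℂ) = -1 / 2 := by
    rw [show (-1 / 2 : ℂ) = ((-1 / 2 : ℝ) : ℂ) by push_cast; rfl, conj_ofReal]
  rwa [conj_conj, h7] at h6

end
end

section

open Topology

/-! ### Elementary inequalities for hyperbolic functions -/

theorem le_of_hasDerivAt_nonneg {f f' : ℝ → ℝ} {a b : ℝ} (hab : a ≤ b)
    (hf : ∀ x, HasDerivAt f (f' x) x) (h0 : ∀ x, a ≤ x → 0 ≤ f' x) : f a ≤ f b := by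
  refine monotoneOn_of_deriv_nonneg (convex_Icc a b)
    (fun x _ => (hf x).continuousAt.continuousWithinAt)
    (fun x _ => (hf x).differentiableAt.differentiableWithinAt) (fun x hx => ?_)
    (Set.left_mem_Icc.2 hab) (Set.right_mem_Icc.2 hab) hab
  rw [interior_Icc] at hx
  rw [(hf x).deriv]
  exact h0 x hx.1.le

section

variable {x y s : ℝ}

theorem cosh_sub_one_le_sinh (hx : 0 ≤ x) : Real.cosh x - 1 ≤ Real.sinh x := by
  have h1 := Real.cosh_sub_sinh x
  have h2 : Real.exp (-x) ≤ 1 := Real.exp_le_one_iff.2 (by linarith)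
  linarith

theorem one_add_half_sq_le_cosh (x : ℝ) : 1 + x ^ 2 / 2 ≤ Real.cosh x := by
  have h1 : Real.cosh x = 1 + 2 * Real.sinh (x / 2) ^ 2 := by
    have h2 := Real.cosh_two_mul (x / 2)
    have h3 := Real.cosh_sq (x / 2)
    rw [show 2 * (x / 2) = x by ring] at h2
    linarith
  have h2 : (x / 2) ^ 2 ≤ Real.sinh (x / 2) ^ 2 := by
    rw [sq_le_sq, Real.abs_sinh]
    exact Real.self_le_sinh_iff.2 (abs_nonneg _)
  linarith

theorem sinh_le_mul_cosh (hx : 0 ≤ x) : Real.sinh x ≤ x * Real.cosh x := by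
  have := le_of_hasDerivAt_nonneg (f := fun x => x * Real.cosh x - Real.sinh x) hx
    (f' := fun x => x * Real.sinh x) (fun x => by
      refine (((hasDerivAt_id x).mul (Real.hasDerivAt_cosh x)).sub
        (Real.hasDerivAt_sinh x)).congr_deriv ?_
      simp) (fun x hx => mul_nonneg hx (Real.sinh_nonneg_iff.2 hx))
  simp at this
  linarith

theorem add_cube_le_sinh (hx : 0 ≤ x) : x + x ^ 3 / 6 ≤ Real.sinh x := by
  have := le_of_hasDerivAt_nonneg (f := fun x => Real.sinh x - (x + x ^ 3 / 6)) hx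
    (f' := fun x => Real.cosh x - (1 + x ^ 2 / 2)) (fun x => by
      refine ((Real.hasDerivAt_sinh x).sub ((hasDerivAt_id x).add
        ((hasDerivAt_pow 3 x).div_const 6))).congr_deriv ?_
      norm_num
      ring) (fun x _ => sub_nonneg.2 (one_add_half_sq_le_cosh x))
  simp at this
  linarith

/-- Monotonicity of y ↦ sinh y / y, written without division. -/
theorem mul_sinh_le_mul_sinh (hx : 0 ≤ x) (hxy : x ≤ y) :
    y * Real.sinh x ≤ x * Real.sinh y := by
  have := le_of_hasDerivAt_nonneg (f := fun y => x * Real.sinh y - y * Real.sinh x) hxy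
    (f' := fun y => x * Real.cosh y - Real.sinh x) (fun y => by
      refine (((Real.hasDerivAt_sinh y).const_mul x).sub
        ((hasDerivAt_id y).mul_const (Real.sinh x))).congr_deriv ?_
      simp) (fun y hy => by
      have h1 := sinh_le_mul_cosh hx
      have h2 : Real.cosh x ≤ Real.cosh y :=
        Real.cosh_le_cosh.2 (by rwa [abs_of_nonneg hx, abs_of_nonneg (hx.trans hy)])
      nlinarith)
  simp only [sub_self] at this
  linarith

theorem cosh_le_one_add_sq (hx : |x| ≤ 1) : Real.cosh x ≤ 1 + x ^ 2 := by
  refine (Real.cosh_le_exp_half_sq x).trans ?_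
  have h1 : x ^ 2 ≤ 1 := (sq_le_one_iff_abs_le_one x).2 hx
  have h2 : |x ^ 2 / 2| ≤ 1 := by rw [abs_of_nonneg (by positivity)]; linarith
  have h3 := (abs_le.1 (Real.abs_exp_sub_one_sub_id_le h2)).2
  nlinarith [sq_nonneg x]

theorem sinh_le_add_cube (hx : 0 ≤ x) (hx1 : x ≤ 1) : Real.sinh x ≤ x + x ^ 3 := by
  have h1 := sinh_le_mul_cosh hx
  have h2 := cosh_le_one_add_sq (abs_le.2 ⟨by linarith, hx1⟩)
  nlinarith

/-- Since e⁻ˣ sinh x = (1 − e⁻²ˣ)/2, this is (1 + 2x)e⁻²ˣ ≤ 1. It trades a factor y in a numerator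
for sinh y with exponential decay, uniformly down to y = 0. -/
theorem le_mul_exp_neg_mul_sinh (x : ℝ) : x ≤ (1 + 2 * x) * Real.exp (-x) * Real.sinh x := by
  have h1 : Real.exp (-x) * Real.sinh x = (1 - Real.exp (-(2 * x))) / 2 := by
    rw [Real.sinh_eq, show -(2 * x) = -x + -x by ring, Real.exp_add]
    have : Real.exp (-x) * Real.exp x = 1 := by rw [← Real.exp_add]; simp
    linear_combination this / 2
  have h2 : (1 + 2 * x) * Real.exp (-(2 * x)) ≤ 1 := by
    rw [Real.exp_neg, ← div_eq_mul_inv]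
    have := Real.add_one_le_exp (2 * x)
    exact (div_le_one (Real.exp_pos _)).2 (by linarith)
  rw [mul_assoc, h1]
  linarith

/-! ### The profiles of the coefficients -/

/-- The profile of `1 - (Xₙ + Yₙ) / (2 Dₙ)`. -/
def profileSigma (l y : ℝ) : ℝ := (Real.cosh y - 1) / (Real.sinh y + l * y)

/-- The derivative of `profileSigma`. -/
def profileSigmaDeriv (l y : ℝ) : ℝ :=
  (l * y * Real.sinh y - (l - 1) * (Real.cosh y - 1)) / (Real.sinh y + l * y) ^ 2

/-- The second derivative of `profileSigma`. -/
def profileSigmaDeriv2 (l y : ℝ) : ℝ :=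
  ((Real.sinh y - l * y) * (Real.sinh y - l * y * Real.cosh y) +
    2 * (l - 1) * ((Real.cosh y - 1) * (Real.cosh y + l) - l * y * Real.sinh y)) /
    (Real.sinh y + l * y) ^ 3

/-- The profile of `κₙ`. -/
def profileKappa (l y : ℝ) : ℝ := y / (Real.sinh y + l * y)

variable {l : ℝ}

theorem hasDerivAt_profile_den (l y : ℝ) :
    HasDerivAt (fun y => Real.sinh y + l * y) (Real.cosh y + l) y := by
  refine ((Real.hasDerivAt_sinh y).add ((hasDerivAt_id y).const_mul l)).congr_deriv ?_
  simp

theorem profile_den_pos (hl : 0 ≤ l) (hy : 0 < y) : 0 < Real.sinh y + l * y := by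
  have := Real.sinh_pos_iff.2 hy
  positivity

theorem hasDerivAt_profileSigma (hl : 0 ≤ l) (hy : 0 < y) :
    HasDerivAt (profileSigma l) (profileSigmaDeriv l y) y := by
  refine (((Real.hasDerivAt_cosh y).sub_const 1).div (hasDerivAt_profile_den l y)
    (profile_den_pos hl hy).ne').congr_deriv ?_
  rw [profileSigmaDeriv]
  congr 1
  linear_combination (-1) * Real.cosh_sq y

theorem hasDerivAt_profileSigmaDeriv (hl : 0 ≤ l) (hy : 0 < y) :
    HasDerivAt (profileSigmaDeriv l) (profileSigmaDeriv2 l y) y := by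
  have hD := (profile_den_pos hl hy).ne'
  have h1 : HasDerivAt (fun y => l * y * Real.sinh y - (l - 1) * (Real.cosh y - 1))
      (Real.sinh y + l * y * Real.cosh y) y := by
    refine ((((hasDerivAt_id y).const_mul l).mul (Real.hasDerivAt_sinh y)).sub
      (((Real.hasDerivAt_cosh y).sub_const 1).const_mul (l - 1))).congr_deriv ?_
    simp
    ring
  refine (h1.div ((hasDerivAt_profile_den l y).pow 2) (pow_ne_zero 2 hD)).congr_deriv ?_
  rw [profileSigmaDeriv2]
  simp only [Nat.cast_ofNat, Nat.add_one_sub_one, pow_one, Pi.pow_apply]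
  rw [div_eq_div_iff (pow_ne_zero 2 (pow_ne_zero 2 hD)) (pow_ne_zero 3 hD)]
  ring

theorem hasDerivAt_profileKappa (hl : 0 ≤ l) (hy : 0 < y) :
    HasDerivAt (profileKappa l)
      ((Real.sinh y - y * Real.cosh y) / (Real.sinh y + l * y) ^ 2) y := by
  refine ((hasDerivAt_id y).div (hasDerivAt_profile_den l y)
    (profile_den_pos hl hy).ne').congr_deriv ?_
  simp
  ring

theorem abs_profileKappa_deriv_le (hl : 0 ≤ l) (hy : 0 < y) :
    |(Real.sinh y - y * Real.cosh y) / (Real.sinh y + l * y) ^ 2| ≤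
      (1 + 2 * y) * Real.exp (-y) := by
  have hS := Real.sinh_pos_iff.2 hy
  have h1 := sinh_le_mul_cosh hy.le
  have h2 := cosh_sub_one_le_sinh hy.le
  have h3 := Real.self_le_sinh_iff.2 hy.le
  have h4 := le_mul_exp_neg_mul_sinh y
  have hD := profile_den_pos hl hy
  have h5 : Real.sinh y ≤ Real.sinh y + l * y := by nlinarith
  rw [abs_div, abs_of_nonpos (by linarith), abs_of_pos (pow_pos hD 2), div_le_iff₀ (pow_pos hD 2)]
  have h6 : 0 ≤ (1 + 2 * y) * Real.exp (-y) := by positivity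
  calc -(Real.sinh y - y * Real.cosh y) ≤ y * Real.sinh y := by nlinarith
    _ ≤ (1 + 2 * y) * Real.exp (-y) * Real.sinh y * Real.sinh y := by gcongr
    _ = (1 + 2 * y) * Real.exp (-y) * Real.sinh y ^ 2 := by ring
    _ ≤ _ := by gcongr

/-- The bound must be uniform in s although the denominator vanishes to third order at y = 0. Two
facts compensate. The first is l − 1 ≤ (2s)² ≤ y². The second is l y ≤ sinh y, which holds exactly
because y ≥ 2s. They give the numerator a factor y sinh² y. -/
theorem abs_profileSigmaDeriv2_le (hs : 0 < s) (hs1 : s ≤ 1 / 2)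
    (hl : l = Real.sinh (2 * s) / (2 * s)) (hy : 2 * s ≤ y) :
    |profileSigmaDeriv2 l y| ≤ 8 * (1 + 2 * y) ^ 2 * Real.exp (-y) := by
  have hy0 : 0 < y := by linarith
  have hS := Real.sinh_pos_iff.2 hy0
  have hls : l * (2 * s) = Real.sinh (2 * s) := by rw [hl]; field_simp
  have hl1 : 1 ≤ l := by
    rw [hl, le_div_iff₀ (by linarith), one_mul]
    exact Real.self_le_sinh_iff.2 (by linarith)
  have hl2' : l ≤ 1 + (2 * s) ^ 2 := by
    have h1 := sinh_le_add_cube (x := 2 * s) (by linarith) (by linarith)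
    rw [hl, div_le_iff₀ (by linarith)]
    linarith
  have hl2 : l - 1 ≤ y ^ 2 := by nlinarith
  have hl3 : l ≤ 2 := by nlinarith
  have hly : l * y ≤ Real.sinh y := by
    have := mul_sinh_le_mul_sinh (x := 2 * s) (by linarith) hy
    rw [← hls] at this
    have h2 : 2 * s * (l * y) ≤ 2 * s * Real.sinh y := by linarith
    exact le_of_mul_le_mul_left h2 (by linarith)
  have h2 := cosh_sub_one_le_sinh hy0.le
  have h3 := Real.self_le_sinh_iff.2 hy0.le
  have h4 := le_mul_exp_neg_mul_sinh y
  have hc := Real.one_le_cosh y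
  have hsc := sinh_le_mul_cosh hy0.le
  have hD := profile_den_pos (by linarith : 0 ≤ l) hy0
  have h5 : Real.sinh y ≤ Real.sinh y + l * y := by nlinarith
  set S := Real.sinh y
  set c := Real.cosh y
  set D := S + l * y
  have hD3 : 0 < D ^ 3 := pow_pos hD 3
  have hSD : S ^ 3 ≤ D ^ 3 := by gcongr
  have t1 : |(S - l * y) * (S - l * y * c)| ≤ S * (2 * y * S) := by
    rw [abs_mul]
    refine mul_le_mul ?_ ?_ (abs_nonneg _) hS.le
    · rw [abs_of_nonneg (by linarith)]
      nlinarith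
    · have h6 : 0 ≤ l * y * c - S := by nlinarith
      rw [abs_sub_comm, abs_of_nonneg h6]
      have h7 : l * y * (c - 1) ≤ 2 * y * S := by
        have : l * y ≤ 2 * y := by nlinarith
        exact mul_le_mul this h2 (by linarith) (by linarith)
      nlinarith
  have t2 : |2 * (l - 1) * ((c - 1) * (c + l) - l * y * S)| ≤ 6 * (1 + y) * y * S ^ 2 := by
    rw [abs_mul, abs_of_nonneg (by linarith : 0 ≤ 2 * (l - 1))]
    have h6 : |(c - 1) * (c + l) - l * y * S| ≤ S * (c + l) + l * y * S := by
      refine (abs_sub _ _).trans ?_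
      rw [abs_of_nonneg (mul_nonneg (by linarith) (by linarith)),
        abs_of_nonneg (by positivity)]
      gcongr
    have h7 : y * (c + l + l * y) ≤ 3 * (1 + y) * S := by
      have e1 : y * c ≤ y + y * S := by nlinarith
      have e2 : l * y * y ≤ 2 * y * S := by nlinarith
      nlinarith
    calc 2 * (l - 1) * |(c - 1) * (c + l) - l * y * S|
        ≤ 2 * y ^ 2 * (S * (c + l) + l * y * S) := by gcongr
      _ = 2 * y * S * (y * (c + l + l * y)) := by ring
      _ ≤ 2 * y * S * (3 * (1 + y) * S) := by gcongr
      _ = _ := by ring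
  rw [profileSigmaDeriv2, abs_div, abs_of_pos hD3, div_le_iff₀ hD3]
  calc _ ≤ S * (2 * y * S) + 6 * (1 + y) * y * S ^ 2 := (abs_add_le _ _).trans (add_le_add t1 t2)
    _ ≤ 8 * (1 + 2 * y) * S ^ 2 * y := by
      have : 0 ≤ S ^ 2 * y := by positivity
      nlinarith [mul_nonneg this hy0.le]
    _ ≤ 8 * (1 + 2 * y) * S ^ 2 * ((1 + 2 * y) * Real.exp (-y) * S) := by gcongr
    _ = 8 * (1 + 2 * y) ^ 2 * Real.exp (-y) * S ^ 3 := by ring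
    _ ≤ _ := by gcongr

theorem abs_sub_le_of_hasDerivAt {f f' : ℝ → ℝ} {a b M : ℝ} (hab : a ≤ b)
    (hf : ∀ x ∈ Set.Icc a b, HasDerivAt f (f' x) x) (hM : ∀ x ∈ Set.Icc a b, |f' x| ≤ M) :
    |f b - f a| ≤ M * (b - a) := by
  have := (convex_Icc a b).norm_image_sub_le_of_norm_hasDerivWithin_le
    (fun x hx => (hf x hx).hasDerivWithinAt) hM (Set.left_mem_Icc.2 hab) (Set.right_mem_Icc.2 hab)
  rwa [Real.norm_eq_abs, Real.norm_eq_abs, abs_of_nonneg (sub_nonneg.2 hab)] at this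

theorem abs_second_difference_le {f f' f'' : ℝ → ℝ} {h M : ℝ} (hh : 0 ≤ h)
    (hf : ∀ u ∈ Set.Icc (x - h) (x + h), HasDerivAt f (f' u) u)
    (hf' : ∀ u ∈ Set.Icc (x - h) (x + h), HasDerivAt f' (f'' u) u)
    (hM : ∀ u ∈ Set.Icc (x - h) (x + h), |f'' u| ≤ M) :
    |f (x + h) - 2 * f x + f (x - h)| ≤ M * h ^ 2 := by
  have h1 : ∀ u ∈ Set.Icc (x - h) x, |f' (u + h) - f' u| ≤ M * h := by
    intro u hu
    have hsub : Set.Icc u (u + h) ⊆ Set.Icc (x - h) (x + h) :=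
      Set.Icc_subset_Icc hu.1 (by linarith [hu.2])
    have := abs_sub_le_of_hasDerivAt (by linarith : u ≤ u + h) (fun v hv => hf' v (hsub hv))
      (fun v hv => hM v (hsub hv))
    simpa using this
  have h2 := abs_sub_le_of_hasDerivAt (f := fun u => f (u + h) - f u)
    (f' := fun u => f' (u + h) - f' u) (by linarith : x - h ≤ x)
    (fun u hu => ((hf (u + h) ⟨by linarith [hu.1], by linarith [hu.2]⟩).comp_add_const u h).sub
      (hf u ⟨hu.1, by linarith [hu.2]⟩)) h1
  simp only [sub_add_cancel] at h2
  calc _ = |f (x + h) - f x - (f x - f (x - h))| := by congr 1; ring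
    _ ≤ _ := h2
    _ = _ := by ring

end

end

section

open Topology

/-! ### The coefficients of the pressure of the clamped flow -/

/-- The coefficients of the holomorphic function whose imaginary part is the pressure. -/
def coeffH (s q : ℝ) (n : ℕ) : ℝ :=
  (n + 1) * coeffA s q n - ((n - 1 : ℕ) : ℝ) * coeffA s q (n - 1) +
    (n + 1) * coeffB s q (n + 1) - (n - 1) * coeffB s q n +
    (if n = 0 then coeffX s q else if n = 1 then -coeffX s q else 0)

/-- The coefficient `2 n sinh² s / Dₙ`. -/
def kappa (s : ℝ) (x : ℝ) : ℝ :=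
  Real.sinh s ^ 2 / s * profileKappa (Real.sinh (2 * s) / (2 * s)) (2 * s * x)

/-- The coefficient `2 sinh² ns / Dₙ`. -/
def sigma (s : ℝ) (x : ℝ) : ℝ := profileSigma (Real.sinh (2 * s) / (2 * s)) (2 * s * x)

section

variable {s q : ℝ}

theorem exp_two_mul_pow (s : ℝ) (n : ℕ) : Real.exp (2 * s) ^ n = Real.exp (2 * s * n) := by
  rw [← Real.exp_nat_mul]; congr 1; ring

theorem den_eq (hs : 0 < s) (n : ℕ) :
    den (Real.exp (2 * s)) n = Real.sinh (2 * s * n) +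
      Real.sinh (2 * s) / (2 * s) * (2 * s * n) := by
  have h : Real.sinh (2 * s) / (2 * s) * (2 * s * n) = n * Real.sinh (2 * s) := by field_simp
  rw [h, den, exp_two_mul_pow, Real.sinh_eq, Real.sinh_eq, Real.exp_neg, Real.exp_neg]
  ring

theorem kappa_eq (hs : 0 < s) (n : ℕ) :
    kappa s n = 2 * n * Real.sinh s ^ 2 / den (Real.exp (2 * s)) n := by
  rw [kappa, profileKappa, ← den_eq hs]
  field_simp

theorem sigma_eq (hs : 0 < s) (n : ℕ) :
    sigma s n = (Real.cosh (2 * s * n) - 1) / den (Real.exp (2 * s)) n := by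
  rw [sigma, profileSigma, ← den_eq hs]

theorem four_mul_sinh_sq (s : ℝ) :
    4 * Real.sinh s ^ 2 = Real.exp (2 * s) + (Real.exp (2 * s))⁻¹ - 2 := by
  have h := Real.cosh_two_mul s
  have h2 := Real.cosh_sq s
  have h3 := Real.cosh_eq (2 * s)
  rw [Real.exp_neg] at h3
  linarith

theorem numA_div_den (hs : 0 < s) {n : ℕ} (hn : n ≠ 0) :
    numA (Real.exp (2 * s)) n / den (Real.exp (2 * s)) n = 1 - sigma s n - kappa s n := by
  have hD := (den_pos (Real.one_lt_exp_iff.2 (by linarith : 0 < 2 * s)) hn).ne'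
  rw [sigma_eq hs, kappa_eq hs]
  field_simp
  have h := four_mul_sinh_sq s
  rw [numA, den, Real.cosh_eq, Real.exp_neg, exp_two_mul_pow]
  linear_combination (n : ℝ) / 2 * h

theorem numB_div_den (hs : 0 < s) {n : ℕ} (hn : n ≠ 0) :
    numB (Real.exp (2 * s)) n / den (Real.exp (2 * s)) n = 1 - sigma s n + kappa s n := by
  have hD := (den_pos (Real.one_lt_exp_iff.2 (by linarith : 0 < 2 * s)) hn).ne'
  rw [sigma_eq hs, kappa_eq hs]
  field_simp
  have h := four_mul_sinh_sq s
  rw [numB, den, Real.cosh_eq, Real.exp_neg, exp_two_mul_pow]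
  linear_combination -(n : ℝ) / 2 * h

theorem coeffA_eq (hs : 0 < s) {n : ℕ} (hn : n ≠ 0) :
    coeffA s (Real.exp (2 * s)) n = (1 - sigma s n - kappa s n) / (n * (n + 1)) := by
  rw [coeffA, if_neg hn, ← numA_div_den hs hn, div_div, mul_comm (den _ _)]

theorem coeffB_eq (hs : 0 < s) {n : ℕ} (hn : 2 ≤ n) :
    coeffB s (Real.exp (2 * s)) n = -((1 - sigma s n + kappa s n) / (n * (n - 1))) := by
  rw [coeffB, if_neg (by omega), if_neg (by omega), ← numB_div_den hs (by omega), div_div,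
    mul_comm (den _ _)]

/-- The factors n ± 1 in `coeffH` cancel the denominators of the coefficients, and the constants 1
drop out. A second difference of σ and a central difference of κ remain. Each is O(s²): the former
because the step in the profile variable is 2s, the latter because κ itself carries a factor of
order s. -/
theorem coeffH_eq (hs : 0 < s) (n : ℕ) :
    coeffH s (Real.exp (2 * s)) (n + 2) =
      ((sigma s (n + 2 + 1) - 2 * sigma s (n + 2) + sigma s (n + 2 - 1)) -
        (kappa s (n + 2 + 1) - kappa s (n + 2 - 1))) / (n + 2) := by
  rw [coeffH, if_neg (by omega), if_neg (by omega), coeffA_eq hs (by omega),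
    Nat.add_sub_assoc (by norm_num), coeffA_eq hs (by omega), coeffB_eq hs (by omega),
    coeffB_eq hs (by omega)]
  norm_num
  have e1 : (n : ℝ) + 2 - 1 = n + 1 := by ring
  have e2 : (n : ℝ) + 1 + 1 = n + 2 := by ring
  have e3 : (n : ℝ) + 2 + 1 = n + 3 := by ring
  rw [e1, e2, e3]
  have h1 : (n : ℝ) + 1 ≠ 0 := by positivity
  have h2 : (n : ℝ) + 2 ≠ 0 := by positivity
  have h3 : (n : ℝ) + 3 ≠ 0 := by positivity
  field_simp
  ring

theorem abs_sigma_difference_le (hs : 0 < s) (hs1 : s ≤ 1 / 2) {x : ℝ} (hx : 2 ≤ x) :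
    |sigma s (x + 1) - 2 * sigma s x + sigma s (x - 1)| ≤
      96 * s ^ 2 * (1 + 6 * (x * s)) ^ 2 * Real.exp (-(2 * (x * s))) := by
  have hl : 0 ≤ Real.sinh (2 * s) / (2 * s) := by
    have := Real.sinh_pos_iff.2 (by linarith : 0 < 2 * s)
    positivity
  have hmem : ∀ u ∈ Set.Icc (2 * s * x - 2 * s) (2 * s * x + 2 * s), 2 * s ≤ u := fun u hu => by
    have := hu.1; nlinarith
  -- The 24 is 8 · 3: the 8 comes from the second derivative of the profile, and the 3 bounds e^(2s)
  -- ≤ e when the exponential is moved to the midpoint. Since x ≥ 2, every u in the window satisfies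
  -- u ≤ 3xs.
  have h1 := abs_second_difference_le (x := 2 * s * x) (h := 2 * s)
    (f := profileSigma (Real.sinh (2 * s) / (2 * s)))
    (M := 24 * (1 + 6 * (x * s)) ^ 2 * Real.exp (-(2 * (x * s)))) (by linarith)
    (fun u hu => hasDerivAt_profileSigma hl (by linarith [hmem u hu]))
    (fun u hu => hasDerivAt_profileSigmaDeriv hl (by linarith [hmem u hu]))
    (fun u hu => by
      refine (abs_profileSigmaDeriv2_le hs hs1 rfl (hmem u hu)).trans ?_
      have h2 : 1 + 2 * u ≤ 1 + 6 * (x * s) := by have := hu.2; nlinarith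
      have h3 : Real.exp (-u) ≤ 3 * Real.exp (-(2 * (x * s))) := by
        have h4 : Real.exp (-u) ≤ Real.exp (2 * s + -(2 * (x * s))) :=
          Real.exp_le_exp.2 (by have := hu.1; linarith)
        have h5 : Real.exp (2 * s) ≤ 3 :=
          (Real.exp_le_exp.2 (by linarith : 2 * s ≤ 1)).trans Real.exp_one_lt_three.le
        rw [Real.exp_add] at h4
        exact h4.trans (mul_le_mul_of_nonneg_right h5 (Real.exp_pos _).le)
      have h6 : 0 ≤ 1 + 2 * u := by linarith [hmem u hu]
      calc 8 * (1 + 2 * u) ^ 2 * Real.exp (-u)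
          ≤ 8 * (1 + 6 * (x * s)) ^ 2 * (3 * Real.exp (-(2 * (x * s)))) := by gcongr
        _ = _ := by ring)
  simp only [sigma]
  rw [show 2 * s * (x + 1) = 2 * s * x + 2 * s by ring,
    show 2 * s * (x - 1) = 2 * s * x - 2 * s by ring]
  refine h1.trans (le_of_eq ?_)
  ring

theorem abs_kappa_difference_le (hs : 0 < s) (hs1 : s ≤ 1 / 2) {x : ℝ} (hx : 2 ≤ x) :
    |kappa s (x + 1) - kappa s (x - 1)| ≤
      48 * s ^ 2 * (1 + 6 * (x * s)) ^ 2 * Real.exp (-(2 * (x * s))) := by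
  have hl : 0 ≤ Real.sinh (2 * s) / (2 * s) := by
    have := Real.sinh_pos_iff.2 (by linarith : 0 < 2 * s)
    positivity
  have hmem : ∀ u ∈ Set.Icc (2 * s * (x - 1)) (2 * s * (x + 1)), 2 * s ≤ u := fun u hu => by
    have := hu.1; nlinarith
  have h1 := abs_sub_le_of_hasDerivAt (a := 2 * s * (x - 1)) (b := 2 * s * (x + 1))
    (f := profileKappa (Real.sinh (2 * s) / (2 * s)))
    (M := 3 * (1 + 6 * (x * s)) * Real.exp (-(2 * (x * s)))) (by linarith)
    (fun u hu => hasDerivAt_profileKappa hl (by linarith [hmem u hu]))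
    (fun u hu => by
      refine (abs_profileKappa_deriv_le hl (by linarith [hmem u hu])).trans ?_
      have h2 : 1 + 2 * u ≤ 1 + 6 * (x * s) := by have := hu.2; nlinarith
      have h3 : Real.exp (-u) ≤ 3 * Real.exp (-(2 * (x * s))) := by
        have h4 : Real.exp (-u) ≤ Real.exp (2 * s + -(2 * (x * s))) :=
          Real.exp_le_exp.2 (by have := hu.1; linarith)
        have h5 : Real.exp (2 * s) ≤ 3 :=
          (Real.exp_le_exp.2 (by linarith : 2 * s ≤ 1)).trans Real.exp_one_lt_three.le
        rw [Real.exp_add] at h4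
        exact h4.trans (mul_le_mul_of_nonneg_right h5 (Real.exp_pos _).le)
      have h6 : 0 ≤ 1 + 2 * u := by linarith [hmem u hu]
      calc (1 + 2 * u) * Real.exp (-u)
          ≤ (1 + 6 * (x * s)) * (3 * Real.exp (-(2 * (x * s)))) := by gcongr
        _ = _ := by ring)
  have h2 : Real.sinh s ≤ 2 * s := by
    have := sinh_le_add_cube hs.le (by linarith)
    have : s ^ 3 ≤ s := by nlinarith [sq_nonneg s]
    linarith
  have h3 := Real.sinh_pos_iff.2 hs
  have hxs : 0 ≤ x * s := by positivity
  simp only [kappa]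
  rw [← mul_sub, abs_mul, abs_of_nonneg (by positivity)]
  calc _ ≤ (2 * s) ^ 2 / s * (3 * (1 + 6 * (x * s)) * Real.exp (-(2 * (x * s))) *
        (2 * s * (x + 1) - 2 * s * (x - 1))) := by gcongr
    _ = 48 * s ^ 2 * (1 + 6 * (x * s)) * Real.exp (-(2 * (x * s))) := by field_simp; ring
    _ ≤ _ := by
      gcongr
      nlinarith

/-- With u = ns one has s²/n = s^(3/2) n^(−3/2) √u, and √u is absorbed by the exponential decay.
This half power of s buys a summable weight independent of s; the resulting order s^(3/2) is still
more than the final estimate needs. The factor e^(ns)(1 + ns) prepares for evaluating the series and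
s times its derivative at |t| ≤ eˢ. -/
theorem abs_coeffH_mul_le (hs : 0 < s) (hs1 : s ≤ 1 / 2) (n : ℕ) :
    |coeffH s (Real.exp (2 * s)) (n + 2)| * (Real.exp ((n + 2 : ℕ) * s) * (1 + (n + 2 : ℕ) * s)) ≤
      144 * 24 ^ 4 * (s * √s) * (((n + 2 : ℕ) : ℝ) ^ (3 / 2 : ℝ))⁻¹ := by
  have e1 : ((n + 2 : ℕ) : ℝ) = n + 2 := by push_cast; ring
  rw [coeffH_eq hs, e1]
  set x : ℝ := n + 2 with hx
  have hx2 : 2 ≤ x := by have : (0 : ℝ) ≤ n := Nat.cast_nonneg n; linarith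
  have h1 := abs_sigma_difference_le hs hs1 hx2
  have h2 := abs_kappa_difference_le hs hs1 hx2
  have hu : 0 < x * s := by positivity
  rw [abs_div, abs_of_pos (by linarith : 0 < x)]
  have h3 := (abs_sub _ _).trans (add_le_add h1 h2)
  set u := x * s
  have e2 : Real.exp (-(2 * u)) * Real.exp u = Real.exp (-u) := by
    rw [← Real.exp_add]; congr 1; ring
  have h4 : (1 + 6 * u) ≤ 24 * Real.exp (u / 4) := by
    have := Real.add_one_le_exp (u / 4); linarith
  have h5 : (1 + 6 * u) ^ 4 ≤ 24 ^ 4 * Real.exp u := by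
    have : Real.exp u = Real.exp (u / 4) ^ 4 := by rw [← Real.exp_nat_mul]; congr 1; push_cast; ring
    rw [this, ← mul_pow]
    gcongr
  have h6 : √u ≤ 1 + 6 * u := by
    rw [Real.sqrt_le_left (by linarith)]; nlinarith
  have h7 : x ^ (3 / 2 : ℝ) = x * √x := by
    rw [show (3 / 2 : ℝ) = 1 + 1 / 2 by norm_num, Real.rpow_add (by linarith), Real.rpow_one,
      Real.sqrt_eq_rpow]
  have h8 : √u = √x * √s := Real.sqrt_mul (by linarith) s
  have hsx : 0 < √x := Real.sqrt_pos.2 (by linarith)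
  have hss : 0 < √s := Real.sqrt_pos.2 hs
  have hs2 : √s * √s = s := Real.mul_self_sqrt hs.le
  rw [h7]
  -- Four powers of 1 + 6u occur: two from the difference bounds, one from 1 + u, one from √u. The
  -- inequality 1 + 6u ≤ 24 e^(u/4) makes them cost exactly one factor e^u.
  have h9 : (1 + 6 * u) ^ 2 * (1 + u) * Real.exp (-u) * (√x * √s) ≤ 24 ^ 4 := by
    rw [← h8]
    calc (1 + 6 * u) ^ 2 * (1 + u) * Real.exp (-u) * √u
        ≤ (1 + 6 * u) ^ 2 * (1 + 6 * u) * Real.exp (-u) * (1 + 6 * u) := by gcongr; linarith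
      _ = (1 + 6 * u) ^ 4 * Real.exp (-u) := by ring
      _ ≤ 24 ^ 4 * Real.exp u * Real.exp (-u) := by gcongr
      _ = 24 ^ 4 := by rw [mul_assoc, ← Real.exp_add]; simp
  calc _ ≤ (96 * s ^ 2 * (1 + 6 * u) ^ 2 * Real.exp (-(2 * u)) +
        48 * s ^ 2 * (1 + 6 * u) ^ 2 * Real.exp (-(2 * u))) / x * (Real.exp u * (1 + u)) := by
        gcongr
    _ = 144 * s ^ 2 * ((1 + 6 * u) ^ 2 * (1 + u) * (Real.exp (-(2 * u)) * Real.exp u)) / x := by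
        ring
    _ = 144 * ((1 + 6 * u) ^ 2 * (1 + u) * Real.exp (-u) * (√x * √s)) * (s * √s) *
        (x * √x)⁻¹ := by
        rw [e2]
        field_simp
        nth_rw 1 [← hs2]
        ring
    _ ≤ 144 * 24 ^ 4 * (s * √s) * (x * √x)⁻¹ := by gcongr

theorem coeffH_zero_eq (hs : 0 < s) :
    coeffH s (Real.exp (2 * s)) 0 = s - Real.sinh s / (2 * Real.cosh s) -
      s ^ 2 / (Real.sinh s * Real.cosh s + s) := by
  have hE : Real.exp (2 * s) = Real.exp s ^ 2 := by rw [← Real.exp_nat_mul]; norm_num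
  have hE1 : 1 < Real.exp s := Real.one_lt_exp_iff.2 hs
  simp only [coeffH, coeffA, coeffB, coeffX, Real.sinh_eq, Real.cosh_eq, hE, Real.exp_neg]
  set E := Real.exp s
  have h1 : E ^ 2 - 1 > 0 := by nlinarith
  have h2 : (E ^ 2) ^ 2 - 1 + 4 * E ^ 2 * s > 0 := by
    have : 0 < 4 * E ^ 2 * s := by positivity
    nlinarith
  have h3 : (E - E⁻¹) / 2 * ((E + E⁻¹) / 2) + s =
      ((E ^ 2) ^ 2 - 1 + 4 * E ^ 2 * s) / (4 * E ^ 2) := by field_simp; ring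
  have h4 : 2 * ((E + E⁻¹) / 2) = (E ^ 2 + 1) / E := by field_simp
  rw [h3, h4]
  obtain ⟨F, hF⟩ : ∃ F, F = (E ^ 2) ^ 2 - 1 + 4 * E ^ 2 * s := ⟨_, rfl⟩
  rw [← hF] at h2 ⊢
  norm_num
  field_simp
  rw [hF]
  ring

theorem coeffH_one_eq (hs : 0 < s) :
    coeffH s (Real.exp (2 * s)) 1 = Real.sinh s ^ 2 / (Real.sinh s * Real.cosh s + s) -
      Real.sinh s / (2 * Real.cosh s ^ 3) := by
  have hE : Real.exp (2 * s) = Real.exp s ^ 2 := by rw [← Real.exp_nat_mul]; norm_num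
  have hE1 : 1 < Real.exp s := Real.one_lt_exp_iff.2 hs
  have e1 : den (Real.exp s ^ 2) 1 = (Real.exp s ^ 4 - 1) / Real.exp s ^ 2 := by
    rw [den]; field_simp; push_cast; ring
  have e2 : den (Real.exp s ^ 2) 2 =
      (Real.exp s ^ 4 - 1) * (Real.exp s ^ 2 + 1) ^ 2 / (2 * Real.exp s ^ 4) := by
    rw [den]; field_simp; push_cast; ring
  simp only [coeffH, coeffA, coeffB, coeffX, Real.sinh_eq, Real.cosh_eq, hE, Real.exp_neg,
    Nat.reduceAdd, OfNat.ofNat_ne_zero, OfNat.ofNat_ne_one, one_ne_zero, if_false, e1, e2, numA,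
    numB]
  set E := Real.exp s
  have h1 : E ^ 4 - 1 > 0 := by
    have : 1 < E ^ 4 := one_lt_pow₀ hE1 (by norm_num)
    linarith
  have h2 : (E ^ 2) ^ 2 - 1 + 4 * E ^ 2 * s > 0 := by
    have : 0 < 4 * E ^ 2 * s := by positivity
    nlinarith
  have h3 : (E - E⁻¹) / 2 * ((E + E⁻¹) / 2) + s =
      ((E ^ 2) ^ 2 - 1 + 4 * E ^ 2 * s) / (4 * E ^ 2) := by field_simp; ring
  have h4 : ((E + E⁻¹) / 2) = (E ^ 2 + 1) / (2 * E) := by field_simp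
  rw [h3, h4]
  obtain ⟨F, hF⟩ : ∃ F, F = (E ^ 2) ^ 2 - 1 + 4 * E ^ 2 * s := ⟨_, rfl⟩
  rw [← hF] at h2 ⊢
  norm_num
  field_simp
  ring

/-- The leading terms s − s/2 − s/2 cancel, and by parity the next order is s³. The following mode
is similar, with two terms each close to half of sinh s. -/
theorem abs_coeffH_zero_le (hs : 0 < s) (hs1 : s ≤ 1 / 2) :
    |coeffH s (Real.exp (2 * s)) 0| ≤ 2 * s ^ 3 := by
  rw [coeffH_zero_eq hs]
  have h1 := sinh_le_mul_cosh hs.le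
  have h2 := Real.self_le_sinh_iff.2 hs.le
  have h3 := cosh_le_one_add_sq (abs_le.2 ⟨by linarith, by linarith⟩ : |s| ≤ 1)
  have h4 := Real.one_le_cosh s
  set S := Real.sinh s
  set c := Real.cosh s
  have hS : 0 < S := by linarith
  have e1 : S / (2 * c) ≤ s / 2 := by
    rw [div_le_div_iff₀ (by linarith) (by norm_num)]; linarith
  have e2 : s / 2 - s ^ 3 / 2 ≤ S / (2 * c) := by
    rw [le_div_iff₀ (by linarith)]
    have : (s - s ^ 3) * c ≤ s := by
      calc (s - s ^ 3) * c ≤ (s - s ^ 3) * (1 + s ^ 2) :=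
            mul_le_mul_of_nonneg_left h3 (by nlinarith [sq_nonneg s])
        _ ≤ s := by nlinarith [pow_pos hs 5]
    linarith
  have e3 : s ^ 2 / (S * c + s) ≤ s / 2 := by
    rw [div_le_div_iff₀ (by positivity) (by norm_num)]
    nlinarith
  have e4 : s / 2 - s ^ 3 ≤ s ^ 2 / (S * c + s) := by
    rw [le_div_iff₀ (by positivity)]
    have h5 : S * c ≤ s * (1 + s ^ 2) ^ 2 := by
      calc S * c ≤ s * c * c := by gcongr
        _ = s * c ^ 2 := by ring
        _ ≤ _ := by gcongr
    have h6 : 0 ≤ s / 2 - s ^ 3 := by nlinarith [sq_nonneg s]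
    calc (s / 2 - s ^ 3) * (S * c + s) ≤ (s / 2 - s ^ 3) * (s * (1 + s ^ 2) ^ 2 + s) := by gcongr
      _ ≤ s ^ 2 := by nlinarith [pow_pos hs 4, pow_pos hs 6, pow_pos hs 8]
  rw [abs_le]
  constructor <;> nlinarith [pow_pos hs 3]

theorem abs_coeffH_one_le (hs : 0 < s) (hs1 : s ≤ 1 / 2) :
    |coeffH s (Real.exp (2 * s)) 1| ≤ 3 * s ^ 3 := by
  rw [coeffH_one_eq hs]
  have h1 := sinh_le_mul_cosh hs.le
  have h2 := Real.self_le_sinh_iff.2 hs.le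
  have h3 := cosh_le_one_add_sq (abs_le.2 ⟨by linarith, by linarith⟩ : |s| ≤ 1)
  have h4 := Real.one_le_cosh s
  set S := Real.sinh s
  set c := Real.cosh s
  have hS : 0 < S := by linarith
  have hc : 0 < c := by linarith
  have hS2 : S ≤ 5 / 4 * s := by
    have : s * c ≤ s * (5 / 4) := by gcongr; nlinarith
    linarith
  have e1 : S ^ 2 / (S * c + s) ≤ S / 2 := by
    rw [div_le_div_iff₀ (by positivity) (by norm_num)]
    have : 2 * S ≤ S * c + s := by
      have h5 : S ≤ s * c := h1
      nlinarith [sq_nonneg (c - 1)]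
    nlinarith
  have e2 : S / 2 - S * s ^ 2 / 4 ≤ S ^ 2 / (S * c + s) := by
    rw [le_div_iff₀ (by positivity)]
    have h6 : 0 ≤ S / 2 - S * s ^ 2 / 4 := by nlinarith [sq_nonneg s]
    calc (S / 2 - S * s ^ 2 / 4) * (S * c + s)
        ≤ (S / 2 - S * s ^ 2 / 4) * (S * (1 + s ^ 2) + S) := by gcongr
      _ ≤ S ^ 2 := by nlinarith [mul_pos (pow_pos hS 2) (pow_pos hs 4)]
  have e3 : S / (2 * c ^ 3) ≤ S / 2 := by
    rw [div_le_div_iff₀ (by positivity) (by norm_num)]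
    have : 1 ≤ c ^ 3 := one_le_pow₀ h4
    nlinarith
  have e4 : S / 2 - 3 / 2 * S * s ^ 2 ≤ S / (2 * c ^ 3) := by
    rw [le_div_iff₀ (by positivity)]
    have h5 : c ^ 3 ≤ (1 + s ^ 2) ^ 3 := by gcongr
    have h7 : (1 - 3 * s ^ 2) * c ^ 3 ≤ 1 := by
      by_cases h8 : 0 ≤ 1 - 3 * s ^ 2
      · calc (1 - 3 * s ^ 2) * c ^ 3 ≤ (1 - 3 * s ^ 2) * (1 + s ^ 2) ^ 3 := by gcongr
          _ ≤ 1 := by nlinarith [pow_pos hs 4, pow_pos hs 6, pow_pos hs 8]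
      · have : 0 < c ^ 3 := by positivity
        nlinarith
    nlinarith
  have e5 : S * s ^ 2 ≤ 5 / 4 * s ^ 3 := by nlinarith [sq_nonneg s]
  rw [abs_le]
  constructor <;> nlinarith [pow_pos hs 3]

theorem exists_coeffH_bound : ∃ w : ℕ → ℝ, Summable w ∧ ∀ s : ℝ, 0 < s → s ≤ 1 / 2 → ∀ n : ℕ,
    |coeffH s (Real.exp (2 * s)) n| * (Real.exp (n * s) * (1 + n * s)) ≤ w n * (s * √s) := by
  -- At n = 0 the first summand is 0⁻¹ = 0, so the geometric summand is needed to give that mode a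
  -- positive weight.
  refine ⟨fun n => 144 * 24 ^ 4 * (((n : ℝ) ^ (3 / 2 : ℝ))⁻¹ + (1 / 2) ^ n), ?_, ?_⟩
  · exact ((Real.summable_nat_rpow_inv.2 (by norm_num)).add
      (summable_geometric_of_lt_one (by norm_num) (by norm_num))).mul_left _
  · intro s hs hs1 n
    have hss : 0 < √s := Real.sqrt_pos.2 hs
    have h1 : s ^ 3 ≤ s * √s := by
      have h2 : s ≤ √s := Real.le_sqrt_of_sq_le (by nlinarith)
      have h3 : s ^ 2 ≤ s := by nlinarith
      calc s ^ 3 = s * s ^ 2 := by ring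
        _ ≤ s * √s := by gcongr; linarith
    rcases n with _ | _ | n
    · have := abs_coeffH_zero_le hs hs1
      norm_num
      have : 0 ≤ s * √s := by positivity
      linarith
    · have h2 := abs_coeffH_one_le hs hs1
      have h3 : Real.exp (1 * s) * (1 + 1 * s) ≤ 6 := by
        have : Real.exp (1 * s) ≤ 3 :=
          (Real.exp_le_exp.2 (by linarith : 1 * s ≤ 1)).trans Real.exp_one_lt_three.le
        have h4 : 0 < Real.exp (1 * s) := Real.exp_pos _
        nlinarith
      have h4 : |coeffH s (Real.exp (2 * s)) 1| * (Real.exp (1 * s) * (1 + 1 * s)) ≤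
          3 * s ^ 3 * 6 := by
        gcongr
      have : 0 ≤ s * √s := by positivity
      norm_num at h4 ⊢
      linarith
    · have h2 := abs_coeffH_mul_le hs hs1 n
      refine h2.trans ?_
      have h3 : (0 : ℝ) ≤ (1 / 2) ^ (n + 1 + 1) := by positivity
      have h4 : 0 ≤ 144 * 24 ^ 4 * (s * √s) * (1 / 2) ^ (n + 1 + 1) := by positivity
      nlinarith

end

end

section

open Complex ComplexConjugate Topology

/-! ### The value of the clamped series at infinity -/

/-- The value of the clamped series at infinity, that is at `t = 1`. -/
def clampedLimit (s q : ℝ) : ℝ := ∑' n, (coeffA s q n + coeffB s q n)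

section

variable {s q : ℝ}

theorem summable_coeffA (s : ℝ) (hq : 1 < q) : Summable (coeffA s q) := by
  obtain ⟨M, hM⟩ := exists_coeffA_bound s hq
  have := hasSum_powerSeries (by linarith) hM (t := 1) (by simpa using hq)
  simp only [one_pow, mul_one] at this
  exact Complex.summable_ofReal.1 this.summable

theorem summable_coeffB (s : ℝ) (hq : 1 < q) : Summable (coeffB s q) := by
  obtain ⟨M, hM⟩ := exists_coeffB_bound s hq
  have := hasSum_powerSeries (by linarith) hM (t := 1) (by simpa using hq)
  simp only [one_pow, mul_one] at this
  exact Complex.summable_ofReal.1 this.summable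

theorem clampedSeries_one (hq : 1 < q) : clampedSeries s q 1 = clampedLimit s q := by
  rw [clampedSeries, laurent, inv_one, clampedLimit,
    (summable_coeffA s hq).tsum_add (summable_coeffB s hq), ofReal_add, ofReal_tsum, ofReal_tsum]
  simp [powerSeries]

theorem nat_mul_sinh_le (hs : 0 < s) {n : ℕ} (hn : 1 ≤ n) :
    n * Real.sinh s ≤ Real.sinh (n * s) := by
  have h1 : (1 : ℝ) ≤ n := by exact_mod_cast hn
  have h2 := mul_sinh_le_mul_sinh hs.le (by nlinarith : s ≤ n * s)
  have h3 : s * (n * Real.sinh s) ≤ s * Real.sinh (n * s) := by linarith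
  exact le_of_mul_le_mul_left h3 hs

theorem cosh_two_mul_sub_one (x : ℝ) : Real.cosh (2 * x) - 1 = 2 * Real.sinh x ^ 2 := by
  have h := Real.cosh_two_mul x
  have h2 := Real.cosh_sq x
  linarith

theorem sigma_sub_kappa_eq (hs : 0 < s) (n : ℕ) :
    sigma s n - n * kappa s n =
      2 * (Real.sinh (n * s) ^ 2 - (n * Real.sinh s) ^ 2) / den (Real.exp (2 * s)) n := by
  rw [sigma_eq hs, kappa_eq hs, show 2 * s * n = 2 * (n * s) by ring, cosh_two_mul_sub_one]
  ring

theorem sigma_sub_kappa_nonneg (hs : 0 < s) {n : ℕ} (hn : 1 ≤ n) :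
    0 ≤ sigma s n - n * kappa s n := by
  rw [sigma_sub_kappa_eq hs]
  have h1 := den_pos (Real.one_lt_exp_iff.2 (by linarith : 0 < 2 * s)) (by omega : n ≠ 0)
  have h2 := nat_mul_sinh_le hs hn
  have h3 := Real.sinh_pos_iff.2 hs
  have h4 : (n * Real.sinh s) ^ 2 ≤ Real.sinh (n * s) ^ 2 := by gcongr
  have h5 : 0 ≤ Real.sinh (n * s) ^ 2 - (n * Real.sinh s) ^ 2 := by linarith
  positivity

/-- Once ns ≥ 1, the cubic term of sinh makes n sinh s a definite fraction of sinh(ns): at most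
(17/16)/(7/6) = 51/56 of it. The difference of squares is then comparable to the denominator. -/
theorem le_sigma_sub_kappa (hs : 0 < s) (hs1 : s ≤ 1 / 4) {n : ℕ} (hn : 1 ≤ n * s) :
    1 / 25 ≤ sigma s n - n * kappa s n := by
  rw [sigma_sub_kappa_eq hs]
  have hn1 : 1 ≤ n := by
    rcases Nat.eq_zero_or_pos n with rfl | h
    · norm_num at hn
    · exact h
  have h1 := den_pos (Real.one_lt_exp_iff.2 (by linarith : 0 < 2 * s)) (by omega : n ≠ 0)
  have h2 := nat_mul_sinh_le (s := 2 * s) (by linarith) hn1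
  have h3 := den_eq hs n
  have h4 : Real.sinh (2 * s) / (2 * s) * (2 * s * n) = n * Real.sinh (2 * s) := by field_simp
  have h5 : Real.sinh (2 * s * n) = 2 * Real.sinh (n * s) * Real.cosh (n * s) := by
    rw [← Real.sinh_two_mul]; congr 1; ring
  have h6 := add_cube_le_sinh (x := n * s) (by linarith)
  have h7 := sinh_le_add_cube hs.le (by linarith)
  have h8 := cosh_sub_one_le_sinh (x := n * s) (by linarith)
  have h9 := Real.sinh_pos_iff.2 hs
  rw [h4] at h3
  rw [show (n : ℝ) * (2 * s) = 2 * s * n by ring] at h2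
  rw [h5] at h2 h3
  set x := n * s
  set S := Real.sinh x
  set c := Real.cosh x
  have hx3 : x ≤ x ^ 3 := by nlinarith [mul_nonneg (by linarith : 0 ≤ x) (by linarith : 0 ≤ x - 1)]
  have hS : 7 / 6 * x ≤ S := by linarith
  have hs3 : n * Real.sinh s ≤ 17 / 16 * x := by
    have : s ^ 3 ≤ s / 16 := by nlinarith [mul_pos hs hs]
    calc n * Real.sinh s ≤ n * (17 / 16 * s) := by gcongr; linarith
      _ = 17 / 16 * x := by ring
  have h10 : n * Real.sinh s ≤ 51 / 56 * S := by linarith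
  have h11 : (n * Real.sinh s) ^ 2 ≤ (51 / 56 * S) ^ 2 := by gcongr
  rw [div_le_div_iff₀ (by norm_num) h1]
  have h12 : den (Real.exp (2 * s)) n ≤ 4 * S * (S + 1) := by
    rw [h3]
    have : 2 * S * c ≤ 2 * S * (S + 1) := by
      have : 0 ≤ S := by linarith
      gcongr; linarith
    linarith
  nlinarith

theorem coeff_add_eq (hs : 0 < s) (n : ℕ) :
    coeffA s (Real.exp (2 * s)) (n + 2) + coeffB s (Real.exp (2 * s)) (n + 2) =
      (sigma s ((n + 2 : ℕ) : ℝ) - (n + 2 : ℕ) * kappa s ((n + 2 : ℕ) : ℝ) - 1) *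
        (2 / ((n + 1) * (n + 2) * (n + 3))) := by
  rw [coeffA_eq hs (by omega), coeffB_eq hs (by omega)]
  have h1 : (n : ℝ) + 1 ≠ 0 := by positivity
  have h2 : (n : ℝ) + 2 ≠ 0 := by positivity
  have h3 : (n : ℝ) + 3 ≠ 0 := by positivity
  push_cast
  have e1 : (n : ℝ) + 2 - 1 = n + 1 := by ring
  have e3 : (n : ℝ) + 2 + 1 = n + 3 := by ring
  rw [e1, e3]
  field_simp
  ring

theorem sum_two_coeff_ge (hs : 0 < s) :
    1 / 2 ≤ ∑ n ∈ Finset.range 2, (coeffA s (Real.exp (2 * s)) n + coeffB s (Real.exp (2 * s)) n) := by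
  have hE : Real.exp (2 * s) = Real.exp s ^ 2 := by rw [← Real.exp_nat_mul]; norm_num
  have hE1 : 1 < Real.exp s := Real.one_lt_exp_iff.2 hs
  have e1 : den (Real.exp s ^ 2) 1 = (Real.exp s ^ 4 - 1) / Real.exp s ^ 2 := by
    rw [den]; field_simp; push_cast; ring
  have h1 := sinh_le_mul_cosh hs.le
  have h2 := Real.self_le_sinh_iff.2 hs.le
  rw [Real.sinh_eq, Real.exp_neg] at h1 h2
  rw [Real.cosh_eq, Real.exp_neg] at h1
  rw [Finset.sum_range_succ, Finset.sum_range_one, hE]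
  set E := Real.exp s
  have h4 : E ^ 4 - 1 > 0 := by
    have : 1 < E ^ 4 := one_lt_pow₀ hE1 (by norm_num)
    linarith
  have a1 : coeffA s (E ^ 2) 1 = 1 / (E ^ 2 + 1) := by
    rw [coeffA, if_neg one_ne_zero, e1, numA]
    field_simp
    push_cast
    ring
  have h5 : (E ^ 2 - 1) / (E ^ 2 + 1) ≤ s := by
    rw [div_le_iff₀ (by positivity)]
    have : E - E⁻¹ ≤ s * (E + E⁻¹) := by linarith
    have := mul_le_mul_of_nonneg_left this (by linarith : 0 ≤ E)
    have e : E * E⁻¹ = 1 := mul_inv_cancel₀ (by linarith)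
    nlinarith
  have h6 : 0 ≤ ((E ^ 2 - 1) ^ 2 - 4 * E ^ 2 * s ^ 2) / ((E ^ 2) ^ 2 - 1 + 4 * E ^ 2 * s) := by
    have h7 : 2 * s * E ≤ E ^ 2 - 1 := by
      have := mul_le_mul_of_nonneg_left h2 (by linarith : 0 ≤ E)
      have e : E * E⁻¹ = 1 := mul_inv_cancel₀ (by linarith)
      nlinarith
    have h8 : 0 < 2 * s * E := by positivity
    have h9 : (2 * s * E) ^ 2 ≤ (E ^ 2 - 1) ^ 2 := by gcongr
    have h10 : 0 < 4 * E ^ 2 * s := by positivity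
    exact div_nonneg (by nlinarith) (by nlinarith)
  have h7 : 1 / (E ^ 2 + 1) = 1 / 2 - (E ^ 2 - 1) / (2 * (E ^ 2 + 1)) := by field_simp; ring
  have h8 : (E ^ 2 - 1) / (E ^ 2 + 1) = 2 * ((E ^ 2 - 1) / (2 * (E ^ 2 + 1))) := by field_simp
  rw [a1, h7]
  simp only [coeffA, coeffB, if_true, one_ne_zero, if_false]
  linarith

/-- Because σ − nκ ≥ 0, each new mode lowers the partial sum by at most 2/((m + 1)(m + 2)(m + 3)).
These losses telescope and exhaust the initial 1/2 exactly, so this bound alone gives no positive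
limit. -/
theorem le_sum_coeff (hs : 0 < s) (m : ℕ) :
    1 / (((m : ℝ) + 1) * (m + 2)) ≤ ∑ n ∈ Finset.range (m + 2),
      (coeffA s (Real.exp (2 * s)) n + coeffB s (Real.exp (2 * s)) n) := by
  induction m with
  | zero => simpa using sum_two_coeff_ge hs
  | succ m ih =>
    rw [Finset.sum_range_succ, coeff_add_eq hs m]
    have h1 := sigma_sub_kappa_nonneg hs (by omega : 1 ≤ m + 2)
    have h2 : 0 < 2 / (((m : ℝ) + 1) * (m + 2) * (m + 3)) := by positivity
    have h3 : 1 / ((((m + 1 : ℕ) : ℝ) + 1) * ((m + 1 : ℕ) + 2)) =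
        1 / (((m : ℝ) + 1) * (m + 2)) - 2 / (((m : ℝ) + 1) * (m + 2) * (m + 3)) := by
      push_cast
      field_simp
      ring
    rw [h3]
    nlinarith

/-- Beyond mode 1/s the gap σ − nκ ≥ 1/25 means that only the fraction 24/25 of the telescoping loss
occurs. The recovered part is 1/25 of what was left at the index k. -/
theorem le_sum_coeff_add (hs : 0 < s) (hs1 : s ≤ 1 / 4) {k : ℕ} (hk : 1 ≤ (k + 2) * s) (j : ℕ) :
    1 / (((k + j : ℕ) + 1 : ℝ) * ((k + j : ℕ) + 2)) + 1 / 25 * (1 / (((k : ℝ) + 1) * (k + 2)) -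
      1 / (((k + j : ℕ) + 1 : ℝ) * ((k + j : ℕ) + 2))) ≤ ∑ n ∈ Finset.range (k + j + 2),
      (coeffA s (Real.exp (2 * s)) n + coeffB s (Real.exp (2 * s)) n) := by
  induction j with
  | zero => simpa using le_sum_coeff hs k
  | succ j ih =>
    rw [← add_assoc, show k + j + 1 + 2 = (k + j + 2) + 1 by ring, Finset.sum_range_succ,
      coeff_add_eq hs (k + j)]
    have h1 := le_sigma_sub_kappa hs hs1 (n := k + j + 2) (by
      push_cast
      have : (0 : ℝ) ≤ j * s := by positivity
      linarith)
    generalize k + j = m at *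
    have h2 : 0 < 2 / (((m : ℝ) + 1) * (m + 2) * (m + 3)) := by positivity
    have h3 : 1 / ((((m + 1 : ℕ) : ℝ) + 1) * ((m + 1 : ℕ) + 2)) =
        1 / (((m : ℝ) + 1) * (m + 2)) - 2 / (((m : ℝ) + 1) * (m + 2) * (m + 3)) := by
      push_cast
      field_simp
      ring
    rw [h3]
    nlinarith

/-- This number is the denominator of the amplitude with which the clamped flow enters. The order
s², obtained by starting the gain at k close to 1/s, balances the factor (q − 1)² in the numerator.
-/
theorem le_clampedLimit (hs : 0 < s) (hs1 : s ≤ 1 / 4) :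
    s ^ 2 / 150 ≤ clampedLimit s (Real.exp (2 * s)) := by
  have hq : 1 < Real.exp (2 * s) := Real.one_lt_exp_iff.2 (by linarith)
  have hsum := ((summable_coeffA s hq).add (summable_coeffB s hq)).hasSum.tendsto_sum_nat
  have hk1 : (⌊1 / s⌋₊ : ℝ) ≤ 1 / s := Nat.floor_le (by positivity)
  have hk2 : 1 / s < ⌊1 / s⌋₊ + 1 := Nat.lt_floor_add_one _
  set k := ⌊1 / s⌋₊
  have hk3 : 1 ≤ ((k : ℝ) + 2) * s := by
    have := (div_lt_iff₀ hs).1 hk2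
    linarith
  have h1 : ∀ j : ℕ, 1 / 25 * (1 / (((k : ℝ) + 1) * (k + 2))) ≤ ∑ n ∈ Finset.range (j + (k + 2)),
      (coeffA s (Real.exp (2 * s)) n + coeffB s (Real.exp (2 * s)) n) := by
    intro j
    have h2 := le_sum_coeff_add hs hs1 hk3 j
    rw [show j + (k + 2) = k + j + 2 by ring]
    have h3 : 0 < 1 / (((k + j : ℕ) + 1 : ℝ) * ((k + j : ℕ) + 2)) := by positivity
    linarith
  have h2 := ge_of_tendsto' ((tendsto_add_atTop_iff_nat (k + 2)).2 hsum) h1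
  refine le_trans ?_ h2
  have hks : (k : ℝ) * s ≤ 1 := by rwa [le_div_iff₀ hs] at hk1
  -- Together with the gap 1/25 this crude 6 gives the constant 150.
  have h4 : (((k : ℝ) + 1) * (k + 2)) * s ^ 2 ≤ 6 := by nlinarith
  rw [mul_one_div, div_div, div_le_div_iff₀ (by norm_num) (by positivity)]
  nlinarith

/-! ### The pressure of the clamped flow as a series -/

theorem exists_nat_mul_coeff_bound {c : ℕ → ℝ} {M r : ℝ} (hq : 0 < q)
    (hc : ∀ n, |c n| * q ^ n ≤ M) (hr : 0 ≤ r) (hrq : r < q) :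
    ∃ M', 0 ≤ M' ∧ ∀ n : ℕ, ((n : ℝ) + 1) * (|c n| * r ^ n) ≤ M' := by
  have hs := summable_mul_coeff hq hc hr hrq
  have hM : 0 ≤ M := le_trans (by positivity) (hc 0)
  refine ⟨(∑' n : ℕ, (n : ℝ) * (|c n| * r ^ n)) + M,
    add_nonneg (tsum_nonneg fun n => by positivity) hM, fun n => ?_⟩
  have h1 := hs.le_tsum n (fun j _ => by positivity)
  have h2 : |c n| * r ^ n ≤ M := le_trans (by gcongr) (hc n)
  linarith

/-- A qualitative bound, with M depending on s, which only justifies termwise differentiation beyond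
|t| = eˢ. The factors n in `coeffH` cost an arbitrarily small part of the radius q. -/
theorem exists_coeffH_radius (hs : 0 < s) {r : ℝ} (hr : 1 < r) (hrq : r < Real.exp (2 * s)) :
    ∃ M, ∀ n, |coeffH s (Real.exp (2 * s)) n| * r ^ n ≤ M := by
  have hq : 1 < Real.exp (2 * s) := Real.one_lt_exp_iff.2 (by linarith)
  set q := Real.exp (2 * s)
  obtain ⟨M, hM⟩ := exists_coeffA_bound s hq
  obtain ⟨N, hN⟩ := exists_coeffB_bound s hq
  obtain ⟨M', hM0, hM'⟩ := exists_nat_mul_coeff_bound (by linarith) hM (by linarith) hrq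
  obtain ⟨N', hN0, hN'⟩ := exists_nat_mul_coeff_bound (by linarith) hN (by linarith) hrq
  refine ⟨M' + r * M' + N' + N' + |coeffX s q| * r, fun n => ?_⟩
  have hrn : 0 < r ^ n := by positivity
  have t1 : |((n : ℝ) + 1) * coeffA s q n| * r ^ n ≤ M' := by
    rw [abs_mul, abs_of_nonneg (by positivity), mul_assoc]; exact hM' n
  have t2 : |((n - 1 : ℕ) : ℝ) * coeffA s q (n - 1)| * r ^ n ≤ r * M' := by
    rw [abs_mul, abs_of_nonneg (by positivity)]
    rcases n with _ | n
    · simp; positivity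
    · rw [Nat.add_sub_cancel, pow_succ]
      have h1 := hM' n
      have h2 : 0 ≤ |coeffA s q n| * r ^ n := by positivity
      calc (n : ℝ) * |coeffA s q n| * (r ^ n * r) = r * (n * (|coeffA s q n| * r ^ n)) := by ring
        _ ≤ r * M' := by gcongr; linarith
  have t3 : |((n : ℝ) + 1) * coeffB s q (n + 1)| * r ^ n ≤ N' := by
    rw [abs_mul, abs_of_nonneg (by positivity)]
    have h1 := hN' (n + 1)
    rw [pow_succ] at h1
    push_cast at h1
    have h2 : 0 ≤ |coeffB s q (n + 1)| * r ^ n := by positivity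
    calc ((n : ℝ) + 1) * |coeffB s q (n + 1)| * r ^ n
        = ((n : ℝ) + 1) * (|coeffB s q (n + 1)| * r ^ n) * 1 := by ring
      _ ≤ ((n : ℝ) + 1 + 1) * (|coeffB s q (n + 1)| * r ^ n) * r := by gcongr; linarith
      _ = ((n : ℝ) + 1 + 1) * (|coeffB s q (n + 1)| * (r ^ n * r)) := by ring
      _ ≤ N' := h1
  have t4 : |((n : ℝ) - 1) * coeffB s q n| * r ^ n ≤ N' := by
    have h3 : |(n : ℝ) - 1| ≤ n + 1 := by
      have : (0 : ℝ) ≤ n := Nat.cast_nonneg n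
      rw [abs_le]; constructor <;> linarith
    rw [abs_mul, mul_assoc]
    exact (mul_le_mul_of_nonneg_right h3 (by positivity)).trans (hN' n)
  have t5 : |if n = 0 then coeffX s q else if n = 1 then -coeffX s q else 0| * r ^ n ≤
      |coeffX s q| * r := by
    rcases n with _ | _ | n
    · simp
      exact le_mul_of_one_le_right (abs_nonneg _) hr.le
    · simp
    · simp
      positivity
  have t6 : |coeffH s q n| ≤ |((n : ℝ) + 1) * coeffA s q n| +
      |((n - 1 : ℕ) : ℝ) * coeffA s q (n - 1)| + |((n : ℝ) + 1) * coeffB s q (n + 1)| +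
      |((n : ℝ) - 1) * coeffB s q n| +
      |if n = 0 then coeffX s q else if n = 1 then -coeffX s q else 0| := by
    rw [coeffH]
    refine (abs_add_le _ _).trans (add_le_add ?_ le_rfl)
    refine (abs_sub _ _).trans (add_le_add ?_ le_rfl)
    refine (abs_add_le _ _).trans (add_le_add ?_ le_rfl)
    exact abs_sub _ _
  calc _ ≤ _ * r ^ n := mul_le_mul_of_nonneg_right t6 hrn.le
    _ ≤ _ := by linarith

/-- Invariance of Π under inversion allows it to be split as f(t) + f(t⁻¹), up to the factor k, with
f a power series. The present sum is f. -/
theorem hasSum_coeffH (hq : 1 < q) {t : ℂ} (ht0 : t ≠ 0) (ht : ‖t‖ < q) :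
    HasSum (fun n => (coeffH s q n : ℂ) * t ^ n)
      (powerSeries (coeffA s q) t + powerSeries (coeffB s q) t -
        (t - 1) * (t * deriv (powerSeries (coeffA s q)) t + deriv (powerSeries (coeffB s q)) t) +
        coeffX s q * (1 - t)) := by
  obtain ⟨M, hM⟩ := exists_coeffA_bound s hq
  obtain ⟨N, hN⟩ := exists_coeffB_bound s hq
  have hq0 : 0 < q := by linarith
  have a0 := hasSum_powerSeries hq0 hM ht
  have b0 := hasSum_powerSeries hq0 hN ht
  have da := hasSum_mul_deriv_powerSeries hq0 hM ht
  have db := hasSum_mul_deriv_powerSeries hq0 hN ht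
  -- Truncated subtraction makes the n = 0 term of the shifted series zero, so the shift introduces
  -- no boundary term.
  have sa : HasSum (fun n : ℕ => ((n - 1 : ℕ) : ℂ) * (coeffA s q (n - 1) * t ^ n))
      (t * (t * deriv (powerSeries (coeffA s q)) t)) := by
    refine ((hasSum_nat_add_iff' (f := fun n : ℕ =>
      ((n - 1 : ℕ) : ℂ) * (coeffA s q (n - 1) * t ^ n)) 1).1 ?_)
    simp only [Finset.sum_range_one, Nat.zero_sub, Nat.cast_zero, zero_mul, sub_zero,
      Nat.add_sub_cancel]
    refine (da.mul_left t).congr_fun fun n => ?_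
    rw [pow_succ]; ring
  have sb : HasSum (fun n : ℕ => ((n : ℂ) + 1) * (coeffB s q (n + 1) * t ^ n))
      (deriv (powerSeries (coeffB s q)) t) := by
    have h1 := ((hasSum_nat_add_iff' 1).2 db).mul_left t⁻¹
    simp only [Finset.sum_range_one, Nat.cast_zero, zero_mul, sub_zero, Nat.cast_add,
      Nat.cast_one] at h1
    rw [inv_mul_cancel_left₀ ht0] at h1
    refine h1.congr_fun fun n => ?_
    rw [pow_succ]; field_simp
  have sx : HasSum (fun n : ℕ => ((if n = 0 then coeffX s q else if n = 1 then -coeffX s q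
      else 0 : ℝ) : ℂ) * t ^ n) (coeffX s q * (1 - t)) := by
    have h1 : HasSum (fun n : ℕ => ((if n = 0 then coeffX s q else if n = 1 then -coeffX s q
      else 0 : ℝ) : ℂ) * t ^ n) (∑ n ∈ Finset.range 2, ((if n = 0 then coeffX s q else
        if n = 1 then -coeffX s q else 0 : ℝ) : ℂ) * t ^ n) :=
      hasSum_sum_of_ne_finset_zero (fun n hn => by
        have : 1 < n := by simpa using hn
        rw [if_neg (by omega), if_neg (by omega)]; simp)
    have e : coeffX s q * (1 - t) = ∑ n ∈ Finset.range 2, ((if n = 0 then coeffX s q else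
        if n = 1 then -coeffX s q else 0 : ℝ) : ℂ) * t ^ n := by
      simp [Finset.sum_range_succ]
      ring
    rw [e]
    exact h1
  have h := (((((a0.add da).sub sa).add sb).add b0).sub db).add sx
  have e : powerSeries (coeffA s q) t + t * deriv (powerSeries (coeffA s q)) t -
      t * (t * deriv (powerSeries (coeffA s q)) t) + deriv (powerSeries (coeffB s q)) t +
      powerSeries (coeffB s q) t - t * deriv (powerSeries (coeffB s q)) t +
      coeffX s q * (1 - t) =
      powerSeries (coeffA s q) t + powerSeries (coeffB s q) t -
        (t - 1) * (t * deriv (powerSeries (coeffA s q)) t + deriv (powerSeries (coeffB s q)) t) +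
        coeffX s q * (1 - t) := by ring
  rw [← e]
  refine h.congr_fun fun n => ?_
  simp only [coeffH]
  push_cast
  ring

/-- The pressure function of the clamped flow as a Laurent series. -/
theorem flowPi_clamped {a : ℝ} (ha : a ≠ 0) (hq : 1 < q) {t : ℂ} (ht : t ∈ annulus q) :
    flowPi a (coeffX s q / a) 0 (1 / (4 * a ^ 2)) (clampedSeries s q) t =
      1 / (4 * a ^ 2) * (powerSeries (coeffH s q) t + powerSeries (coeffH s q) t⁻¹) := by
  obtain ⟨M, hM⟩ := exists_coeffA_bound s hq
  obtain ⟨N, hN⟩ := exists_coeffB_bound s hq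
  have hq0 : 0 < q := by linarith
  have ht0 := ne_zero_of_mem_annulus hq0 ht
  have h1 : powerSeries (coeffH s q) t = _ := (hasSum_coeffH (s := s) hq ht0 ht.2).tsum_eq
  have h2 : powerSeries (coeffH s q) t⁻¹ = _ := (hasSum_coeffH (s := s) hq (inv_ne_zero ht0)
    (norm_inv_lt_of_mem_annulus hq0 ht)).tsum_eq
  have d1 := (hasDerivAt_laurent hq0 hM hN ht).deriv
  have d2 := (hasDerivAt_laurent hq0 hM hN (inv_mem_annulus hq0 ht)).deriv
  have hac : (a : ℂ) ≠ 0 := ofReal_ne_zero.2 ha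
  rw [h1, h2, flowPi, clampedSeries, d1, d2, inv_inv, laurent, laurent,
    inv_inv]
  push_cast
  field_simp
  ring

end

end

section

open Complex ComplexConjugate Topology

/-! ### The derivative of the flow in bipolar coordinates -/

/-- The inverse of the bipolar coordinate. -/
def bipolarInv (a : ℝ) (t : ℂ) : ℂ := a * (t + 1) / (t - 1)

/-- The function `L' + J - z Π'`, in the bipolar coordinate. -/
def flowN (a c r k l : ℝ) (A : ℂ → ℂ) (t : ℂ) : ℂ :=
  -(t - 1) ^ 2 / (2 * a) * deriv (flowL a c k l A) t + flowJ a c t +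
    (t ^ 2 - 1) / 2 * deriv (flowPi a c r k A) t

/-- The conjugate of the derivative of the flow with respect to `z̄`. -/
def flowQ (a c r k l : ℝ) (A : ℂ → ℂ) (z : ℂ) : ℂ :=
  flowN a c r k l A (bipolar a z) +
    2 * z.re * (deriv (flowPi a c r k A) (bipolar a z) * (-(2 * a) / (z - a) ^ 2))

section

variable {a c r k l s q : ℝ} {t z : ℂ} {A : ℂ → ℂ}

theorem bipolarInv_sub (ht : t ≠ 1) : bipolarInv a t - a = 2 * a / (t - 1) := by
  have : t - 1 ≠ 0 := sub_ne_zero.2 ht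
  rw [bipolarInv]; field_simp; ring

theorem bipolar_bipolarInv (ha : a ≠ 0) (ht : t ≠ 1) : bipolar a (bipolarInv a t) = t := by
  have h1 : t - 1 ≠ 0 := sub_ne_zero.2 ht
  have hac : (a : ℂ) ≠ 0 := ofReal_ne_zero.2 ha
  rw [bipolar, bipolarInv_sub ht, bipolarInv]
  field_simp
  ring

theorem hasDerivAt_bipolarInv (ht : t ≠ 1) :
    HasDerivAt (bipolarInv a) (-(2 * a) / (t - 1) ^ 2) t := by
  have h1 : t - 1 ≠ 0 := sub_ne_zero.2 ht
  refine ((((hasDerivAt_id t).add_const (1 : ℂ)).const_mul (a : ℂ)).div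
    ((hasDerivAt_id t).sub_const 1) h1).congr_deriv ?_
  simp
  ring

theorem differentiableOn_flowN (ha : a ≠ 0) (hq : 0 < q)
    (hA : DifferentiableOn ℂ A (annulus q)) :
    DifferentiableOn ℂ (flowN a c r k l A) (annulus q) := by
  have d1 := (differentiableOn_flowL (a := a) (c := c) (k := k) (l := l) hq hA).deriv
    (isOpen_annulus q)
  have d2 := (differentiableOn_flowPi (c := c) (r := r) (k := k) ha hq hA).deriv (isOpen_annulus q)
  have d3 := differentiableOn_flowJ (c := c) ha hq
  have d4 : DifferentiableOn ℂ (fun t : ℂ => -(t - 1) ^ 2 / (2 * (a : ℂ))) (annulus q) := by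
    fun_prop
  have d5 : DifferentiableOn ℂ (fun t : ℂ => (t ^ 2 - 1) / 2) (annulus q) := by fun_prop
  exact ((d4.mul d1).add d3).add (d5.mul d2)

/-- Writing z̄ = 2 Re z − z in J + z̄Π' + L' separates the holomorphic function N from the remainder
2 Re z · Π', with Π' the derivative in z. -/
theorem hasFDerivAt_flowV (ha : a ≠ 0) (hq : 0 < q) (hA : DifferentiableOn ℂ A (annulus q))
    (hz : z ∈ bipolarDomain a q) :
    HasFDerivAt (flowV a c r k l A)
      (wirtinger (flowPi a c r k A (bipolar a z) + conj (flowPi a c r k A (bipolar a z)))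
        (conj (flowQ a c r k l A z))) z := by
  have hs := sub_ne_zero_of_mem_bipolarDomain hq hz
  have hnhds := (isOpen_annulus q).mem_nhds hz
  have d1 := (((differentiableOn_flowL (a := a) (c := c) (k := k) (l := l) hq
    hA).differentiableAt hnhds).hasDerivAt).comp z (hasDerivAt_bipolar hs)
  have d2 := (((differentiableOn_flowPi (c := c) (r := r) (k := k) ha hq
    hA).differentiableAt hnhds).hasDerivAt).comp z (hasDerivAt_bipolar hs)
  refine (hasFDerivAt_goursat (hasFDerivAt_flowG ha hq hA hz) d2 d1).congr_fderiv ?_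
  congr 2
  have hac : (a : ℂ) ≠ 0 := ofReal_ne_zero.2 ha
  have h1 : (2 : ℂ) * z.re = z + conj z := (add_conj z).symm ▸ by push_cast; ring
  rw [flowQ, flowN, h1]
  have h2 : -(bipolar a z - 1) ^ 2 / (2 * a) = -(2 * a) / (z - a) ^ 2 := by
    rw [bipolar_sub_one hs]; field_simp
  have h3 : (bipolar a z ^ 2 - 1) / 2 = -z * (-(2 * a) / (z - a) ^ 2) := by
    rw [bipolar]; field_simp; ring
  rw [h2, h3]
  ring

/-- Since |t|² − 1 = 4a Re z/|z − a|², the non-holomorphic coefficient in Q depends only on |t|. In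
particular it remains bounded at infinity and is O(s) on the annulus. -/
theorem norm_re_mul_eq (ha : 0 < a) (hz : z - a ≠ 0) :
    ‖2 * (z.re : ℂ) * (-(2 * a) / (z - a) ^ 2)‖ = |‖bipolar a z‖ ^ 2 - 1| := by
  have h0 : 0 < ‖z - a‖ ^ 2 := by positivity
  have h1 : ‖bipolar a z‖ ^ 2 - 1 = 4 * a * z.re / ‖z - a‖ ^ 2 := by
    rw [norm_bipolar_sq]
    field_simp
    rw [← normSq_eq_norm_sq, ← normSq_eq_norm_sq, normSq_apply, normSq_apply]
    simp
    ring
  rw [h1, abs_div, abs_of_pos h0, abs_mul, abs_of_pos (by linarith : 0 < 4 * a), norm_mul,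
    norm_div, norm_neg, norm_mul, norm_mul, norm_pow, norm_real, norm_real, Real.norm_eq_abs,
    Real.norm_eq_abs, abs_of_pos ha]
  norm_num
  ring

theorem norm_flowQ_le (ha : 0 < a) (hz : z - a ≠ 0) :
    ‖flowQ a c r k l A z‖ ≤ ‖flowN a c r k l A (bipolar a z)‖ +
      |‖bipolar a z‖ ^ 2 - 1| * ‖deriv (flowPi a c r k A) (bipolar a z)‖ := by
  rw [flowQ]
  refine (norm_add_le _ _).trans (add_le_add le_rfl (le_of_eq ?_))
  rw [← norm_re_mul_eq ha hz, ← norm_mul]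
  congr 1
  ring

theorem norm_flowN_le (ha : 0 < a) (hz : z - a ≠ 0) :
    ‖flowN a c r k l A (bipolar a z)‖ ≤ ‖flowQ a c r k l A z‖ +
      |‖bipolar a z‖ ^ 2 - 1| * ‖deriv (flowPi a c r k A) (bipolar a z)‖ := by
  have h1 : flowN a c r k l A (bipolar a z) = flowQ a c r k l A z -
      2 * (z.re : ℂ) * (-(2 * a) / (z - a) ^ 2) * deriv (flowPi a c r k A) (bipolar a z) := by
    rw [flowQ]; ring
  rw [h1]
  refine (norm_sub_le _ _).trans (add_le_add le_rfl (le_of_eq ?_))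
  rw [norm_mul, norm_re_mul_eq ha hz]

/-- If the flow vanishes on a coordinate circle, its two Wirtinger derivatives have the same
modulus there. -/
theorem norm_flowQ_eq_of_vanish {ρ : ℝ} (ha : 0 < a) (hq : 1 < q)
    (hA : DifferentiableOn ℂ A (annulus q)) (ht : t ∈ annulus q) (ht1 : t ≠ 1) (htρ : ‖t‖ = ρ)
    (hV : ∀ z ∈ bipolarDomain a q, ‖bipolar a z‖ = ρ → flowV a c r k l A z = 0) :
    ‖flowQ a c r k l A (bipolarInv a t)‖ ≤ 2 * ‖flowPi a c r k A t‖ := by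
  have hq0 : 0 < q := by linarith
  have hbt := bipolar_bipolarInv ha.ne' ht1
  have hz : bipolarInv a t ∈ bipolarDomain a q := by
    rw [bipolarDomain, Set.mem_preimage, hbt]; exact ht
  have hd := hasFDerivAt_flowV (c := c) (r := r) (k := k) (l := l) ha.ne' hq0 hA hz
  have hγ : HasDerivAt (fun θ : ℝ => t * Complex.exp (θ * I)) (t * I) 0 := by
    have h1 : HasDerivAt (fun θ : ℂ => t * Complex.exp (θ * I)) (t * I) ((0 : ℝ) : ℂ) := by
      refine ((((hasDerivAt_id _).mul_const I).cexp).const_mul t).congr_deriv ?_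
      simp
    exact h1.comp_ofReal
  have hγ0 : t * Complex.exp (((0 : ℝ) : ℂ) * I) = t := by simp
  have hd2 : HasDerivAt (bipolarInv a) (-(2 * a) / (t - 1) ^ 2)
      (t * Complex.exp (((0 : ℝ) : ℂ) * I)) := by
    rw [hγ0]; exact hasDerivAt_bipolarInv ht1
  have hd3 := hd2.comp (0 : ℝ) hγ
  have hd' : HasFDerivAt (flowV a c r k l A)
      (wirtinger (flowPi a c r k A (bipolar a (bipolarInv a t)) +
        conj (flowPi a c r k A (bipolar a (bipolarInv a t))))
        (conj (flowQ a c r k l A (bipolarInv a t))))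
      (bipolarInv a (t * Complex.exp (((0 : ℝ) : ℂ) * I))) := by
    rw [hγ0]; exact hd
  have hd4 := hd'.comp_hasDerivAt (0 : ℝ) hd3
  have hzero : (flowV a c r k l A ∘ (bipolarInv a ∘ fun θ : ℝ => t * Complex.exp (θ * I)))
      =ᶠ[𝓝 0] fun _ => 0 := by
    have hne : ∀ᶠ θ : ℝ in 𝓝 0, t * Complex.exp (θ * I) ≠ 1 := by
      refine hγ.continuousAt.eventually_ne ?_
      rw [hγ0]; exact ht1
    filter_upwards [hne] with θ hθ
    have hn : ‖t * Complex.exp (θ * I)‖ = ‖t‖ := by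
      rw [norm_mul, norm_exp_ofReal_mul_I, mul_one]
    have hb := bipolar_bipolarInv ha.ne' hθ
    refine hV _ ?_ ?_
    · rw [bipolarDomain, Set.mem_preimage, Function.comp_apply, hb]
      exact ⟨hn ▸ ht.1, hn ▸ ht.2⟩
    · rw [Function.comp_apply, hb, hn, htρ]
  -- V is constant along the circle, so its derivative in the tangent direction w vanishes: 2 Re Π ·
  -- w + Q̄ w̄ = 0. Taking moduli gives |Q| = 2|Re Π|.
  have hd5 := hd4.unique ((hasDerivAt_const (0 : ℝ) (0 : ℂ)).congr_of_eventuallyEq hzero)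
  rw [wirtinger_apply, hbt] at hd5
  set w := -(2 * (a : ℂ)) / (t - 1) ^ 2 * (t * I)
  have hw : w ≠ 0 := by
    have h1 : t - 1 ≠ 0 := sub_ne_zero.2 ht1
    have h2 : (a : ℂ) ≠ 0 := ofReal_ne_zero.2 ha.ne'
    exact mul_ne_zero (div_ne_zero (neg_ne_zero.2 (mul_ne_zero two_ne_zero h2))
      (pow_ne_zero 2 h1)) (mul_ne_zero (ne_zero_of_mem_annulus hq0 ht) I_ne_zero)
  have h6 : ‖conj (flowQ a c r k l A (bipolarInv a t)) * conj w‖ =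
      ‖(flowPi a c r k A t + conj (flowPi a c r k A t)) * w‖ := by
    rw [← norm_neg]
    congr 1
    linear_combination -hd5
  rw [norm_mul, norm_mul, RCLike.norm_conj, RCLike.norm_conj] at h6
  rw [mul_right_cancel₀ (norm_ne_zero_iff.2 hw) h6]
  refine (norm_add_le _ _).trans (le_of_eq ?_)
  rw [RCLike.norm_conj]
  ring

/-! ### Estimates for the clamped flow -/

/-- N is holomorphic on the closed annulus, including t = 1, so it suffices to bound it on the two
circles. There |N| ≤ |Q| + M ≤ 2|Π| + M ≤ 3M by the vanishing of V. No series expansion of the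
strain has to be estimated. -/
theorem norm_flowN_le_of_circles (ha : 0 < a) (hs : 0 < s) {M : ℝ} (hqs : Real.exp s < q)
    (hA : DifferentiableOn ℂ A (annulus q))
    (hV : ∀ z ∈ bipolarDomain a q, ‖bipolar a z‖ = Real.exp s → flowV a c r k l A z = 0)
    (hP : ∀ t : ℂ, (Real.exp s)⁻¹ ≤ ‖t‖ → ‖t‖ ≤ Real.exp s → ‖flowPi a c r k A t‖ ≤ M)
    (hD : ∀ t : ℂ, (Real.exp s)⁻¹ ≤ ‖t‖ → ‖t‖ ≤ Real.exp s →
      |‖t‖ ^ 2 - 1| * ‖deriv (flowPi a c r k A) t‖ ≤ M)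
    (ht1 : (Real.exp s)⁻¹ ≤ ‖t‖) (ht2 : ‖t‖ ≤ Real.exp s) :
    ‖flowN a c r k l A t‖ ≤ 3 * M := by
  have he : 1 < Real.exp s := Real.one_lt_exp_iff.2 hs
  have he' : (Real.exp s)⁻¹ < 1 := inv_lt_one_of_one_lt₀ he
  have hq1 : 1 < q := he.trans hqs
  have hqi : q⁻¹ < (Real.exp s)⁻¹ := inv_strictAnti₀ (by linarith) hqs
  have hsub : {t : ℂ | (Real.exp s)⁻¹ ≤ ‖t‖ ∧ ‖t‖ ≤ Real.exp s} ⊆ annulus q := fun t ht =>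
    ⟨hqi.trans_le ht.1, ht.2.trans_lt hqs⟩
  have hcl : closure (annulus (Real.exp s)) ⊆
      {t : ℂ | (Real.exp s)⁻¹ ≤ ‖t‖ ∧ ‖t‖ ≤ Real.exp s} :=
    closure_minimal (fun t ht => ⟨ht.1.le, ht.2.le⟩)
      ((isClosed_le continuous_const continuous_norm).inter
        (isClosed_le continuous_norm continuous_const))
  have hV' : ∀ z ∈ bipolarDomain a q, ‖bipolar a z‖ = (Real.exp s)⁻¹ →
      flowV a c r k l A z = 0 := by
    intro z hz hn
    have h1 := hV (-z) (neg_mem_bipolarDomain (by linarith) hz) (by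
      rw [bipolar_neg, norm_inv, hn, inv_inv])
    rw [flowV_neg (by linarith) hz] at h1
    simpa using h1
  have hbd : ∀ t : ℂ, (‖t‖ = Real.exp s ∨ ‖t‖ = (Real.exp s)⁻¹) →
      ‖flowN a c r k l A t‖ ≤ 3 * M := by
    intro t ht
    have hmem : (Real.exp s)⁻¹ ≤ ‖t‖ ∧ ‖t‖ ≤ Real.exp s := by
      rcases ht with h | h <;> rw [h] <;> constructor <;> linarith
    have hne : t ≠ 1 := by
      rintro rfl
      rw [norm_one] at ht
      rcases ht with h | h <;> linarith
    have h1 : ‖flowQ a c r k l A (bipolarInv a t)‖ ≤ 2 * ‖flowPi a c r k A t‖ := by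
      rcases ht with h | h
      · exact norm_flowQ_eq_of_vanish ha hq1 hA (hsub hmem) hne h hV
      · exact norm_flowQ_eq_of_vanish ha hq1 hA (hsub hmem) hne h hV'
    have h2 : bipolarInv a t - a ≠ 0 := by
      rw [bipolarInv_sub hne]
      exact div_ne_zero (mul_ne_zero two_ne_zero (ofReal_ne_zero.2 ha.ne')) (sub_ne_zero.2 hne)
    have h3 := norm_flowN_le (c := c) (r := r) (k := k) (l := l) (A := A) ha h2
    rw [bipolar_bipolarInv ha.ne' hne] at h3
    have h4 := hP t hmem.1 hmem.2
    have h5 := hD t hmem.1 hmem.2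
    linarith
  have hdiff : DiffContOnCl ℂ (flowN a c r k l A) (annulus (Real.exp s)) :=
    ((differentiableOn_flowN ha.ne' (by linarith) hA).mono (hcl.trans hsub)).diffContOnCl
  have hb : Bornology.IsBounded (annulus (Real.exp s)) :=
    (Metric.isBounded_closedBall (x := (0 : ℂ)) (r := Real.exp s)).subset fun t ht => by
      simpa using ht.2.le
  by_cases h : t ∈ annulus (Real.exp s)
  · refine Complex.norm_le_of_forall_mem_frontier_norm_le hb hdiff (fun w hw => hbd w ?_)
      (subset_closure h)
    rw [(isOpen_annulus _).frontier_eq] at hw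
    have h1 := hcl hw.1
    by_contra hcon
    rw [not_or] at hcon
    exact hw.2 ⟨lt_of_le_of_ne h1.1 (Ne.symm hcon.2), lt_of_le_of_ne h1.2 hcon.1⟩
  · refine hbd t ?_
    by_contra hcon
    rw [not_or] at hcon
    exact h ⟨lt_of_le_of_ne ht1 (Ne.symm hcon.2), lt_of_le_of_ne ht2 hcon.1⟩

theorem norm_powerSeries_le {c w : ℕ → ℝ} {B ρ M r : ℝ} (hw : Summable w) (hρ : 1 ≤ ρ)
    (hrρ : ρ < r) (hs : 0 < s) (hM : ∀ n, |c n| * r ^ n ≤ M)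
    (hc : ∀ n : ℕ, |c n| * (ρ ^ n * (1 + n * s)) ≤ w n * B) (ht : ‖t‖ ≤ ρ) :
    ‖powerSeries c t‖ ≤ (∑' n, w n) * B ∧
      s * ‖t * deriv (powerSeries c) t‖ ≤ (∑' n, w n) * B := by
  have htr : ‖t‖ < r := ht.trans_lt hrρ
  have hsum := hw.hasSum.mul_right B
  constructor
  · refine tsum_of_norm_bounded hsum fun n => ?_
    rw [norm_mul, norm_pow, norm_real, Real.norm_eq_abs]
    refine le_trans ?_ (hc n)
    have h1 : ‖t‖ ^ n ≤ ρ ^ n := by gcongr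
    have h2 : 0 ≤ (n : ℝ) * s := by positivity
    have h3 : 0 ≤ ρ ^ n := by positivity
    refine mul_le_mul_of_nonneg_left ?_ (abs_nonneg _)
    nlinarith
  · rw [← (hasSum_mul_deriv_powerSeries (by linarith) hM htr).tsum_eq,
      ← abs_of_pos hs, ← Real.norm_eq_abs, ← norm_real, ← norm_mul, ← tsum_mul_left]
    refine tsum_of_norm_bounded hsum fun n => ?_
    rw [norm_mul, norm_mul, norm_mul, norm_pow, norm_real, norm_real, Real.norm_eq_abs,
      Real.norm_eq_abs, abs_of_pos hs, norm_natCast]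
    refine le_trans ?_ (hc n)
    have h1 : ‖t‖ ^ n ≤ ρ ^ n := by gcongr
    have h3 : 0 ≤ ρ ^ n := by positivity
    calc s * (n * (|c n| * ‖t‖ ^ n)) = |c n| * (‖t‖ ^ n * (n * s)) := by ring
      _ ≤ |c n| * (ρ ^ n * (1 + n * s)) := by gcongr; linarith

theorem hasDerivAt_flowPi_clamped (ha : a ≠ 0) (hs : 0 < s) {r : ℝ} (hr : 1 < r)
    (hrq : r < Real.exp (2 * s)) (ht : t ∈ annulus r) :
    HasDerivAt (flowPi a (coeffX s (Real.exp (2 * s)) / a) 0 (1 / (4 * a ^ 2))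
        (clampedSeries s (Real.exp (2 * s))))
      (1 / (4 * a ^ 2) * (deriv (powerSeries (coeffH s (Real.exp (2 * s)))) t -
        deriv (powerSeries (coeffH s (Real.exp (2 * s)))) t⁻¹ / t ^ 2)) t := by
  obtain ⟨M, hM⟩ := exists_coeffH_radius hs hr hrq
  have hr0 : 0 < r := by linarith
  have h1 := (hasDerivAt_laurent hr0 hM hM ht).const_mul (1 / (4 * (a : ℂ) ^ 2))
  refine h1.congr_of_eventuallyEq ?_
  have hsub : annulus r ⊆ annulus (Real.exp (2 * s)) := fun w hw =>
    ⟨(inv_strictAnti₀ hr0 hrq).trans hw.1, hw.2.trans hrq⟩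
  filter_upwards [(isOpen_annulus r).mem_nhds ht] with w hw
  exact flowPi_clamped ha (hr.trans hrq) (hsub hw)

/-- Bounds for the pressure of the clamped flow and for its derivative. -/
theorem exists_flowPi_clamped_bound : ∃ W : ℝ, 0 < W ∧ ∀ a s : ℝ, 0 < a → 0 < s → s ≤ 1 / 2 →
    ∀ t : ℂ, (Real.exp s)⁻¹ ≤ ‖t‖ → ‖t‖ ≤ Real.exp s →
    ‖flowPi a (coeffX s (Real.exp (2 * s)) / a) 0 (1 / (4 * a ^ 2))
      (clampedSeries s (Real.exp (2 * s))) t‖ ≤ W * (s * √s) / a ^ 2 ∧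
    |‖t‖ ^ 2 - 1| * ‖deriv (flowPi a (coeffX s (Real.exp (2 * s)) / a) 0 (1 / (4 * a ^ 2))
      (clampedSeries s (Real.exp (2 * s)))) t‖ ≤ W * (s * √s) / a ^ 2 := by
  obtain ⟨w, hw, hbound⟩ := exists_coeffH_bound
  refine ⟨2 * |∑' n, w n| + 1, by positivity, fun a s ha hs hs1 t ht1 ht2 => ?_⟩
  set B := s * √s with hB
  have hB0 : 0 ≤ B := by positivity
  set W := |∑' n, w n| with hW
  have hWw : (∑' n, w n) * B ≤ W * B := by gcongr; exact le_abs_self _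
  have he : 1 < Real.exp s := Real.one_lt_exp_iff.2 hs
  have hr1 : Real.exp s < Real.exp (3 / 2 * s) := Real.exp_lt_exp.2 (by linarith)
  have hr2 : Real.exp (3 / 2 * s) < Real.exp (2 * s) := Real.exp_lt_exp.2 (by linarith)
  obtain ⟨M, hM⟩ := exists_coeffH_radius hs (he.trans hr1) hr2
  have hc : ∀ n : ℕ, |coeffH s (Real.exp (2 * s)) n| * (Real.exp s ^ n * (1 + n * s)) ≤
      w n * B := fun n => by
    rw [← Real.exp_nat_mul]; exact hbound s hs hs1 n
  have hr0 : 0 < Real.exp (3 / 2 * s) := Real.exp_pos _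
  have hmem : t ∈ annulus (Real.exp (3 / 2 * s)) :=
    ⟨(inv_strictAnti₀ (Real.exp_pos s) hr1).trans_le ht1, ht2.trans_lt hr1⟩
  have ht0 : t ≠ 0 := ne_zero_of_mem_annulus hr0 hmem
  have htp : 0 < ‖t‖ := norm_pos_iff.2 ht0
  have ht3 : ‖t⁻¹‖ ≤ Real.exp s := by
    rw [norm_inv]; exact inv_le_of_inv_le₀ (Real.exp_pos s) ht1
  obtain ⟨p1, p2⟩ := norm_powerSeries_le hw he.le hr1 hs hM hc ht2
  obtain ⟨p3, p4⟩ := norm_powerSeries_le hw he.le hr1 hs hM hc ht3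
  have hsub : t ∈ annulus (Real.exp (2 * s)) :=
    ⟨(inv_strictAnti₀ hr0 hr2).trans hmem.1, hmem.2.trans hr2⟩
  have hk : ‖(1 / (4 * (a : ℂ) ^ 2))‖ = 1 / (4 * a ^ 2) := by
    rw [norm_div, norm_mul, norm_pow, norm_real, Real.norm_eq_abs, sq_abs]; norm_num
  have ha2 : 0 < a ^ 2 := by positivity
  have hWB : 0 ≤ W * B := by positivity
  constructor
  · rw [flowPi_clamped ha.ne' (by linarith) hsub, norm_mul, hk, div_mul_eq_mul_div,
      div_le_div_iff₀ (by positivity) ha2]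
    have := (norm_add_le (powerSeries (coeffH s (Real.exp (2 * s))) t)
      (powerSeries (coeffH s (Real.exp (2 * s))) t⁻¹))
    have h2 : ‖powerSeries (coeffH s (Real.exp (2 * s))) t +
        powerSeries (coeffH s (Real.exp (2 * s))) t⁻¹‖ ≤ 2 * (W * B) := by linarith
    nlinarith
  · rw [(hasDerivAt_flowPi_clamped ha.ne' hs (he.trans hr1) hr2 hmem).deriv, norm_mul, hk]
    set d := deriv (powerSeries (coeffH s (Real.exp (2 * s))))
    have h1 : ‖t‖ * ‖d t - d t⁻¹ / t ^ 2‖ ≤ ‖t * d t‖ + ‖t⁻¹ * d t⁻¹‖ := by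
      rw [← norm_mul]
      refine le_trans (le_of_eq ?_) (norm_sub_le _ _)
      congr 1
      field_simp
    -- The width of the annulus provides the factor s that pays for differentiating the series.
    have h2 : |‖t‖ ^ 2 - 1| ≤ 3 * s * ‖t‖ := by
      have hS := sinh_le_add_cube hs.le (by linarith)
      rw [Real.sinh_eq, Real.exp_neg] at hS
      have h3 : Real.exp s - (Real.exp s)⁻¹ ≤ 3 * s := by
        have : s ^ 3 ≤ s / 4 := by nlinarith [mul_pos hs hs]
        linarith
      have h4 : ‖t‖⁻¹ ≤ Real.exp s := by rwa [norm_inv] at ht3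
      have h5 : ‖t‖ * ‖t‖⁻¹ = 1 := mul_inv_cancel₀ htp.ne'
      have h6 : (Real.exp s)⁻¹ ≤ ‖t‖⁻¹ := inv_anti₀ htp ht2
      rw [abs_le]
      constructor <;> nlinarith
    have h7 : s * (‖t‖ * ‖d t - d t⁻¹ / t ^ 2‖) ≤ 2 * (W * B) := by
      have := mul_le_mul_of_nonneg_left h1 hs.le
      linarith
    calc |‖t‖ ^ 2 - 1| * (1 / (4 * a ^ 2) * ‖d t - d t⁻¹ / t ^ 2‖)
        ≤ 3 * s * ‖t‖ * (1 / (4 * a ^ 2) * ‖d t - d t⁻¹ / t ^ 2‖) := by gcongr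
      _ = 3 / 4 * (s * (‖t‖ * ‖d t - d t⁻¹ / t ^ 2‖)) / a ^ 2 := by field_simp
      _ ≤ 3 / 4 * (2 * (W * B)) / a ^ 2 := by gcongr
      _ ≤ (2 * W + 1) * B / a ^ 2 := by
        refine div_le_div_of_nonneg_right ?_ ha2.le
        nlinarith

/-- Bounds for the derivatives of the clamped flow. -/
theorem exists_flow_clamped_bound : ∃ W : ℝ, 0 < W ∧ ∀ a s : ℝ, 0 < a → 0 < s → s ≤ 1 / 2 →
    ∀ z ∈ bipolarDomain a (Real.exp s),
    ‖flowPi a (coeffX s (Real.exp (2 * s)) / a) 0 (1 / (4 * a ^ 2))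
      (clampedSeries s (Real.exp (2 * s))) (bipolar a z)‖ ≤ W * (s * √s) / a ^ 2 ∧
    ‖flowQ a (coeffX s (Real.exp (2 * s)) / a) 0 (1 / (4 * a ^ 2)) 1
      (clampedSeries s (Real.exp (2 * s))) z‖ ≤ W * (s * √s) / a ^ 2 := by
  obtain ⟨W, hW, hb⟩ := exists_flowPi_clamped_bound
  refine ⟨4 * W, by positivity, fun a s ha hs hs1 z hz => ?_⟩
  have hq : 1 < Real.exp (2 * s) := Real.one_lt_exp_iff.2 (by linarith)
  have hqs : Real.exp s < Real.exp (2 * s) := Real.exp_lt_exp.2 (by linarith)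
  have hA := differentiableOn_clampedSeries s hq
  have hza := sub_ne_zero_of_mem_bipolarDomain (Real.exp_pos s) hz
  obtain ⟨h1, h2⟩ := hb a s ha hs hs1 (bipolar a z) hz.1.le hz.2.le
  have hN := norm_flowN_le_of_circles ha hs hqs hA
    (fun z hz hn => flowV_clamped_eq_zero ha.ne' hs rfl hz hn)
    (fun t e1 e2 => (hb a s ha hs hs1 t e1 e2).1) (fun t e1 e2 => (hb a s ha hs hs1 t e1 e2).2)
    hz.1.le hz.2.le
  have hQ := norm_flowQ_le (c := coeffX s (Real.exp (2 * s)) / a) (r := 0)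
    (k := 1 / (4 * a ^ 2)) (l := 1) (A := clampedSeries s (Real.exp (2 * s))) ha hza
  have h0 : 0 ≤ W * (s * √s) / a ^ 2 := by positivity
  have e : 4 * W * (s * √s) / a ^ 2 = 4 * (W * (s * √s) / a ^ 2) := by ring
  rw [e]
  constructor <;> linarith

end

end

section

open Complex ComplexConjugate Topology Bornology

/-! ### Decay at infinity -/

section

variable {a c r k l q : ℝ} {A : ℂ → ℂ}

theorem isBigO_sq_of_deriv_eq_zero {f : ℂ → ℂ} {U : Set ℂ} {x : ℂ} (hU : IsOpen U) (hx : x ∈ U)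
    (hf : DifferentiableOn ℂ f U) (h0 : f x = 0) (h1 : deriv f x = 0) :
    deriv f =O[𝓝 x] (fun t => t - x) ∧ f =O[𝓝 x] (fun t => (t - x) ^ 2) := by
  have h2 : deriv f =O[𝓝 x] (fun t => t - x) := by
    have := ((hf.deriv hU).differentiableAt (hU.mem_nhds hx)).hasDerivAt.isBigO_sub
    simpa [h1] using this
  refine ⟨h2, ?_⟩
  obtain ⟨C, hC⟩ := h2.bound
  obtain ⟨ε, hε, hball⟩ := Metric.eventually_nhds_iff_ball.1 (hC.and (hU.mem_nhds hx))
  refine IsBigO.of_bound C ?_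
  filter_upwards [Metric.ball_mem_nhds x hε] with t ht
  have hsub : Metric.closedBall x ‖t - x‖ ⊆ Metric.ball x ε := fun w hw => by
    rw [Metric.mem_closedBall] at hw
    rw [mem_ball_iff_norm] at ht
    exact Metric.mem_ball.2 (hw.trans_lt ht)
  have hC0 : ∀ w ∈ Metric.closedBall x ‖t - x‖, ‖deriv f w‖ ≤ |C| * ‖t - x‖ := fun w hw => by
    have h3 := (hball w (hsub hw)).1
    have h4 : ‖w - x‖ ≤ ‖t - x‖ := by rwa [mem_closedBall_iff_norm] at hw
    exact h3.trans (mul_le_mul (le_abs_self C) h4 (norm_nonneg _) (abs_nonneg _))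
  have h5 := (convex_closedBall x ‖t - x‖).norm_image_sub_le_of_norm_hasDerivWithin_le
    (fun w hw => ((hf.differentiableAt (hU.mem_nhds
      (hball w (hsub hw)).2)).hasDerivAt.hasDerivWithinAt)) hC0
    (Metric.mem_closedBall_self (norm_nonneg _)) (mem_closedBall_iff_norm.2 le_rfl : t ∈ _)
  have h6 := (hball x (Metric.mem_ball_self hε)).1
  rw [h0, sub_zero] at h5
  rcases eq_or_ne t x with rfl | hne
  · simp [h0]
  · have h7 : 0 < ‖t - x‖ := norm_pos_iff.2 (sub_ne_zero.2 hne)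
    have h8 := (hball t ht).1
    have hCn : 0 ≤ C := by
      by_contra hneg
      have : C * ‖t - x‖ < 0 := mul_neg_of_neg_of_pos (not_le.1 hneg) h7
      linarith [norm_nonneg (deriv f t)]
    rw [abs_of_nonneg hCn] at h5
    rw [norm_pow, sq, ← mul_assoc]
    exact h5

/-- The inversion t ↦ t⁻¹ fixes 1 with derivative −1 and leaves Π invariant, so Π'(1) = −Π'(1). -/
theorem deriv_flowPi_one (ha : a ≠ 0) (hq : 1 < q) (hA : DifferentiableOn ℂ A (annulus q)) :
    deriv (flowPi a c r k A) 1 = 0 := by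
  have h1 := ((differentiableOn_flowPi (c := c) (r := r) (k := k) ha (by linarith)
    hA).differentiableAt ((isOpen_annulus q).mem_nhds (one_mem_annulus hq))).hasDerivAt
  have h2 : HasDerivAt (fun t : ℂ => flowPi a c r k A t⁻¹)
      (deriv (flowPi a c r k A) 1 * (-(1 ^ 2)⁻¹)) 1 := by
    have h3 : HasDerivAt (flowPi a c r k A) (deriv (flowPi a c r k A) 1) (1 : ℂ)⁻¹ := by
      rwa [inv_one]
    exact h3.comp 1 (hasDerivAt_inv one_ne_zero)
  have h3 := h2.unique (h1.congr_of_eventuallyEq (by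
    filter_upwards [isOpen_ne.mem_nhds (one_ne_zero : (1 : ℂ) ≠ 0)] with t ht
    exact flowPi_inv ht))
  have h4 : (2 : ℂ) * deriv (flowPi a c r k A) 1 = 0 := by
    norm_num at h3
    linear_combination -h3
  simpa using h4

/-- The terms with L' and J carry an explicit (t − 1)²; in the last term one factor comes from t² −
1 and the other from the vanishing of Π' at 1. -/
theorem isBigO_flowN (ha : a ≠ 0) (hq : 1 < q) (hA : DifferentiableOn ℂ A (annulus q))
    (h0 : flowPi a c r k A 1 = 0) : flowN a c r k l A =O[𝓝 1] (fun t => (t - 1) ^ 2) := by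
  have hq0 : 0 < q := by linarith
  have h1 := (isBigO_sq_of_deriv_eq_zero (isOpen_annulus q) (one_mem_annulus hq)
    (differentiableOn_flowPi ha hq0 hA) h0 (deriv_flowPi_one ha hq hA)).1
  have hac : (a : ℂ) ≠ 0 := ofReal_ne_zero.2 ha
  have c1 : ContinuousAt (deriv (flowL a c k l A)) 1 :=
    (((differentiableOn_flowL hq0 hA).deriv (isOpen_annulus q)).differentiableAt
      ((isOpen_annulus q).mem_nhds (one_mem_annulus hq))).continuousAt
  have c2 : ContinuousAt (fun t : ℂ => -1 / (2 * a) * deriv (flowL a c k l A) t -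
      c / (4 * a * t)) 1 :=
    (continuousAt_const.mul c1).sub (continuousAt_const.div
      (continuousAt_const.mul continuousAt_id)
      (mul_ne_zero (mul_ne_zero (by norm_num) hac) one_ne_zero))
  have h2 : (fun t : ℂ => (t - 1) ^ 2 * (-1 / (2 * a) * deriv (flowL a c k l A) t -
      c / (4 * a * t))) =O[𝓝 1] (fun t => (t - 1) ^ 2) := by
    simpa using (isBigO_refl (fun t : ℂ => (t - 1) ^ 2) (𝓝 1)).mul (c2.isBigO_one ℂ)
  have c3 : ContinuousAt (fun t : ℂ => (t + 1) / 2) 1 := by fun_prop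
  have h3 : (fun t : ℂ => (t - 1) * deriv (flowPi a c r k A) t * ((t + 1) / 2)) =O[𝓝 1]
      (fun t => (t - 1) ^ 2) := by
    have := ((isBigO_refl (fun t : ℂ => t - 1) (𝓝 1)).mul h1).mul (c3.isBigO_one ℂ)
    simpa [sq] using this
  refine (h2.add h3).congr_left fun t => ?_
  simp only [flowN, flowJ]
  ring

theorem tendsto_bipolar (a : ℝ) : Tendsto (bipolar a) (cobounded ℂ) (𝓝 1) ∧
    (fun z => bipolar a z - 1) =O[cobounded ℂ] (fun z => ‖z‖⁻¹) := by
  have h1 : ∀ᶠ z in cobounded ℂ, 2 * |a| + 1 ≤ ‖z‖ :=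
    tendsto_norm_cobounded_atTop.eventually_ge_atTop _
  have h2 : (fun z => bipolar a z - 1) =O[cobounded ℂ] (fun z => ‖z‖⁻¹) := by
    refine IsBigO.of_bound (4 * |a|) ?_
    filter_upwards [h1] with z hz
    have h3 : ‖z‖ / 2 ≤ ‖z - a‖ := by
      have := norm_sub_norm_le z a
      rw [norm_real, Real.norm_eq_abs] at this
      linarith [abs_nonneg a]
    have h0 : 0 < ‖z‖ := by linarith [abs_nonneg a]
    have h4 : z - a ≠ 0 := norm_pos_iff.1 (by linarith)
    rw [bipolar_sub_one h4, norm_div, norm_mul, norm_real, norm_inv, norm_norm, Real.norm_eq_abs,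
      div_le_iff₀ (by linarith)]
    norm_num
    rw [mul_assoc, mul_comm _ ‖z - a‖, ← div_eq_mul_inv, ← mul_div_assoc, le_div_iff₀ h0]
    nlinarith [abs_nonneg a]
  refine ⟨?_, h2⟩
  have h3 := h2.trans_tendsto (tendsto_norm_cobounded_atTop.inv_tendsto_atTop)
  simpa using h3.add_const 1

theorem isBigO_flowQ (ha : 0 < a) (hq : 1 < q) (hA : DifferentiableOn ℂ A (annulus q))
    (h0 : flowPi a c r k A 1 = 0) :
    (fun z => flowPi a c r k A (bipolar a z)) =O[cobounded ℂ] (fun z => (‖z‖ ^ 2)⁻¹) ∧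
    flowQ a c r k l A =O[cobounded ℂ] (fun z => (‖z‖ ^ 2)⁻¹) := by
  obtain ⟨ht, hb⟩ := tendsto_bipolar a
  obtain ⟨h1, h2⟩ := isBigO_sq_of_deriv_eq_zero (isOpen_annulus q) (one_mem_annulus hq)
    (differentiableOn_flowPi ha.ne' (by linarith) hA) h0 (deriv_flowPi_one ha.ne' hq hA)
  have h3 := isBigO_flowN (l := l) ha.ne' hq hA h0
  have hb2 : (fun z => (bipolar a z - 1) ^ 2) =O[cobounded ℂ] (fun z => (‖z‖ ^ 2)⁻¹) := by
    simpa [inv_pow] using hb.pow 2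
  refine ⟨(h2.comp_tendsto ht).trans hb2, ?_⟩
  have h4 : (fun t : ℂ => ‖t‖ ^ 2 - 1) =O[𝓝 1] (fun t => t - 1) := by
    refine IsBigO.of_bound 3 ?_
    have : ∀ᶠ t : ℂ in 𝓝 1, ‖t‖ < 2 :=
      continuous_norm.continuousAt.eventually_lt_const (by simp)
    filter_upwards [this] with t ht
    have h5 := abs_norm_sub_norm_le t 1
    rw [norm_one] at h5
    rw [Real.norm_eq_abs, show ‖t‖ ^ 2 - 1 = (‖t‖ + 1) * (‖t‖ - 1) by ring, abs_mul,
      abs_of_pos (by positivity)]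
    exact mul_le_mul (by linarith) h5 (abs_nonneg _) (by norm_num)
  have h6 : (fun t : ℂ => ‖flowN a c r k l A t‖ + |‖t‖ ^ 2 - 1| * ‖deriv (flowPi a c r k A) t‖)
      =O[𝓝 1] (fun t => (t - 1) ^ 2) := by
    refine h3.norm_left.add ?_
    have : (fun t : ℂ => (t - 1) ^ 2) = fun t => (t - 1) * (t - 1) := by funext t; ring
    rw [this]
    refine (IsBigO.mul (h4.abs_left.norm_right) (h1.norm_left.norm_right)).trans ?_
    refine IsBigO.of_bound 1 (Eventually.of_forall fun t => ?_)
    simp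
  refine IsBigO.trans (IsBigO.of_bound 1 ?_) ((h6.comp_tendsto ht).trans hb2)
  filter_upwards [ht ((isOpen_annulus q).mem_nhds (one_mem_annulus hq))] with z hz
  rw [one_mul]
  exact (norm_flowQ_le ha (sub_ne_zero_of_mem_bipolarDomain (by linarith) hz)).trans
    (le_abs_self _)

theorem norm_wirtinger_le (a b : ℂ) : ‖wirtinger a b‖ ≤ ‖a‖ + ‖b‖ := by
  refine ContinuousLinearMap.opNorm_le_bound _ (by positivity) fun h => ?_
  rw [wirtinger_apply]
  refine (norm_add_le _ _).trans (le_of_eq ?_)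
  rw [norm_mul, norm_mul, RCLike.norm_conj]
  ring

/-- V is odd, so 2|V(z)| is its variation along a half circle from z to −z. The length π|z| times
the gradient O(|z|⁻²) gives the bound, and the limit velocity is 0. -/
theorem isBigO_flowV (ha : 0 < a) (hq : 1 < q) (hA : DifferentiableOn ℂ A (annulus q))
    (h0 : flowPi a c r k A 1 = 0) :
    flowV a c r k l A =O[cobounded ℂ] (fun z => ‖z‖⁻¹) := by
  obtain ⟨h1, h2⟩ := isBigO_flowQ (l := l) ha hq hA h0
  obtain ⟨C₁, hC₁⟩ := h1.bound
  obtain ⟨C₂, hC₂⟩ := h2.bound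
  have hdom := (tendsto_bipolar a).1 ((isOpen_annulus q).mem_nhds (one_mem_annulus hq))
  obtain ⟨ρ, -, hρ⟩ := hasBasis_cobounded_norm.eventually_iff.1 ((hC₁.and hC₂).and hdom)
  -- 2C₁ + C₂ controls the two Wirtinger derivatives 2 Re Π and Q̄, π is the half circle, and 1/2
  -- comes from oddness.
  refine IsBigO.of_bound ((2 * C₁ + C₂) * Real.pi / 2) ?_
  have hge : ∀ᶠ z in cobounded ℂ, |ρ| + 1 ≤ ‖z‖ :=
    tendsto_norm_cobounded_atTop.eventually_ge_atTop _
  filter_upwards [hge] with z hz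
  have hz0 : 0 < ‖z‖ := by linarith [abs_nonneg ρ]
  have hγn : ∀ θ : ℝ, ‖z * Complex.exp (θ * I)‖ = ‖z‖ := fun θ => by
    rw [norm_mul, norm_exp_ofReal_mul_I, mul_one]
  have hγ : ∀ θ : ℝ, HasDerivAt (fun θ : ℝ => z * Complex.exp (θ * I))
      (z * Complex.exp (θ * I) * I) θ := fun θ => by
    have h1 : HasDerivAt (fun θ : ℂ => z * Complex.exp (θ * I))
        (z * Complex.exp (θ * I) * I) (θ : ℂ) := by
      refine ((((hasDerivAt_id _).mul_const I).cexp).const_mul z).congr_deriv ?_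
      simp
      ring
    exact h1.comp_ofReal
  have hmem : ∀ θ : ℝ, z * Complex.exp (θ * I) ∈ {x : ℂ | ρ ≤ ‖x‖} := fun θ => by
    change ρ ≤ _
    rw [hγn]; linarith [le_abs_self ρ]
  have hd := fun θ : ℝ => (hasFDerivAt_flowV (c := c) (r := r) (k := k) (l := l) ha.ne'
    (by linarith) hA (hρ (hmem θ)).2).comp_hasDerivAt θ (hγ θ)
  have h3 := norm_image_sub_le_of_norm_deriv_le_segment' (a := 0) (b := Real.pi)
    (C := (2 * C₁ + C₂) * ‖z‖⁻¹)
    (fun θ _ => (hd θ).hasDerivWithinAt) (fun θ _ => by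
      obtain ⟨⟨e1, e2⟩, -⟩ := hρ (hmem θ)
      rw [hγn, norm_inv, norm_pow, norm_norm] at e1 e2
      refine (ContinuousLinearMap.le_opNorm _ _).trans ?_
      rw [norm_mul (z * _), hγn, norm_I, mul_one]
      have e3 := norm_wirtinger_le (flowPi a c r k A (bipolar a (z * Complex.exp (θ * I))) +
        conj (flowPi a c r k A (bipolar a (z * Complex.exp (θ * I)))))
        (conj (flowQ a c r k l A (z * Complex.exp (θ * I))))
      have e4 := norm_add_le (flowPi a c r k A (bipolar a (z * Complex.exp (θ * I))))
        (conj (flowPi a c r k A (bipolar a (z * Complex.exp (θ * I)))))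
      rw [RCLike.norm_conj] at e3 e4
      have e5 : (2 * C₁ + C₂) * ‖z‖⁻¹ = (2 * C₁ + C₂) * (‖z‖ ^ 2)⁻¹ * ‖z‖ := by field_simp
      rw [e5]
      refine mul_le_mul_of_nonneg_right ?_ hz0.le
      linarith) Real.pi ⟨Real.pi_pos.le, le_rfl⟩
  have e1 : z * Complex.exp ((Real.pi : ℝ) * I) = -z := by rw [exp_pi_mul_I]; ring
  have e2 : z * Complex.exp ((0 : ℝ) * I) = z := by simp
  have hzd : z ∈ bipolarDomain a q := by have := (hρ (hmem 0)).2; rwa [e2] at this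
  simp only [Function.comp_apply] at h3
  rw [e1, e2, flowV_neg (by linarith) hzd, sub_zero] at h3
  have h4 : ‖-flowV a c r k l A z - flowV a c r k l A z‖ = 2 * ‖flowV a c r k l A z‖ := by
    rw [show -flowV a c r k l A z - flowV a c r k l A z = -(2 * flowV a c r k l A z) by ring,
      norm_neg, norm_mul]
    norm_num
  rw [h4] at h3
  rw [norm_inv, norm_norm]
  linarith

theorem hasDecay_flowV (μ : ℝ) (ha : 0 < a) (hq : 1 < q) (hA : DifferentiableOn ℂ A (annulus q))
    (h0 : flowPi a c r k A 1 = 0) :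
    HasDecay (planeVelocity (flowV a c r k l A))
      (planePressure μ fun z => flowPi a c r k A (bipolar a z)) := by
  obtain ⟨h1, h2⟩ := isBigO_flowQ (l := l) ha hq hA h0
  have h3 := isBigO_flowV (l := l) ha hq hA h0
  have ht : Tendsto planeEquiv.symm (cobounded Plane) (cobounded ℂ) := by
    rw [← tendsto_norm_atTop_iff_cobounded]
    simpa using tendsto_norm_cobounded_atTop
  have hdom := ht.eventually
    ((tendsto_bipolar a).1 ((isOpen_annulus q).mem_nhds (one_mem_annulus hq)))
  refine ⟨⟨0, ?_⟩, ?_, ?_⟩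
  · have h4 := h3.comp_tendsto ht
    refine IsBigO.congr' (IsBigO.trans (IsBigO.of_bound 1 (Eventually.of_forall fun x => ?_)) h4)
      (EventuallyEq.refl _ _) (Eventually.of_forall fun x => ?_)
    · simp [planeVelocity]
    · simp
  · have h4 := ((h1.comp_tendsto ht).norm_left.const_mul_left 2).add (h2.comp_tendsto ht).norm_left
    refine IsBigO.congr' (IsBigO.trans (IsBigO.of_bound 1 ?_) h4)
      (EventuallyEq.refl _ _) (Eventually.of_forall fun x => ?_)
    · filter_upwards [hdom] with x hx
      have hd := hasFDerivAt_planeVelocity (hasFDerivAt_flowV (c := c) (r := r) (k := k) (l := l)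
        ha.ne' (by linarith) hA hx)
      rw [hd.fderiv, one_mul]
      refine le_trans (ContinuousLinearMap.opNorm_le_bound _ ?_ fun h => ?_) (le_abs_self _)
      · positivity
      · simp only [ContinuousLinearMap.comp_apply, ContinuousLinearEquiv.coe_coe,
          LinearIsometryEquiv.coe_toContinuousLinearEquiv, LinearIsometryEquiv.norm_map]
        refine (ContinuousLinearMap.le_opNorm _ _).trans ?_
        rw [LinearIsometryEquiv.norm_map]
        refine mul_le_mul_of_nonneg_right ((norm_wirtinger_le _ _).trans ?_) (norm_nonneg _)
        rw [norm_mul, norm_mul, norm_neg, norm_I, one_mul, one_mul, RCLike.norm_conj]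
        refine add_le_add ((norm_add_le _ _).trans (le_of_eq ?_)) le_rfl
        rw [RCLike.norm_conj]
        simp only [Function.comp_apply]
        ring
    · simp
  · have h4 := (h1.comp_tendsto ht).const_mul_left (4 * μ : ℂ)
    refine IsBigO.congr' (IsBigO.trans (IsBigO.of_bound 1 (Eventually.of_forall fun x => ?_)) h4)
      (EventuallyEq.refl _ _) (Eventually.of_forall fun x => ?_)
    · simp only [planePressure, Function.comp_apply, one_mul, norm_mul, norm_neg, norm_real]
      norm_num
      gcongr
      exact abs_im_le_norm _
    · simp

end

end

section

open Complex ComplexConjugate Topology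

/-! ### The singular function -/

/-- The coefficient of `x log|t|` in the explicit part of the singular function. -/
def explicitX (s q : ℝ) : ℝ := -(2 * q) / (q ^ 2 - 1 + 4 * q * s)

/-- The coefficient of `|z|²` in the explicit part of the singular function. -/
def explicitR (a s q : ℝ) : ℝ := -((q - 1) ^ 2 / (4 * a * (q ^ 2 - 1 + 4 * q * s)))

/-- The factor of the clamped flow in the singular function. -/
def clampedFactor (a s q : ℝ) : ℝ :=
  a * (q - 1) ^ 2 / (2 * (q ^ 2 - 1 + 4 * q * s) * clampedLimit s q)

/-- The analytic function `Π` of the clamped flow. -/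
def clampedPi (a s q : ℝ) : ℂ → ℂ :=
  flowPi a (coeffX s q / a) 0 (1 / (4 * a ^ 2)) (clampedSeries s q)

/-- The complex form of the singular function. -/
def singularV (a s q : ℝ) : ℂ → ℂ :=
  flowV a (explicitX s q + clampedFactor a s q * (coeffX s q / a))
    (explicitR a s q + clampedFactor a s q * 0) (clampedFactor a s q * (1 / (4 * a ^ 2)))
    (clampedFactor a s q * 1) (clampedSeries s q)

/-- The analytic function `Π` of the singular function. -/
def singularPi (a s q : ℝ) : ℂ → ℂ :=
  flowPi a (explicitX s q + clampedFactor a s q * (coeffX s q / a))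
    (explicitR a s q + clampedFactor a s q * 0) (clampedFactor a s q * (1 / (4 * a ^ 2)))
    (clampedSeries s q)

/-- The conjugate of the derivative of the explicit part with respect to `z̄`. -/
def explicitQ (a s q : ℝ) (z : ℂ) : ℂ :=
  flowQ a (explicitX s q) (explicitR a s q) 0 0 (clampedSeries s q) z

/-- The conjugate of the derivative of the clamped flow with respect to `z̄`. -/
def clampedQ (a s q : ℝ) (z : ℂ) : ℂ :=
  flowQ a (coeffX s q / a) 0 (1 / (4 * a ^ 2)) 1 (clampedSeries s q) z

section

variable {μ R a s q δ : ℝ} {z t : ℂ}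

theorem explicit_den_eq (hqs : q = Real.exp (2 * s)) :
    q ^ 2 - 1 + 4 * q * s = 2 * q * (Real.sinh (2 * s) + 2 * s) := by
  rw [Real.sinh_eq, Real.exp_neg, ← hqs]
  have : q ≠ 0 := by rw [hqs]; exact (Real.exp_pos _).ne'
  field_simp
  ring

theorem explicitX_eq (hqs : q = Real.exp (2 * s)) :
    explicitX s q = -(Real.sinh (2 * s) + 2 * s)⁻¹ := by
  have : q ≠ 0 := by rw [hqs]; exact (Real.exp_pos _).ne'
  rw [explicitX, explicit_den_eq hqs, neg_div, div_mul_eq_div_div, div_self (by simpa using this),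
    one_div]

theorem explicit_sum_bounds (hs : 0 < s) (hs1 : s ≤ 1 / 4) :
    4 * s ≤ Real.sinh (2 * s) + 2 * s ∧ Real.sinh (2 * s) + 2 * s ≤ 5 * s := by
  have h1 := Real.self_le_sinh_iff.2 (by linarith : 0 ≤ 2 * s)
  have h2 := sinh_le_add_cube (x := 2 * s) (by linarith) (by linarith)
  constructor
  · linarith
  · nlinarith [mul_pos hs hs]

theorem abs_explicitX_bounds (hs : 0 < s) (hs1 : s ≤ 1 / 4) (hqs : q = Real.exp (2 * s)) :
    1 / (5 * s) ≤ |explicitX s q| ∧ |explicitX s q| ≤ 1 / (4 * s) := by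
  obtain ⟨h1, h2⟩ := explicit_sum_bounds hs hs1
  have h0 : 0 < Real.sinh (2 * s) + 2 * s := by linarith
  rw [explicitX_eq hqs, abs_neg, abs_of_pos (inv_pos.2 h0), ← one_div]
  exact ⟨one_div_le_one_div_of_le h0 h2, one_div_le_one_div_of_le (by linarith) h1⟩

theorem sinh_le_five_quarters (hs : 0 < s) (hs1 : s ≤ 1 / 4) : Real.sinh s ≤ 5 / 4 * s := by
  have h2 := sinh_le_add_cube hs.le (by linarith)
  nlinarith [mul_pos hs hs]

/-- The numerator contains (q − 1)² = 4q sinh² s, of order s², and the limit in the denominator is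
at least s²/150. These balance, and the remaining denominator, of order s, gives a/s. -/
theorem clampedFactor_bounds (ha : 0 < a) (hs : 0 < s) (hs1 : s ≤ 1 / 4)
    (hqs : q = Real.exp (2 * s)) :
    0 ≤ clampedFactor a s q ∧ clampedFactor a s q ≤ 60 * a / s := by
  obtain ⟨h1, h2⟩ := explicit_sum_bounds hs hs1
  have h3 := sinh_le_five_quarters hs hs1
  have h3' := Real.sinh_pos_iff.2 hs
  have h4 := four_mul_sinh_sq s
  have h5 := le_clampedLimit hs hs1
  rw [← hqs] at h4 h5
  have hq : 0 < q := by rw [hqs]; exact Real.exp_pos _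
  have h6 : (q - 1) ^ 2 = 4 * q * Real.sinh s ^ 2 := by
    have : q * q⁻¹ = 1 := mul_inv_cancel₀ hq.ne'
    linear_combination (-q) * h4 - this
  have hL : 0 < clampedLimit s q := lt_of_lt_of_le (by positivity) h5
  rw [clampedFactor, explicit_den_eq hqs, h6]
  have h0 : 0 < Real.sinh (2 * s) + 2 * s := by linarith
  refine ⟨by positivity, ?_⟩
  rw [div_le_div_iff₀ (by positivity) hs]
  have h7 : Real.sinh s ^ 2 ≤ (5 / 4 * s) ^ 2 := by gcongr
  calc a * (4 * q * Real.sinh s ^ 2) * s ≤ a * (4 * q * (5 / 4 * s) ^ 2) * s := by gcongr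
    _ ≤ 60 * a * (2 * (2 * q * (4 * s)) * (s ^ 2 / 150)) := by
      have : 0 < a * q * s ^ 3 := by positivity
      nlinarith
    _ ≤ _ := by gcongr

/-- `clampedFactor` is chosen for exactly this cancellation. At t = 1 the explicit part contributes
its rotation rate r and the clamped flow contributes twice its limit over 4a². -/
theorem singularPi_one (ha : a ≠ 0) (hq : 1 < q) (hL : clampedLimit s q ≠ 0) :
    singularPi a s q 1 = 0 := by
  rw [singularPi, flowPi, inv_one, clampedSeries_one hq, explicitR, clampedFactor]
  have h1 : (a : ℂ) ≠ 0 := ofReal_ne_zero.2 ha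
  have h3 : (clampedLimit s q : ℂ) ≠ 0 := ofReal_ne_zero.2 hL
  push_cast
  rw [sub_self]
  by_cases hE : (q : ℂ) ^ 2 - 1 + 4 * q * s = 0
  · simp [hE]
  obtain ⟨E, hEd⟩ : ∃ E, E = (q : ℂ) ^ 2 - 1 + 4 * q * s := ⟨_, rfl⟩
  rw [← hEd] at hE ⊢
  field_simp
  ring

theorem singularV_eq (z : ℂ) :
    singularV a s q z = flowV a (explicitX s q) (explicitR a s q) 0 0 (clampedSeries s q) z +
      clampedFactor a s q *
        flowV a (coeffX s q / a) 0 (1 / (4 * a ^ 2)) 1 (clampedSeries s q) z := by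
  rw [singularV, flowV_add_smul]

theorem singularPi_eq (t : ℂ) :
    singularPi a s q t =
      flowPi a (explicitX s q) (explicitR a s q) 0 (clampedSeries s q) t +
      clampedFactor a s q * clampedPi a s q t := by
  rw [singularPi, flowPi_add_smul, clampedPi]

theorem singularV_right (ha : 0 < a) (hs : 0 < s) (hqs : q = Real.exp (2 * s))
    (hz : z ∈ bipolarDomain a q) (htz : ‖bipolar a z‖ = Real.exp s) :
    singularV a s q z = -1 / 2 := by
  rw [singularV_eq, flowV_clamped_eq_zero ha.ne' hs hqs hz htz, mul_zero, add_zero]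
  exact flowV_explicit_eq ha.ne' hs hqs hz htz

theorem planeEquiv_smul_I (x : ℝ) : planeEquiv (x * I) = x • e 1 := by
  rw [← planeEquiv_symm_e_one, ← real_smul, map_smul, planeEquiv.apply_symm_apply]

theorem isSingularFunctionTwo_singularV (hR : 0 < R) (hs : 0 < s) (hs1 : s ≤ 1 / 4)
    (ha : a = R * Real.sinh s) (hδ : δ = 2 * R * (Real.cosh s - 1))
    (hqs : q = Real.exp (2 * s)) :
    IsSingularFunctionTwo μ R δ (planeVelocity (singularV a s q))
      (planePressure μ fun z => singularPi a s q (bipolar a z)) := by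
  have ha0 : 0 < a := by rw [ha]; exact mul_pos hR (Real.sinh_pos_iff.2 hs)
  have hq : 1 < q := by rw [hqs]; exact Real.one_lt_exp_iff.2 (by linarith)
  have he : 1 < Real.exp s := Real.one_lt_exp_iff.2 hs
  have heq : Real.exp s < q := by rw [hqs]; exact Real.exp_lt_exp.2 (by linarith)
  have hA := differentiableOn_clampedSeries s hq
  have hL : clampedLimit s q ≠ 0 := by
    have := le_clampedLimit hs hs1
    rw [← hqs] at this
    have h2 : 0 < s ^ 2 / 150 := by positivity
    linarith
  have hright : ∀ x ∈ Metric.sphere (rightCenter R δ) R,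
      planeEquiv.symm x ∈ bipolarDomain a q ∧ singularV a s q (planeEquiv.symm x) = -1 / 2 := by
    intro x hx
    have h1 := norm_bipolar_right hR hs ha hδ hx
    have h2 : planeEquiv.symm x ∈ bipolarDomain a q := by
      refine ⟨?_, by rw [h1]; exact heq⟩
      rw [h1]
      exact (inv_lt_one_of_one_lt₀ hq).trans he
    exact ⟨h2, singularV_right ha0 hs hqs h2 h1⟩
  refine ⟨?_, fun x hx => ?_, fun x hx => ?_, ?_⟩
  · exact isStokesSolution_flowV ha0.ne' (by linarith) hA
      ((closure_exteriorDomain_subset hR hs ha hδ).trans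
        (Set.preimage_mono (closure_bipolarDomain_subset ha0.ne' he heq)))
  · obtain ⟨h1, h2⟩ := hright (-x) (neg_mem_sphere_right hx)
    rw [map_neg] at h1 h2
    have h3 := flowV_neg (a := a)
      (c := explicitX s q + clampedFactor a s q * (coeffX s q / a))
      (r := explicitR a s q + clampedFactor a s q * 0) (k := clampedFactor a s q * (1 / (4 * a ^ 2)))
      (l := clampedFactor a s q * 1) (A := clampedSeries s q) (by linarith) h1
    rw [neg_neg] at h3
    change singularV a s q _ = -singularV a s q _ at h3
    rw [planeVelocity, h3, h2, ← planeEquiv_smul_I]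
    congr 1
    push_cast
    ring
  · rw [planeVelocity, (hright x hx).2, ← planeEquiv_smul_I]
    congr 1
    push_cast
    ring
  · exact hasDecay_flowV μ ha0 hq hA (singularPi_one ha0.ne' hq hL)

/-! ### Estimates for the singular function -/

theorem hasFDerivAt_singularV (ha : 0 < a) (hq : 1 < q) (hz : z ∈ bipolarDomain a q) :
    ∃ α : ℂ, α.im = 0 ∧ HasFDerivAt (singularV a s q)
      (wirtinger α (conj (explicitQ a s q z + clampedFactor a s q * clampedQ a s q z))) z := by
  have hA := differentiableOn_clampedSeries s hq
  have h1 := hasFDerivAt_flowV (c := explicitX s q) (r := explicitR a s q) (k := 0) (l := 0)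
    ha.ne' (by linarith) hA hz
  have h2 := hasFDerivAt_flowV (c := coeffX s q / a) (r := 0) (k := 1 / (4 * a ^ 2)) (l := 1)
    ha.ne' (by linarith) hA hz
  have h3 := hasFDerivAt_wirtinger_add h1 (hasFDerivAt_wirtinger_mul
    (hasDerivAt_const z (clampedFactor a s q : ℂ)).hasFDerivAt_wirtinger h2)
  have h4 : singularV a s q = _ := funext fun z => singularV_eq (a := a) (s := s) (q := q) z
  rw [h4]
  refine ⟨(flowPi a (explicitX s q) (explicitR a s q) 0 (clampedSeries s q) (bipolar a z) +
      conj (flowPi a (explicitX s q) (explicitR a s q) 0 (clampedSeries s q) (bipolar a z))) +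
      (clampedFactor a s q * (clampedPi a s q (bipolar a z) + conj (clampedPi a s q (bipolar a z)))),
      ?_, h3.congr_fderiv ?_⟩
  · simp
  · congr 1 <;> simp [clampedPi, explicitQ, clampedQ]

theorem deriv_flowPi_explicit (ha : a ≠ 0) (ht : t ≠ 0) (c r : ℝ) (A : ℂ → ℂ) :
    deriv (flowPi a c r 0 A) t = -c / (4 * a) * (1 - (t ^ 2)⁻¹) := by
  have hac : (a : ℂ) ≠ 0 := ofReal_ne_zero.2 ha
  have h1 : HasDerivAt (fun t : ℂ => -c / (4 * a) * (t + t⁻¹ - 2) + r)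
      (-c / (4 * a) * (1 + -(t ^ 2)⁻¹)) t :=
    ((((hasDerivAt_id t).add (hasDerivAt_inv ht)).sub_const 2).const_mul _).add_const _
  have h2 : flowPi a c r 0 A =ᶠ[𝓝 t] fun t : ℂ => -c / (4 * a) * (t + t⁻¹ - 2) + r := by
    filter_upwards [isOpen_ne.mem_nhds ht] with w hw
    rw [flowPi]
    have : w ≠ 0 := hw
    push_cast
    field_simp
    ring
  rw [(h1.congr_of_eventuallyEq h2).deriv]
  ring

theorem deriv_flowL_explicit (ht : t ≠ 0) (c : ℝ) (A : ℂ → ℂ) :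
    deriv (flowL a c 0 0 A) t = -c / 4 * (1 + (t ^ 2)⁻¹) := by
  have h1 : HasDerivAt (fun t : ℂ => -(c : ℂ) / 4 * (t - t⁻¹))
      (-c / 4 * (1 - -(t ^ 2)⁻¹)) t :=
    (((hasDerivAt_id t).sub (hasDerivAt_inv ht)).const_mul _)
  have h2 : flowL a c 0 0 A =ᶠ[𝓝 t] fun t : ℂ => -(c : ℂ) / 4 * (t - t⁻¹) := by
    filter_upwards [isOpen_ne.mem_nhds ht] with w hw
    rw [flowL]
    have : w ≠ 0 := hw
    push_cast
    field_simp
    ring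
  rw [(h1.congr_of_eventuallyEq h2).deriv]
  ring

theorem flowN_explicit (ha : a ≠ 0) (ht : t ≠ 0) (c r : ℝ) (A : ℂ → ℂ) :
    flowN a c r 0 0 A t = -c * (t - 1) ^ 2 / (2 * a * t) := by
  have hac : (a : ℂ) ≠ 0 := ofReal_ne_zero.2 ha
  rw [flowN, deriv_flowPi_explicit ha ht, deriv_flowL_explicit ht, flowJ]
  field_simp
  ring

theorem norm_annulus_bounds (hs : 0 < s) (hs1 : s ≤ 1 / 4) (ht : t ∈ annulus (Real.exp s)) :
    |‖t‖ - ‖t‖⁻¹| ≤ 3 * s ∧ ‖t‖ + ‖t‖⁻¹ ≤ 4 := by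
  have hS := sinh_le_add_cube hs.le (by linarith)
  rw [Real.sinh_eq, Real.exp_neg] at hS
  have h3 : Real.exp s - (Real.exp s)⁻¹ ≤ 3 * s := by
    have : s ^ 3 ≤ s / 4 := by nlinarith [mul_pos hs hs]
    linarith
  have htp : 0 < ‖t‖ := norm_pos_iff.2 (ne_zero_of_mem_annulus (Real.exp_pos s) ht)
  have h4 := (inv_mem_annulus (Real.exp_pos s) ht).2
  have h5 := (inv_mem_annulus (Real.exp_pos s) ht).1
  rw [norm_inv] at h4 h5
  have h6 := ht.1
  have h7 := ht.2
  have h8 : (Real.exp s)⁻¹ ≤ 1 := inv_le_one_of_one_le₀ (Real.one_le_exp hs.le)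
  refine ⟨abs_le.2 ⟨by linarith, by linarith⟩, by linarith⟩

theorem norm_deriv_explicit_le (ha : 0 < a) (hs : 0 < s) (hs1 : s ≤ 1 / 4)
    (haR : R * s ≤ a) (hR : 0 < R) (hqs : q = Real.exp (2 * s))
    (ht : t ∈ annulus (Real.exp s)) (r : ℝ) (A : ℂ → ℂ) :
    |‖t‖ ^ 2 - 1| * ‖deriv (flowPi a (explicitX s q) r 0 A) t‖ ≤ 1 / (R * s) := by
  obtain ⟨h1, h2⟩ := norm_annulus_bounds hs hs1 ht
  have ht0 := ne_zero_of_mem_annulus (Real.exp_pos s) ht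
  have htp : 0 < ‖t‖ := norm_pos_iff.2 ht0
  have h3 := (abs_explicitX_bounds hs hs1 hqs).2
  rw [deriv_flowPi_explicit ha.ne' ht0, norm_mul, norm_div, norm_neg, norm_mul, norm_real,
    norm_real, Real.norm_eq_abs, Real.norm_eq_abs, abs_of_pos ha, norm_ofNat]
  have h4 : |‖t‖ ^ 2 - 1| = ‖t‖ * |‖t‖ - ‖t‖⁻¹| := by
    rw [← abs_of_pos htp, ← abs_mul, abs_of_pos htp]
    congr 1
    field_simp
  have h5 : ‖t‖ * ‖1 - (t ^ 2)⁻¹‖ ≤ 4 := by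
    have := norm_sub_le (1 : ℂ) (t ^ 2)⁻¹
    rw [norm_inv, norm_pow, norm_one] at this
    have h6 := mul_le_mul_of_nonneg_left this htp.le
    have h7 : ‖t‖ * (1 + (‖t‖ ^ 2)⁻¹) = ‖t‖ + ‖t‖⁻¹ := by field_simp
    linarith
  rw [h4]
  calc ‖t‖ * |‖t‖ - ‖t‖⁻¹| * (|explicitX s q| / (4 * a) * ‖1 - (t ^ 2)⁻¹‖)
      = |‖t‖ - ‖t‖⁻¹| * (|explicitX s q| / (4 * a)) * (‖t‖ * ‖1 - (t ^ 2)⁻¹‖) := by ring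
    _ ≤ 3 * s * (1 / (4 * s) / (4 * (R * s))) * 4 := by gcongr
    _ = 3 / 4 * (1 / (R * s)) := by field_simp
    _ ≤ 1 / (R * s) := by
      have : 0 < 1 / (R * s) := by positivity
      linarith

theorem norm_explicitQ_le (ha : 0 < a) (hs : 0 < s) (hs1 : s ≤ 1 / 4)
    (haR : R * s ≤ a) (hR : 0 < R) (hqs : q = Real.exp (2 * s))
    (hz : z ∈ bipolarDomain a (Real.exp s)) :
    ‖explicitQ a s q z‖ ≤ 2 / (R * s ^ 2) := by
  have hza := sub_ne_zero_of_mem_bipolarDomain (Real.exp_pos s) hz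
  have ht0 := ne_zero_of_mem_annulus (Real.exp_pos s) hz
  refine (norm_flowQ_le ha hza).trans ?_
  have h1 := norm_deriv_explicit_le ha hs hs1 haR hR hqs hz (explicitR a s q) (clampedSeries s q)
  obtain ⟨-, h2⟩ := norm_annulus_bounds hs hs1 hz
  have h3 := (abs_explicitX_bounds hs hs1 hqs).2
  rw [flowN_explicit ha.ne' ht0]
  set t := bipolar a z
  have htp : 0 < ‖t‖ := norm_pos_iff.2 ht0
  have h4 : ‖-(explicitX s q : ℂ) * (t - 1) ^ 2 / (2 * a * t)‖ ≤ 1 / (R * s ^ 2) := by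
    rw [norm_div, norm_mul, norm_neg, norm_mul, norm_mul, norm_pow, norm_real,
      norm_real, Real.norm_eq_abs, Real.norm_eq_abs, abs_of_pos ha, norm_ofNat]
    have h5 : ‖t - 1‖ ≤ ‖t‖ + 1 := by
      have := norm_sub_le t 1; rwa [norm_one] at this
    have h6 : ‖t - 1‖ ^ 2 / ‖t‖ ≤ 6 := by
      rw [div_le_iff₀ htp]
      have : ‖t‖⁻¹ * ‖t‖ = 1 := inv_mul_cancel₀ htp.ne'
      have h7 : ‖t - 1‖ ^ 2 ≤ (‖t‖ + 1) ^ 2 := by gcongr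
      nlinarith
    calc |explicitX s q| * ‖t - 1‖ ^ 2 / (2 * a * ‖t‖)
        = |explicitX s q| / (2 * a) * (‖t - 1‖ ^ 2 / ‖t‖) := by field_simp
      _ ≤ 1 / (4 * s) / (2 * (R * s)) * 6 := by gcongr
      _ = 3 / 4 * (1 / (R * s ^ 2)) := by field_simp; norm_num
      _ ≤ _ := by
        have : 0 < 1 / (R * s ^ 2) := by positivity
        linarith
  have h5 : 1 / (R * s) ≤ 1 / (R * s ^ 2) := by
    refine one_div_le_one_div_of_le (by positivity) ?_
    have : s ^ 2 ≤ s := by nlinarith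
    gcongr
  have h6 : 2 / (R * s ^ 2) = 1 / (R * s ^ 2) + 1 / (R * s ^ 2) := by ring
  linarith

/-- The imaginary part of t + t⁻¹ has the factor 1 − |t|⁻², which is O(s) on the annulus. This is
why the pressure is of order s⁻¹ although c/(4a) is of order s⁻². -/
theorem flowPi_explicit_im (c r : ℝ) (A : ℂ → ℂ) (ha : a ≠ 0) (ht : t ≠ 0) :
    (flowPi a c r 0 A t).im = -c / (4 * a) * (t.im * (1 - (‖t‖ ^ 2)⁻¹)) := by
  have hac : (a : ℂ) ≠ 0 := ofReal_ne_zero.2 ha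
  have h1 : flowPi a c r 0 A t = ((-c / (4 * a) : ℝ) : ℂ) * (t + t⁻¹ - 2) + r := by
    rw [flowPi]
    push_cast
    field_simp
    ring
  rw [h1, add_im, im_ofReal_mul, ofReal_im, sub_im, add_im, inv_im, normSq_eq_norm_sq,
    im_ofNat]
  ring

theorem abs_flowPi_explicit_im_le (ha : 0 < a) (hs : 0 < s) (hs1 : s ≤ 1 / 4)
    (haR : R * s ≤ a) (hR : 0 < R) (hqs : q = Real.exp (2 * s))
    (ht : t ∈ annulus (Real.exp s)) (r : ℝ) (A : ℂ → ℂ) :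
    |(flowPi a (explicitX s q) r 0 A t).im| ≤ 1 / (R * s) := by
  obtain ⟨h1, -⟩ := norm_annulus_bounds hs hs1 ht
  have ht0 := ne_zero_of_mem_annulus (Real.exp_pos s) ht
  have htp : 0 < ‖t‖ := norm_pos_iff.2 ht0
  have h3 := (abs_explicitX_bounds hs hs1 hqs).2
  rw [flowPi_explicit_im _ _ _ ha.ne' ht0, abs_mul, abs_mul, abs_div, abs_neg,
    abs_of_pos (by linarith : 0 < 4 * a)]
  have h4 : |t.im| * |1 - (‖t‖ ^ 2)⁻¹| ≤ 3 * s := by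
    calc |t.im| * |1 - (‖t‖ ^ 2)⁻¹| ≤ ‖t‖ * |1 - (‖t‖ ^ 2)⁻¹| := by
          gcongr; exact abs_im_le_norm t
      _ = |‖t‖ - ‖t‖⁻¹| := by
        nth_rw 1 [← abs_of_pos htp]
        rw [← abs_mul]
        congr 1
        field_simp
      _ ≤ 3 * s := h1
  calc |explicitX s q| / (4 * a) * (|t.im| * |1 - (‖t‖ ^ 2)⁻¹|)
      ≤ 1 / (4 * s) / (4 * (R * s)) * (3 * s) := by gcongr
    _ = 3 / 16 * (1 / (R * s)) := by field_simp; norm_num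
    _ ≤ 1 / (R * s) := by
      have : 0 < 1 / (R * s) := by positivity
      linarith

/-- The contribution of the clamped flow to the singular function is of order `s^(-1/2)`. -/
theorem exists_clamped_contribution_bound (hR : 0 < R) : ∃ W : ℝ, 0 < W ∧
    ∀ a s : ℝ, 0 < a → R * s ≤ a → 0 < s → s ≤ 1 / 4 → ∀ z ∈ bipolarDomain a (Real.exp s),
    ‖(clampedFactor a s (Real.exp (2 * s)) : ℂ) * clampedPi a s (Real.exp (2 * s)) (bipolar a z)‖ ≤
      W / √s ∧
    ‖(clampedFactor a s (Real.exp (2 * s)) : ℂ) * clampedQ a s (Real.exp (2 * s)) z‖ ≤ W / √s := by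
  obtain ⟨W, hW, hb⟩ := exists_flow_clamped_bound
  refine ⟨60 * W / R, by positivity, fun a s ha haR hs hs1 z hz => ?_⟩
  obtain ⟨h1, h2⟩ := hb a s ha hs (by linarith) z hz
  obtain ⟨h3, h4⟩ := clampedFactor_bounds ha hs hs1 rfl
  have hss : 0 < √s := Real.sqrt_pos.2 hs
  have hs2 : √s * √s = s := Real.mul_self_sqrt hs.le
  have key : ∀ w : ℂ, ‖w‖ ≤ W * (s * √s) / a ^ 2 →
      ‖(clampedFactor a s (Real.exp (2 * s)) : ℂ) * w‖ ≤ 60 * W / R / √s := by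
    intro w hw
    rw [norm_mul, norm_real, Real.norm_eq_abs, abs_of_nonneg h3]
    calc _ ≤ 60 * a / s * (W * (s * √s) / a ^ 2) := by gcongr
      _ = 60 * W * √s / a := by field_simp
      _ ≤ 60 * W * √s / (R * s) := by gcongr
      _ = 60 * W / R / √s := by
        rw [div_div, div_eq_div_iff (by positivity) (by positivity)]
        linear_combination 60 * W * R * hs2
  exact ⟨key _ h1, key _ h2⟩

end

end

section

open Complex ComplexConjugate Topology

section

variable {μ R a s q δ : ℝ} {z t : ℂ}

/-! ### The parameters -/

theorem delta_bounds (hR : 0 < R) (hs : 0 < s) (hs1 : s ≤ 1 / 4)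
    (hδ : δ = 2 * R * (Real.cosh s - 1)) : R * s ^ 2 ≤ δ ∧ δ ≤ 2 * R * s ^ 2 := by
  have h1 := one_add_half_sq_le_cosh s
  have h2 := cosh_le_one_add_sq (x := s) (by rw [abs_of_pos hs]; linarith)
  constructor
  · nlinarith
  · nlinarith

theorem exists_bipolar_parameter (hR : 0 < R) (hδ : 0 < δ) :
    ∃ s : ℝ, 0 < s ∧ δ = 2 * R * (Real.cosh s - 1) := by
  refine ⟨Real.arcosh (1 + δ / (2 * R)), Real.arcosh_pos ?_, ?_⟩
  · have : 0 < δ / (2 * R) := by positivity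
    linarith
  · rw [Real.cosh_arcosh]
    · field_simp
      ring
    · have : 0 < δ / (2 * R) := by positivity
      linarith

theorem focal_bounds (hR : 0 < R) (hs : 0 < s) (hs1 : s ≤ 1 / 4) (ha : a = R * Real.sinh s) :
    R * s ≤ a ∧ a ≤ 5 / 4 * (R * s) := by
  have h1 := Real.self_le_sinh_iff.2 hs.le
  have h2 := sinh_le_five_quarters hs hs1
  rw [ha]
  constructor <;> nlinarith

theorem rpow_neg_half (hδ : 0 < δ) : δ ^ (-(1 / 2) : ℝ) = (√δ)⁻¹ := by
  rw [Real.rpow_neg hδ.le, ← Real.sqrt_eq_rpow]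

/-! ### The narrow region -/

theorem flowN_explicit_bipolar (ha : a ≠ 0) (c r : ℝ) (A : ℂ → ℂ) (h1 : z - a ≠ 0)
    (h2 : z + a ≠ 0) : flowN a c r 0 0 A (bipolar a z) = 2 * a * c * (a ^ 2 - z ^ 2)⁻¹ := by
  have hac : (a : ℂ) ≠ 0 := ofReal_ne_zero.2 ha
  have ht : bipolar a z ≠ 0 := div_ne_zero h2 h1
  have h3 : (a : ℂ) ^ 2 - z ^ 2 ≠ 0 := by
    have : (a : ℂ) ^ 2 - z ^ 2 = -((z - a) * (z + a)) := by ring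
    rw [this]
    exact neg_ne_zero.2 (mul_ne_zero h1 h2)
  rw [flowN_explicit ha ht, bipolar_sub_one h1, bipolar]
  field_simp
  ring

/-- 2a times `explicitX` is −2R sinh s/(sinh 2s + 2s), and sinh 2s + 2s − 4 sinh s = O(s³), so the
limit −R/2 is reached with relative error O(s²). -/
theorem abs_explicit_factor_le (hR : 0 < R) (hs : 0 < s) (hs1 : s ≤ 1 / 4)
    (ha : a = R * Real.sinh s) (hqs : q = Real.exp (2 * s)) :
    |2 * a * explicitX s q + R / 2| ≤ R * s ^ 2 := by
  obtain ⟨h1, -⟩ := explicit_sum_bounds hs hs1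
  rw [explicitX_eq hqs]
  set σ := Real.sinh (2 * s) + 2 * s with hσ
  have hσ0 : 0 < σ := by linarith
  have h2 : 2 * a * -σ⁻¹ + R / 2 = R / 2 * (σ - 4 * Real.sinh s) / σ := by
    rw [ha]; field_simp; ring
  have h3 := sinh_le_five_quarters hs hs1
  have h4 := sinh_le_add_cube hs.le (by linarith)
  have h5 := Real.self_le_sinh_iff.2 hs.le
  have h6 := cosh_le_one_add_sq (x := s) (by rw [abs_of_pos hs]; linarith)
  have h7 := Real.one_le_cosh s
  have h8 : |σ - 4 * Real.sinh s| ≤ 5 / 2 * s ^ 3 := by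
    have h9 : σ - 4 * Real.sinh s =
        2 * (Real.sinh s * (Real.cosh s - 1)) - 2 * (Real.sinh s - s) := by
      rw [hσ, Real.sinh_two_mul]; ring
    have h10 : Real.sinh s * (Real.cosh s - 1) ≤ 5 / 4 * s * s ^ 2 :=
      mul_le_mul h3 (by linarith) (by linarith) (by positivity)
    have h11 : 0 ≤ Real.sinh s * (Real.cosh s - 1) := mul_nonneg (by linarith) (by linarith)
    have h12 : 0 < s ^ 3 := by positivity
    rw [h9, abs_le]
    constructor <;> nlinarith
  rw [h2, abs_div, abs_mul, abs_of_pos hσ0, abs_of_pos (by positivity : 0 < R / 2),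
    div_le_iff₀ hσ0]
  calc R / 2 * |σ - 4 * Real.sinh s| ≤ R / 2 * (5 / 2 * s ^ 3) := by gcongr
    _ ≤ R * s ^ 2 * (4 * s) := by
      have : 0 < R * s ^ 3 := by positivity
      nlinarith
    _ ≤ R * s ^ 2 * σ := by gcongr

/-- In the gap x is small compared with a, so z² is close to −y²; the numerator of the difference is
x(x + 2iy). -/
theorem norm_inv_sub_inv_le {P x y : ℝ} (hP : 0 < P) (hPa : P = a ^ 2 + y ^ 2)
    (hx : x ^ 2 ≤ P / 2) (hz : z = x + y * I) :
    ‖((a : ℂ) ^ 2 - z ^ 2)⁻¹ - (P : ℂ)⁻¹‖ ≤ 2 * (|x| * (|x| + 2 * |y|)) / P ^ 2 := by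
  have hre : ((a : ℂ) ^ 2 - z ^ 2).re = P - x ^ 2 := by
    rw [hz, hPa]; simp [pow_two]; ring
  have h1 : P / 2 ≤ ‖(a : ℂ) ^ 2 - z ^ 2‖ :=
    calc P / 2 ≤ ((a : ℂ) ^ 2 - z ^ 2).re := by rw [hre]; linarith
      _ ≤ _ := re_le_norm _
  have h2 : (a : ℂ) ^ 2 - z ^ 2 ≠ 0 := by
    rw [← norm_pos_iff]; linarith
  have hPc : (P : ℂ) ≠ 0 := ofReal_ne_zero.2 hP.ne'
  have h3 : ((a : ℂ) ^ 2 - z ^ 2)⁻¹ - (P : ℂ)⁻¹ =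
      x * (x + 2 * y * I) / (((a : ℂ) ^ 2 - z ^ 2) * P) := by
    rw [inv_sub_inv h2 hPc, hz, hPa]
    congr 1
    push_cast
    linear_combination ((y : ℂ) ^ 2) * I_sq
  have h4 : ‖(x : ℂ) + 2 * y * I‖ ≤ |x| + 2 * |y| := by
    refine (norm_add_le _ _).trans ?_
    simp
  rw [h3, norm_div, norm_mul, norm_mul, norm_real, norm_real, Real.norm_eq_abs, Real.norm_eq_abs,
    abs_of_pos hP, div_le_div_iff₀ (by positivity) (by positivity)]
  calc |x| * ‖(x : ℂ) + 2 * y * I‖ * P ^ 2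
      ≤ |x| * (|x| + 2 * |y|) * P ^ 2 := by gcongr
    _ = 2 * (|x| * (|x| + 2 * |y|)) * (P / 2 * P) := by ring
    _ ≤ _ := by gcongr

theorem norm_flowN_explicit_sub_le (hR : 0 < R) (hs : 0 < s) (hs1 : s ≤ 1 / 4)
    (hsR : (R + 2) * s ≤ R / 2) (ha : a = R * Real.sinh s)
    (hδ : δ = 2 * R * (Real.cosh s - 1)) (hqs : q = Real.exp (2 * s))
    (hz : z ∈ bipolarDomain a (Real.exp s)) (hx : |z.re| ≤ (R + 2) * s ^ 2)
    (hy : z.im ^ 2 ≤ δ) (r : ℝ) (A : ℂ → ℂ) :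
    ‖flowN a (explicitX s q) r 0 0 A (bipolar a z) -
      ((-(R / (2 * (z.im ^ 2 + R * δ))) : ℝ) : ℂ)‖ ≤
      (6 * (R + 2) ^ 2 / R ^ 3 + 2 / R) / s := by
  obtain ⟨hδ1, hδ2⟩ := delta_bounds hR hs hs1 hδ
  obtain ⟨ha1, ha2⟩ := focal_bounds hR hs hs1 ha
  have hRs : 0 < R * s := by positivity
  have ha0 : 0 < a := by linarith
  have hδ0 : 0 < δ := lt_of_lt_of_le (by positivity) hδ1
  have hid : a ^ 2 = R * δ + δ ^ 2 / 4 := by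
    rw [ha, hδ]
    linear_combination R ^ 2 * (-(Real.cosh_sq_sub_sinh_sq s))
  set x := z.re
  set y := z.im
  set P := a ^ 2 + y ^ 2 with hP
  have hP1 : R ^ 2 * s ^ 2 ≤ P := by
    have : (R * s) ^ 2 ≤ a ^ 2 := by gcongr
    nlinarith [sq_nonneg y]
  have hP0 : 0 < P := lt_of_lt_of_le (by positivity) hP1
  have hx1 : |x| ≤ R / 2 * s := by nlinarith
  have hx2 : x ^ 2 ≤ P / 2 := by
    have : |x| ^ 2 ≤ (R / 2 * s) ^ 2 := by gcongr
    rw [sq_abs] at this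
    nlinarith
  have hy1 : |y| ≤ (1 + R) * s := by
    refine abs_le_of_sq_le_sq ?_ (by positivity)
    have : 0 ≤ (1 + R ^ 2) * s ^ 2 := by positivity
    nlinarith
  have hN := flowN_explicit_bipolar ha0.ne' (explicitX s q) r A
    (sub_ne_zero_of_mem_bipolarDomain (Real.exp_pos s) hz)
    (add_ne_zero_of_mem_bipolarDomain (Real.exp_pos s) hz)
  set X := explicitX s q
  have hD : 0 < y ^ 2 + R * δ := by positivity
  -- Three replacements: a² − z² by P = a² + y², the factor 2aX by −R/2, and a² by Rδ, using a² = Rδ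
  -- + δ²/4. The first costs O(1/s), the other two O(1).
  have hsplit : flowN a X r 0 0 A (bipolar a z) - ((-(R / (2 * (y ^ 2 + R * δ))) : ℝ) : ℂ) =
      ((2 * a * X : ℝ) : ℂ) * (((a : ℂ) ^ 2 - z ^ 2)⁻¹ - (P : ℂ)⁻¹) +
        (((2 * a * X + R / 2) / P - R / 2 * (P⁻¹ - (y ^ 2 + R * δ)⁻¹) : ℝ) : ℂ) := by
    rw [hN]
    have : -(R / (2 * (y ^ 2 + R * δ))) = -(R / 2) * (y ^ 2 + R * δ)⁻¹ := by field_simp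
    rw [this]
    push_cast
    ring
  have hX := (abs_explicitX_bounds hs hs1 hqs).2
  have t1 : ‖((2 * a * X : ℝ) : ℂ) * (((a : ℂ) ^ 2 - z ^ 2)⁻¹ - (P : ℂ)⁻¹)‖ ≤
      6 * (R + 2) ^ 2 / R ^ 3 / s := by
    rw [norm_mul, norm_real, Real.norm_eq_abs, abs_mul, abs_of_pos (by linarith : 0 < 2 * a)]
    have h1 := norm_inv_sub_inv_le (a := a) hP0 rfl hx2 (re_add_im z).symm
    have h2 : |x| + 2 * |y| ≤ 3 * (R + 2) * s := by nlinarith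
    have h3 : 2 * a * |X| ≤ R := by
      calc 2 * a * |X| ≤ 2 * (5 / 4 * (R * s)) * (1 / (4 * s)) := by gcongr
        _ = 5 / 8 * R := by field_simp; norm_num
        _ ≤ R := by linarith
    calc 2 * a * |X| * ‖((a : ℂ) ^ 2 - z ^ 2)⁻¹ - (P : ℂ)⁻¹‖
        ≤ R * (2 * (|x| * (|x| + 2 * |y|)) / P ^ 2) := by gcongr
      _ ≤ R * (2 * ((R + 2) * s ^ 2 * (3 * (R + 2) * s)) / (R ^ 2 * s ^ 2) ^ 2) := by gcongr
      _ = 6 * (R + 2) ^ 2 / R ^ 3 / s := by field_simp; norm_num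
  have t2 : |(2 * a * X + R / 2) / P| ≤ 1 / R := by
    rw [abs_div, abs_of_pos hP0]
    calc _ ≤ R * s ^ 2 / (R ^ 2 * s ^ 2) := by
          gcongr; exact abs_explicit_factor_le hR hs hs1 ha hqs
      _ = 1 / R := by field_simp
  have t3 : |R / 2 * (P⁻¹ - (y ^ 2 + R * δ)⁻¹)| ≤ 1 / R := by
    have h1 : R / 2 * (P⁻¹ - (y ^ 2 + R * δ)⁻¹) =
        -(R * δ ^ 2 / 8 / (P * (y ^ 2 + R * δ))) := by
      rw [inv_sub_inv hP0.ne' hD.ne', hP, hid]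
      field_simp
      ring
    rw [h1, abs_neg, abs_of_nonneg (by positivity)]
    calc R * δ ^ 2 / 8 / (P * (y ^ 2 + R * δ)) ≤ R * δ ^ 2 / 8 / (R ^ 2 * s ^ 2 * (R * δ)) := by
          gcongr; nlinarith [sq_nonneg y]
      _ = δ / (8 * (R ^ 2 * s ^ 2)) := by field_simp
      _ ≤ 2 * R * s ^ 2 / (8 * (R ^ 2 * s ^ 2)) := by gcongr
      _ = 1 / 4 * (1 / R) := by field_simp; norm_num
      _ ≤ 1 / R := by
        have : 0 < 1 / R := by positivity
        linarith
  rw [hsplit]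
  refine (norm_add_le _ _).trans ?_
  rw [norm_real, Real.norm_eq_abs]
  have h5 := abs_sub ((2 * a * X + R / 2) / P) (R / 2 * (P⁻¹ - (y ^ 2 + R * δ)⁻¹))
  have h6 : 2 / R ≤ 2 / R / s := by
    rw [le_div_iff₀ hs]
    have : 0 < 2 / R := by positivity
    nlinarith
  have h7 : 2 / R = 1 / R + 1 / R := by ring
  rw [add_div (6 * (R + 2) ^ 2 / R ^ 3)]
  linarith

/-- At height |y| ≤ √δ a circle has receded from its nearest point by only about y²/(2R), so the gap
still has width O(δ), that is O(s²). -/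
theorem abs_le_of_mem_narrowRegion (hR : 0 < R) (hs : 0 < s) (hs1 : s ≤ 1 / 4)
    (hsR : (R + 2) * s ≤ R / 2) (hδ : δ = 2 * R * (Real.cosh s - 1)) {p : Plane}
    (hp : p ∈ narrowRegion R δ) : |p 0| ≤ (R + 2) * s ^ 2 ∧ p 1 ^ 2 ≤ δ := by
  obtain ⟨hδ1, hδ2⟩ := delta_bounds hR hs hs1 hδ
  have hδ0 : 0 < δ := lt_of_lt_of_le (by positivity) hδ1
  obtain ⟨⟨hx, hy⟩, hext⟩ := hp
  rw [mem_exteriorDomain_iff hR] at hext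
  have hy2 : p 1 ^ 2 ≤ δ := by
    have := sq_le_sq.2 ((abs_le.2 hy).trans (le_abs_self _))
    rwa [Real.sq_sqrt hδ0.le] at this
  refine ⟨?_, hy2⟩
  have hδR : δ ≤ R ^ 2 := by nlinarith
  have key : ∀ u : ℝ, 0 ≤ u → R ^ 2 < u ^ 2 + p 1 ^ 2 → R - u ≤ δ / R := by
    intro u hu h
    rw [le_div_iff₀ hR]
    nlinarith
  have h1 := key (R + δ / 2 + p 0) (by linarith [hx.1]) (by nlinarith [hext])
  have h2 := key (R + δ / 2 - p 0) (by linarith [hx.2]) (by nlinarith [hext])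
  have h3 : δ / R ≤ 2 * s ^ 2 := by rw [div_le_iff₀ hR]; linarith
  rw [abs_le]
  constructor <;> nlinarith

end

end

section

open Complex ComplexConjugate Topology

/-! ### The Frobenius norm of a `2 × 2` matrix -/

theorem frobenius_norm_two (a b c d : ℝ) :
    ‖!![a, b; c, d]‖ = √(a ^ 2 + b ^ 2 + (c ^ 2 + d ^ 2)) := by
  rw [Matrix.frobenius_norm_def, ← Real.sqrt_eq_rpow]
  simp

theorem frobenius_norm_two_le (a b : ℝ) {c d M N : ℝ} (ha : |a| ≤ M) (hb : |b| ≤ N) (hc : |c| ≤ N)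
    (hd : |d| ≤ M) : ‖!![a, b; c, d]‖ ≤ 2 * (M + N) := by
  have hM : 0 ≤ M := (abs_nonneg a).trans ha
  have hN : 0 ≤ N := (abs_nonneg b).trans hb
  rw [frobenius_norm_two]
  refine Real.sqrt_le_iff.2 ⟨by positivity, ?_⟩
  have h1 := sq_le_sq' (abs_le.1 ha).1 (abs_le.1 ha).2
  have h2 := sq_le_sq' (abs_le.1 hb).1 (abs_le.1 hb).2
  have h3 := sq_le_sq' (abs_le.1 hc).1 (abs_le.1 hc).2
  have h4 := sq_le_sq' (abs_le.1 hd).1 (abs_le.1 hd).2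
  nlinarith [mul_nonneg hM hN]

theorem le_frobenius_norm_two (a b c d : ℝ) : |b| ≤ ‖!![a, b; c, d]‖ := by
  rw [frobenius_norm_two]
  refine Real.abs_le_sqrt ?_
  nlinarith [sq_nonneg a, sq_nonneg c, sq_nonneg d]

/-! ### The supremum norm -/

theorem supNorm_le {F : Type*} [NormedAddCommGroup F] {Ω : Set Plane} {f : Plane → F} {C : ℝ}
    (h : ∀ x ∈ Ω, ‖f x‖ ≤ C) : supNorm Ω f ≤ ENNReal.ofReal C :=
  iSup₂_le fun x hx => by
    rw [← ofReal_norm]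
    exact ENNReal.ofReal_le_ofReal (h x hx)

theorem le_supNorm {F : Type*} [NormedAddCommGroup F] {Ω : Set Plane} {f : Plane → F} {c : ℝ}
    {x : Plane} (hx : x ∈ Ω) (h : c ≤ ‖f x‖) : ENNReal.ofReal c ≤ supNorm Ω f := by
  refine le_trans ?_ (le_iSup₂ (f := fun z (_ : z ∈ Ω) => ‖f z‖ₑ) x hx)
  rw [← ofReal_norm]
  exact ENNReal.ofReal_le_ofReal h

/-! ### Estimates for the strain and the pressure -/

/-- The conjugate of the derivative of the singular function with respect to `z̄`. -/
def singularQ (a s q : ℝ) (z : ℂ) : ℂ :=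
  explicitQ a s q z + clampedFactor a s q * clampedQ a s q z

section

variable {μ R a s q δ W : ℝ} {z t : ℂ} {x : Plane}

theorem strain_singular (ha : 0 < a) (hq : 1 < q) (hx : planeEquiv.symm x ∈ bipolarDomain a q) :
    strain (planeVelocity (singularV a s q)) x =
      !![-(singularQ a s q (planeEquiv.symm x)).im, -(singularQ a s q (planeEquiv.symm x)).re;
        -(singularQ a s q (planeEquiv.symm x)).re, (singularQ a s q (planeEquiv.symm x)).im] := by
  obtain ⟨α, hα, h⟩ := hasFDerivAt_singularV (s := s) ha hq hx
  rw [strain_planeVelocity hα h, conj_im, conj_re, neg_neg]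
  rfl

theorem one_div_sqrt_le (hs : 0 < s) (hs1 : s ≤ 1 / 4) (hW : 0 ≤ W) : W / √s ≤ W / s := by
  have : s ≤ √s := Real.le_sqrt_of_sq_le (by nlinarith)
  gcongr

theorem norm_singularQ_le (ha : 0 < a) (hs : 0 < s) (hs1 : s ≤ 1 / 4) (haR : R * s ≤ a)
    (hR : 0 < R) (hqs : q = Real.exp (2 * s)) (hz : z ∈ bipolarDomain a (Real.exp s))
    (hW : 0 ≤ W) (hb : ‖(clampedFactor a s q : ℂ) * clampedQ a s q z‖ ≤ W / √s) :
    ‖singularQ a s q z‖ ≤ (2 / R + W) / s ^ 2 := by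
  have h1 := norm_explicitQ_le ha hs hs1 haR hR hqs hz
  have h2 := one_div_sqrt_le hs hs1 hW
  have h3 : W / s ≤ W / s ^ 2 := by
    have : s ^ 2 ≤ s := by nlinarith
    gcongr
  have h4 : (2 / R + W) / s ^ 2 = 2 / (R * s ^ 2) + W / s ^ 2 := by field_simp
  refine (norm_add_le _ _).trans ?_
  linarith

theorem abs_singularPi_im_le (ha : 0 < a) (hs : 0 < s) (hs1 : s ≤ 1 / 4) (haR : R * s ≤ a)
    (hR : 0 < R) (hqs : q = Real.exp (2 * s)) (ht : t ∈ annulus (Real.exp s))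
    (hW : 0 ≤ W) (hb : ‖(clampedFactor a s q : ℂ) * clampedPi a s q t‖ ≤ W / √s) :
    |(singularPi a s q t).im| ≤ (1 / R + W) / s := by
  have h1 := abs_flowPi_explicit_im_le ha hs hs1 haR hR hqs ht (explicitR a s q)
    (clampedSeries s q)
  have h2 := one_div_sqrt_le hs hs1 hW
  have h3 := abs_im_le_norm ((clampedFactor a s q : ℂ) * clampedPi a s q t)
  have h4 : (1 / R + W) / s = 1 / (R * s) + W / s := by field_simp
  rw [singularPi_eq, add_im]
  refine (abs_add_le _ _).trans ?_
  linarith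

theorem zero_mem_bipolarDomain (ha : a ≠ 0) (hq : 1 < q) : (0 : ℂ) ∈ bipolarDomain a q := by
  have h : bipolar a 0 = -1 := by
    have : (a : ℂ) ≠ 0 := ofReal_ne_zero.2 ha
    rw [bipolar]; field_simp; simp
  rw [bipolarDomain, Set.mem_preimage, h]
  simpa [annulus] using ⟨inv_lt_one_of_one_lt₀ hq, hq⟩

/-- The test point is the centre of the gap, where Re z = 0 removes the non-holomorphic term of Q.
The explicit value is at least twice the claimed bound; the other half absorbs the clamped part. -/
theorem le_abs_singularQ_zero_re (hs : 0 < s) (hs1 : s ≤ 1 / 4) (hR : 0 < R)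
    (ha : a = R * Real.sinh s) (hqs : q = Real.exp (2 * s)) (hW : 0 ≤ W)
    (hsW : 25 * R * W * s ≤ 4)
    (hb : ‖(clampedFactor a s q : ℂ) * clampedQ a s q 0‖ ≤ W / √s) :
    4 / (25 * R) / s ^ 2 ≤ |(singularQ a s q 0).re| := by
  obtain ⟨ha1, ha2⟩ := focal_bounds hR hs hs1 ha
  have ha0 : 0 < a := lt_of_lt_of_le (by positivity) ha1
  have hac : (a : ℂ) ≠ 0 := ofReal_ne_zero.2 ha0.ne'
  have h1 : explicitQ a s q 0 = ((2 * explicitX s q / a : ℝ) : ℂ) := by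
    rw [explicitQ, flowQ, flowN_explicit_bipolar ha0.ne' _ _ _ (by simpa using hac)
      (by simpa using hac)]
    push_cast
    rw [zero_re]
    field_simp
    simp
    ring
  have h2 := (abs_explicitX_bounds hs hs1 hqs).1
  have h3 := one_div_sqrt_le hs hs1 hW
  have h4 := abs_re_le_norm ((clampedFactor a s q : ℂ) * clampedQ a s q 0)
  have h5 : W / s ≤ 4 / (25 * R) / s ^ 2 := by
    rw [div_div, div_le_div_iff₀ hs (by positivity)]
    nlinarith
  have h6 : 2 * (4 / (25 * R) / s ^ 2) ≤ |2 * explicitX s q / a| := by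
    rw [abs_div, abs_mul, abs_of_pos ha0, abs_two]
    calc 2 * (4 / (25 * R) / s ^ 2) = 2 * (1 / (5 * s)) / (5 / 4 * (R * s)) := by
          field_simp; norm_num
      _ ≤ _ := by gcongr
  rw [singularQ, add_re, h1, ofReal_re]
  have h7 := abs_sub_abs_le_abs_sub (2 * explicitX s q / a)
    (-((clampedFactor a s q : ℂ) * clampedQ a s q 0).re)
  rw [abs_neg, sub_neg_eq_add] at h7
  linarith

theorem half_exp_mem_annulus (hs : 0 < s) :
    ((Real.exp (s / 2) : ℝ) : ℂ) * I ∈ annulus (Real.exp s) := by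
  have h : ‖((Real.exp (s / 2) : ℝ) : ℂ) * I‖ = Real.exp (s / 2) := by
    rw [norm_mul, norm_I, mul_one, norm_real, Real.norm_eq_abs, Real.abs_exp]
  rw [annulus, Set.mem_ofPred_eq, h, ← Real.exp_neg]
  exact ⟨Real.exp_lt_exp.2 (by linarith), Real.exp_lt_exp.2 (by linarith)⟩

/-- The pressure of the explicit part vanishes for |t| = 1 and for real t. The test point i e^(s/2)
avoids both, and there Im(t + t⁻¹) = 2 sinh(s/2) ≥ s. -/
theorem le_abs_singularPi_im (hs : 0 < s) (hs1 : s ≤ 1 / 4) (hR : 0 < R)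
    (ha : a = R * Real.sinh s) (hqs : q = Real.exp (2 * s)) 
    (hsW : 50 * R * W * √s ≤ 1)
    (hb : ‖(clampedFactor a s q : ℂ) * clampedPi a s q (((Real.exp (s / 2) : ℝ) : ℂ) * I)‖ ≤
      W / √s) :
    1 / (50 * R) / s ≤ |(singularPi a s q (((Real.exp (s / 2) : ℝ) : ℂ) * I)).im| := by
  obtain ⟨ha1, ha2⟩ := focal_bounds hR hs hs1 ha
  have ha0 : 0 < a := lt_of_lt_of_le (by positivity) ha1
  have ht0 := ne_zero_of_mem_annulus (Real.exp_pos s) (half_exp_mem_annulus hs)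
  have h1 := flowPi_explicit_im (explicitX s q) (explicitR a s q) (clampedSeries s q) ha0.ne' ht0
  have hex := Real.exp_pos (s / 2)
  have h2 : (((Real.exp (s / 2) : ℝ) : ℂ) * I).im *
      (1 - (‖((Real.exp (s / 2) : ℝ) : ℂ) * I‖ ^ 2)⁻¹) = 2 * Real.sinh (s / 2) := by
    rw [norm_mul, norm_I, mul_one, norm_real, Real.norm_eq_abs, Real.abs_exp, im_ofReal_mul, I_im,
      Real.sinh_eq, Real.exp_neg]
    field_simp
  rw [h2] at h1
  have h3 := (abs_explicitX_bounds hs hs1 hqs).1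
  have h4 := abs_im_le_norm ((clampedFactor a s q : ℂ) *
    clampedPi a s q (((Real.exp (s / 2) : ℝ) : ℂ) * I))
  have hss : 0 < √s := Real.sqrt_pos.2 hs
  have h5 : W / √s ≤ 1 / (50 * R) / s := by
    rw [div_div, div_le_div_iff₀ hss (by positivity)]
    have h6 := Real.mul_self_sqrt hs.le
    nlinarith
  have h6 := Real.self_le_sinh_iff.2 (by linarith : 0 ≤ s / 2)
  have h7 : 2 * (1 / (50 * R) / s) ≤
      |-explicitX s q / (4 * a) * (2 * Real.sinh (s / 2))| := by
    rw [abs_mul, abs_div, abs_neg, abs_of_pos (by linarith : 0 < 4 * a),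
      abs_of_pos (by linarith : 0 < 2 * Real.sinh (s / 2))]
    calc 2 * (1 / (50 * R) / s) = 1 / (5 * s) / (4 * (5 / 4 * (R * s))) * (2 * (s / 2)) := by
          field_simp; norm_num
      _ ≤ _ := by gcongr
  rw [singularPi_eq, add_im, h1]
  have h8 := abs_sub_abs_le_abs_sub (-explicitX s q / (4 * a) * (2 * Real.sinh (s / 2)))
    (-((clampedFactor a s q : ℂ) * clampedPi a s q (((Real.exp (s / 2) : ℝ) : ℂ) * I)).im)
  rw [abs_neg, sub_neg_eq_add] at h8
  linarith

theorem norm_singularQ_sub_le (hR : 0 < R) (hs : 0 < s) (hs1 : s ≤ 1 / 4)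
    (hsR : (R + 2) * s ≤ R / 2) (ha : a = R * Real.sinh s)
    (hδ : δ = 2 * R * (Real.cosh s - 1)) (hqs : q = Real.exp (2 * s))
    (hz : z ∈ bipolarDomain a (Real.exp s)) (hx : |z.re| ≤ (R + 2) * s ^ 2)
    (hy : z.im ^ 2 ≤ δ) (hW : 0 ≤ W)
    (hb : ‖(clampedFactor a s q : ℂ) * clampedQ a s q z‖ ≤ W / √s) :
    ‖singularQ a s q z - ((-(R / (2 * (z.im ^ 2 + R * δ))) : ℝ) : ℂ)‖ ≤
      (6 * (R + 2) ^ 2 / R ^ 3 + 3 / R + W) / s := by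
  obtain ⟨ha1, -⟩ := focal_bounds hR hs hs1 ha
  have ha0 : 0 < a := lt_of_lt_of_le (by positivity) ha1
  have h1 := norm_flowN_explicit_sub_le hR hs hs1 hsR ha hδ hqs hz hx hy (explicitR a s q)
    (clampedSeries s q)
  have h2 := norm_deriv_explicit_le ha0 hs hs1 ha1 hR hqs hz (explicitR a s q) (clampedSeries s q)
  have h3 := one_div_sqrt_le hs hs1 hW
  have hza := sub_ne_zero_of_mem_bipolarDomain (Real.exp_pos s) hz
  rw [← norm_re_mul_eq ha0 hza, ← norm_mul] at h2
  have h4 : ∀ m : ℂ, singularQ a s q z - m =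
      (flowN a (explicitX s q) (explicitR a s q) 0 0 (clampedSeries s q) (bipolar a z) - m) +
      2 * (z.re : ℂ) * (-(2 * a) / (z - a) ^ 2) *
        deriv (flowPi a (explicitX s q) (explicitR a s q) 0 (clampedSeries s q)) (bipolar a z) +
      (clampedFactor a s q : ℂ) * clampedQ a s q z := by
    intro m
    rw [singularQ, explicitQ, flowQ]
    ring
  rw [h4]
  refine (norm_add₃_le).trans ?_
  have h5 : (6 * (R + 2) ^ 2 / R ^ 3 + 3 / R + W) / s =
      (6 * (R + 2) ^ 2 / R ^ 3 + 2 / R) / s + 1 / (R * s) + W / s := by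
    field_simp; ring
  linarith

/-- The estimates for the singular function in terms of the bipolar parameter `s`. -/
theorem exists_singularFunctionTwo_bounds (hμ : 0 < μ) (hR : 0 < R) : ∃ s₀ c C : ℝ,
    0 < s₀ ∧ s₀ ≤ 1 / 4 ∧ 0 < c ∧ 0 < C ∧
    ∀ s δ : ℝ, 0 < s → s ≤ s₀ → δ = 2 * R * (Real.cosh s - 1) →
      ∃ (h₂ : Plane → Plane) (p₂ : Plane → ℝ), IsSingularFunctionTwo μ R δ h₂ p₂ ∧
        (∃ x ∈ exteriorDomain R δ, c / s ^ 2 ≤ ‖strain h₂ x‖) ∧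
        (∀ x ∈ exteriorDomain R δ, ‖strain h₂ x‖ ≤ C / s ^ 2) ∧
        (∃ x ∈ exteriorDomain R δ, c / s ≤ ‖p₂ x‖) ∧
        (∀ x ∈ exteriorDomain R δ, ‖p₂ x‖ ≤ C / s) ∧
        ∀ x ∈ narrowRegion R δ, ‖stress μ h₂ p₂ x -
          (μ * δ⁻¹ * (R * δ / (x 1 ^ 2 + R * δ))) • !![(0 : ℝ), 1; 1, 0]‖ ≤ C / s := by
  obtain ⟨W, hW, hb⟩ := exists_clamped_contribution_bound hR
  set K := 6 * (R + 2) ^ 2 / R ^ 3 + 3 / R + W with hK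
  have hK0 : 0 < K := by positivity
  -- The four thresholds serve, in order, the hyperbolic inequalities, the approximation in the gap,
  -- and the absorption of the clamped part in the lower bounds for the strain and for the pressure.
  refine ⟨min (1 / 4) (min (R / 2 / (R + 2)) (min (4 / (25 * R * W)) (1 / (50 * R * W) ^ 2))),
    min (4 / (25 * R)) (4 * μ * (1 / (50 * R))),
    4 * (2 / R + W) + 8 * μ * (1 / R + W) + 8 * μ * K, by positivity, min_le_left _ _,
    by positivity, by positivity, fun s δ hs hss hδ => ?_⟩
  simp only [le_min_iff] at hss
  obtain ⟨hs1, hs2, hs3, hs4⟩ := hss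
  rw [le_div_iff₀ (by positivity)] at hs2 hs3 hs4
  have hs4' : 50 * R * W * √s ≤ 1 := by
    refine le_of_sq_le_sq ?_ zero_le_one
    rw [mul_pow, Real.sq_sqrt hs.le]
    linarith
  obtain ⟨q, hqs⟩ : ∃ q, q = Real.exp (2 * s) := ⟨_, rfl⟩
  obtain ⟨a, ha⟩ : ∃ a, a = R * Real.sinh s := ⟨_, rfl⟩
  obtain ⟨ha1, -⟩ := focal_bounds hR hs hs1 ha
  have ha0 : 0 < a := lt_of_lt_of_le (by positivity) ha1
  have hb' := hb a s ha0 ha1 hs hs1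
  rw [← hqs] at hb'
  have he : 1 < Real.exp s := Real.one_lt_exp_iff.2 hs
  have heq : Real.exp s ≤ q := by rw [hqs]; exact Real.exp_le_exp.2 (by linarith)
  have hmem := mem_exteriorDomain_iff_bipolar hR hs ha hδ
  have hdom : ∀ z ∈ bipolarDomain a (Real.exp s), z ∈ bipolarDomain a q := fun z hz =>
    ⟨(inv_anti₀ (Real.exp_pos s) heq).trans_lt hz.1, hz.2.trans_le heq⟩
  have hstrain : ∀ x ∈ exteriorDomain R δ, _ := fun x hx =>
    strain_singular (s := s) ha0 (he.trans_le heq) (hdom _ ((hmem x).1 hx))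
  have hp : ∀ x ∈ exteriorDomain R δ,
      |planePressure μ (fun z => singularPi a s q (bipolar a z)) x| ≤
        4 * μ * ((1 / R + W) / s) := by
    intro x hx
    have hz := (hmem x).1 hx
    rw [planePressure, abs_mul, abs_neg, abs_of_pos (by positivity : 0 < 4 * μ)]
    gcongr
    exact abs_singularPi_im_le ha0 hs hs1 ha1 hR hqs hz hW.le (hb' _ hz).1
  have hC : ∀ D E : ℝ, 0 < E → D ≤ 4 * (2 / R + W) + 8 * μ * (1 / R + W) + 8 * μ * K →
      D / E ≤ (4 * (2 / R + W) + 8 * μ * (1 / R + W) + 8 * μ * K) / E := by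
    intro D E hE hD
    gcongr
  have hpos1 : 0 < 4 * (2 / R + W) := by positivity
  have hpos2 : 0 < 4 * μ * (1 / R + W) := by positivity
  have hpos3 : 0 < 8 * μ * K := by positivity
  refine ⟨planeVelocity (singularV a s q),
    planePressure μ fun z => singularPi a s q (bipolar a z),
    isSingularFunctionTwo_singularV hR hs hs1 ha hδ hqs, ?_, ?_, ?_, ?_, ?_⟩
  · have hz := zero_mem_bipolarDomain ha0.ne' he
    have hx : planeEquiv 0 ∈ exteriorDomain R δ := by
      rwa [hmem, planeEquiv.symm_apply_apply]
    refine ⟨_, hx, ?_⟩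
    have h1 := le_abs_singularQ_zero_re hs hs1 hR ha hqs hW.le (by linarith) (hb' _ hz).2
    rw [hstrain _ hx, planeEquiv.symm_apply_apply]
    refine le_trans ?_ (le_frobenius_norm_two _ _ _ _)
    rw [abs_neg]
    refine le_trans ?_ h1
    gcongr
    exact min_le_left _ _
  · intro x hx
    have hz := (hmem x).1 hx
    have h1 := norm_singularQ_le ha0 hs hs1 ha1 hR hqs hz hW.le (hb' _ hz).2
    rw [hstrain x hx]
    have h2 := (abs_re_le_norm (singularQ a s q (planeEquiv.symm x))).trans h1
    have h3 := (abs_im_le_norm (singularQ a s q (planeEquiv.symm x))).trans h1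
    refine (frobenius_norm_two_le _ _ ((abs_neg _).trans_le h3) ((abs_neg _).trans_le h2)
      ((abs_neg _).trans_le h2) h3).trans ?_
    refine le_trans (le_of_eq ?_) (hC (4 * (2 / R + W)) (s ^ 2) (by positivity) (by linarith))
    ring
  · have ht := half_exp_mem_annulus hs
    set t : ℂ := ((Real.exp (s / 2) : ℝ) : ℂ) * I with htd
    have ht1 : t ≠ 1 := by
      intro h
      have := congrArg Complex.im h
      rw [htd, im_ofReal_mul, I_im, one_im, mul_one] at this
      exact (Real.exp_pos _).ne' this
    have hbt := bipolar_bipolarInv ha0.ne' ht1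
    have hz : bipolarInv a t ∈ bipolarDomain a (Real.exp s) := by
      rw [bipolarDomain, Set.mem_preimage, hbt]; exact ht
    have h1 := (hb' _ hz).1
    rw [hbt] at h1
    have h2 := le_abs_singularPi_im hs hs1 hR ha hqs hs4' h1
    refine ⟨planeEquiv (bipolarInv a t), by rwa [hmem, planeEquiv.symm_apply_apply], ?_⟩
    rw [planePressure, planeEquiv.symm_apply_apply, hbt, Real.norm_eq_abs, abs_mul, abs_neg,
      abs_of_pos (by positivity : 0 < 4 * μ)]
    calc _ ≤ 4 * μ * (1 / (50 * R)) / s := by gcongr; exact min_le_right _ _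
      _ = 4 * μ * (1 / (50 * R) / s) := by ring
      _ ≤ _ := by gcongr
  · intro x hx
    refine (hp x hx).trans ((le_of_eq ?_).trans (hC (4 * μ * (1 / R + W)) s hs (by linarith)))
    ring
  · intro x hx
    obtain ⟨h1, h2⟩ := abs_le_of_mem_narrowRegion hR hs hs1 (by linarith) hδ hx
    have hx' := hx.2
    have hz := (hmem x).1 hx'
    have h3 := hp x hx'
    have hδ0 : 0 < δ := lt_of_lt_of_le (by positivity) (delta_bounds hR hs hs1 hδ).1
    obtain ⟨z, rfl⟩ := planeEquiv.surjective x
    rw [planeEquiv_apply_zero] at h1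
    rw [planeEquiv_apply_one] at h2 ⊢
    rw [stress, hstrain _ hx']
    rw [planeEquiv.symm_apply_apply] at hz ⊢
    have h4 := norm_singularQ_sub_le hR hs hs1 (by linarith) ha hδ hqs hz h1 h2 hW.le (hb' _ hz).2
    rw [← hK] at h4
    set Q := singularQ a s q z
    set p := planePressure μ (fun z => singularPi a s q (bipolar a z)) (planeEquiv z)
    have h5 := (abs_re_le_norm _).trans h4
    have h6 := (abs_im_le_norm _).trans h4
    rw [sub_re, ofReal_re, sub_neg_eq_add] at h5
    rw [sub_im, ofReal_im, sub_zero] at h6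
    have hD : z.im ^ 2 + R * δ ≠ 0 := by positivity
    have h7 : -p • (1 : Matrix (Fin 2) (Fin 2) ℝ) + (2 * μ) • !![-Q.im, -Q.re; -Q.re, Q.im] -
        (μ * δ⁻¹ * (R * δ / (z.im ^ 2 + R * δ))) • !![(0 : ℝ), 1; 1, 0] =
        !![-p - 2 * μ * Q.im, -(2 * μ) * (Q.re + R / (2 * (z.im ^ 2 + R * δ)));
          -(2 * μ) * (Q.re + R / (2 * (z.im ^ 2 + R * δ))), -p + 2 * μ * Q.im] := by
      ext i j
      fin_cases i <;> fin_cases j <;> simp <;> field_simp <;> ring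
    rw [h7]
    have h8 : |2 * μ * Q.im| ≤ 2 * μ * (K / s) := by
      rw [abs_mul, abs_of_pos (by positivity : 0 < 2 * μ)]
      gcongr
    have h9 : |-(2 * μ) * (Q.re + R / (2 * (z.im ^ 2 + R * δ)))| ≤ 2 * μ * (K / s) := by
      rw [abs_mul, abs_neg, abs_of_pos (by positivity : 0 < 2 * μ)]
      gcongr
    have h10 : |-p - 2 * μ * Q.im| ≤ 4 * μ * ((1 / R + W) / s) + 2 * μ * (K / s) := by
      refine (abs_sub _ _).trans ?_
      rw [abs_neg]
      linarith
    have h11 : |-p + 2 * μ * Q.im| ≤ 4 * μ * ((1 / R + W) / s) + 2 * μ * (K / s) := by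
      refine (abs_add_le _ _).trans ?_
      rw [abs_neg]
      linarith
    refine (frobenius_norm_two_le _ _ h10 h9 h9 h11).trans ((le_of_eq ?_).trans
      (hC (8 * μ * (1 / R + W) + 8 * μ * K) s hs (by linarith)))
    ring

end

end

end StokesCylinders

end

/-! ### Return from the bipolar parameter s to δ -/

theorem proposition3p5 (μ R : ℝ) (hμ : 0 < μ) (hR : 0 < R) :
    ∃ δ₀ c C : ℝ, 0 < δ₀ ∧ 0 < c ∧ 0 < C ∧ ∀ δ : ℝ, 0 < δ → δ < δ₀ →
      ∃ (h₂ : StokesCylinders.Plane → StokesCylinders.Plane) (p₂ : StokesCylinders.Plane → ℝ),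
        StokesCylinders.IsSingularFunctionTwo μ R δ h₂ p₂ ∧
        (∀ (u : StokesCylinders.Plane → StokesCylinders.Plane) (p : StokesCylinders.Plane → ℝ),
          StokesCylinders.IsSingularFunctionTwo μ R δ u p →
            Set.EqOn u h₂ (closure (StokesCylinders.exteriorDomain R δ)) ∧
            Set.EqOn p p₂ (closure (StokesCylinders.exteriorDomain R δ))) ∧
        ENNReal.ofReal (c * δ⁻¹) ≤
          StokesCylinders.supNorm (StokesCylinders.exteriorDomain R δ)
            (StokesCylinders.strain h₂) ∧
        StokesCylinders.supNorm (StokesCylinders.exteriorDomain R δ)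
            (StokesCylinders.strain h₂) ≤ ENNReal.ofReal (C * δ⁻¹) ∧
        ENNReal.ofReal (c * δ ^ (-(1 / 2) : ℝ)) ≤
          StokesCylinders.supNorm (StokesCylinders.exteriorDomain R δ) p₂ ∧
        StokesCylinders.supNorm (StokesCylinders.exteriorDomain R δ) p₂ ≤
          ENNReal.ofReal (C * δ ^ (-(1 / 2) : ℝ)) ∧
        ∀ z ∈ StokesCylinders.narrowRegion R δ,
          ‖StokesCylinders.stress μ h₂ p₂ z -
              (μ * δ⁻¹ * (R * δ / (z 1 ^ 2 + R * δ))) • !![(0 : ℝ), 1; 1, 0]‖ ≤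
            C * δ ^ (-(1 / 2) : ℝ) := by
  obtain ⟨s₀, c, C, hs₀, hs1, hc, hC, h⟩ := StokesCylinders.exists_singularFunctionTwo_bounds hμ hR
  have hR2 : 0 < √R := Real.sqrt_pos.2 hR
  -- Since R s² ≤ δ ≤ 2R s², the bound δ < R s₀² yields s ≤ s₀. The minimum and maximum convert s⁻²
  -- into δ⁻¹ and s⁻¹ into δ^(−1/2) with one pair of constants.
  refine ⟨R * s₀ ^ 2, c * min R √R, C * max (2 * R) √(2 * R), by positivity, by positivity,
    by positivity, fun δ hδ hδ₀ => ?_⟩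
  obtain ⟨s, hs, hsδ⟩ := StokesCylinders.exists_bipolar_parameter hR hδ
  have hss : s ≤ s₀ := by
    have h1 := StokesCylinders.one_add_half_sq_le_cosh s
    refine le_of_sq_le_sq ?_ hs₀.le
    nlinarith
  obtain ⟨hδ1, hδ2⟩ := StokesCylinders.delta_bounds hR hs (hss.trans hs1) hsδ
  obtain ⟨u, p, hu, ⟨x, hx, hxl⟩, hE, ⟨y, hy, hyl⟩, hp, hst⟩ := h s δ hs hss hsδ
  have hδs : 0 < √δ := Real.sqrt_pos.2 hδ
  have k1 : c * min R √R * δ⁻¹ ≤ c / s ^ 2 := by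
    rw [← div_eq_mul_inv, div_le_div_iff₀ hδ (by positivity)]
    calc c * min R √R * s ^ 2 ≤ c * R * s ^ 2 := by gcongr; exact min_le_left _ _
      _ = c * (R * s ^ 2) := by ring
      _ ≤ c * δ := by gcongr
  have k2 : C / s ^ 2 ≤ C * max (2 * R) √(2 * R) * δ⁻¹ := by
    rw [← div_eq_mul_inv, div_le_div_iff₀ (by positivity) hδ]
    calc C * δ ≤ C * (2 * R * s ^ 2) := by gcongr
      _ = C * (2 * R) * s ^ 2 := by ring
      _ ≤ _ := by gcongr; exact le_max_left _ _
  have k3 : c * min R √R * δ ^ (-(1 / 2) : ℝ) ≤ c / s := by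
    have h1 : √R * s ≤ √δ := Real.le_sqrt_of_sq_le (by rwa [mul_pow, Real.sq_sqrt hR.le])
    rw [StokesCylinders.rpow_neg_half hδ, ← div_eq_mul_inv, div_le_div_iff₀ hδs hs]
    calc c * min R √R * s ≤ c * √R * s := by gcongr; exact min_le_right _ _
      _ = c * (√R * s) := by ring
      _ ≤ c * √δ := by gcongr
  have k4 : C / s ≤ C * max (2 * R) √(2 * R) * δ ^ (-(1 / 2) : ℝ) := by
    have h1 : √δ ≤ √(2 * R) * s := by
      refine Real.sqrt_le_iff.2 ⟨by positivity, ?_⟩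
      rwa [mul_pow, Real.sq_sqrt (by positivity)]
    rw [StokesCylinders.rpow_neg_half hδ, ← div_eq_mul_inv, div_le_div_iff₀ hs hδs]
    calc C * √δ ≤ C * (√(2 * R) * s) := by gcongr
      _ = C * √(2 * R) * s := by ring
      _ ≤ _ := by gcongr; exact le_max_right _ _
  exact ⟨u, p, hu, fun v r hv => hv.eqOn hμ hR hu, StokesCylinders.le_supNorm hx (k1.trans hxl),
    StokesCylinders.supNorm_le fun x hx => (hE x hx).trans k2, StokesCylinders.le_supNorm hy (k3.trans hyl),
    StokesCylinders.supNorm_le fun x hx => (hp x hx).trans k4, fun x hx => (hst x hx).trans k4⟩
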